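/- Write $|\cdot|$ for the Euclidean norm on $\mathbb R^2$, $e(x)=\exp(2\pi i x)$, $\mathbf x^\perp=(x_2,-x_1)$ for $\mathbf x=(x_1,x_2)$, and $\delta_{\mathbf n}=1$ if $\mathbf n=\mathbf 0$, $\delta_{\mathbf n}=0$ if $\mathbf n\in\mathbb Z^2\setminus\{\mathbf 0\}$. Here $\mathbb N=\{1,2,\dots\}$, and $\sum^*_{\mathbf a\bmod q}$ is the sum over $\mathbf a\in(\mathbb Z/q\mathbb Z)^2$ with $\gcd(\mathbf a,q)=1$. Fix non-negative smooth functions $\omega_0,\omega:\mathbb R\to\mathbb R$ with $\int\omega_0=\int\omega=1$, where $\omega_0$ is even with $\omega_0(0)=1$ and has compact support in $(-\tfrac12,\tfrac12)$, and $\omega$ has support in $(\tfrac12,1)$. All constants may depend on $\omega_0,\omega$. Put $c_\omega=\big(\int_{\mathbb R^2}\omega(|\mathbf x|)\,d\mathbf x\big)^{-1}$ and $$h(y,z)=\sum_{j\in\mathbb N}\frac1{yj}\Big(\omega(yj)-\omega\Big(\frac{|z|}{yj}\Big)\Big).$$ For real $Q\ge1$, $q,k\in\mathbb N$, $\mathbf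 r\in\mathbb Z^2$ and $\mathbf w\in\mathbb R^2$ put $$p_{1,q}(\mathbf w)=-\frac{2c_\omega}{Q}\int_{\mathbb R^2}\omega_0\Big(\frac{|\mathbf x|}{Q^{3/2}}\Big)\sum_{j\in\mathbb N}\frac1{q^2j^2}\,\omega\Big(\frac{|\mathbf x|}{jqQ^{1/2}}\Big)e(-\mathbf w\cdot\mathbf x)\,d\mathbf x,$$ $$p_{2,\mathbf r,k,q}(\mathbf w)=\frac{c_\omega}{Q^3}\int_{\mathbb R^2}\omega_0\Big(\frac{|\mathbf x|}{Q^{3/2}}\Big)h\Big(\frac{kq}{Q},\frac{\mathbf r\cdot\mathbf x}{Q^2}\Big)e(-\mathbf w\cdot\mathbf x)\,d\mathbf x.$$ For $\delta>0$ let $\mathfrak M_q=\{\mathbf w:|\mathbf w|<q^{-1}Q^{-1-\delta}\}$ if $1\le q\le Q^{1/2-\delta}$, and let $\mathfrak m_q=\{\mathbf w: q^{-1}Q^{-1-\delta}\le|\mathbf w|<q^{-1}Q^{-1/2+\delta}\}$ if $1\le q\le Q^{1/2-\delta}$ and $\mathfrak m_q=\{\mathbf w:|\mathbf w|<q^{-1}Q^{-1/2+\delta}\}$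 if $Q^{1/2-\delta}<q\le Q$. **Proposition.** (i) For every $N>0$, uniformly in $Q\ge1$, $1\le q\le Q$ and $\mathbf w\in\mathbb R^2$, $$p_{1,q}(\mathbf w)\ll_N\frac{Q}{q(1+|\mathbf w|Q^{3/2})}(1+|\mathbf w|qQ^{1/2})^{-N}.$$ (ii) For every $N>0$, uniformly in $Q\ge1$, $\mathbf r\in\mathbb Z^2$ with $Q^{1/2}/2\le|\mathbf r|\le Q^{1/2}$, $k,q\in\mathbb N$ and $\mathbf w\in\mathbb R^2$, $$p_{2,\mathbf r,k,q}(\mathbf w)\ll_N(1+|\mathbf w|kqQ^{1/2}+|\mathbf w\cdot\mathbf r^\perp|Q)^{-N}.$$ (iii) For every sufficiently small $\delta>0$ and every $N>0$, uniformly in $Q\ge1$ and $\mathbf n\in\mathbb Z^2$, $$\delta_{\mathbf n}=M+E_1+E_2+O_{N,\delta}(Q^{-\delta N}),$$ where $$M=\sum_{1\le q\le Q^{1/2-\delta}}\ \sum_{\mathbf a\bmod q}^{*}\int_{\mathfrak M_q}e((\mathbf a/q+\mathbf w)\cdot\mathbf n)\,d\mathbf w,$$ $$E_1=\sum_{1\le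 q\le Q}\ \sum_{\mathbf a\bmod q}^{*}\int_{\mathfrak m_q}p_{1,q}(\mathbf w)\,e((\mathbf a/q+\mathbf w)\cdot\mathbf n)\,d\mathbf w,$$ $$E_2=\sum_{\substack{d,k\in\mathbb N\\ \mathbf c\in\mathbb Z^2\text{ primitive}\\ \mathbf r=dk\mathbf c}}\omega\Big(\frac{|\mathbf r|}{Q^{1/2}}\Big)\sum_{\substack{1\le q\le Q/k\\ d\mid q\\ \gcd(q/d,k)=1}}\ \sum^{*}_{\substack{\mathbf a\bmod q\\ q\mid d\,\mathbf c\cdot\mathbf a^\perp}}\int_{\mathfrak m_q}p_{2,\mathbf r,k,q}(\mathbf w)\,e((\mathbf a/q+\mathbf w)\cdot\mathbf n)\,d\mathbf w.$$ -/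

import Mathlib

open MeasureTheory

noncomputable section

namespace DeltaSymbol

/-- The plane `ℝ²` with the Euclidean norm and Lebesgue measure. -/
abbrev Plane := EuclideanSpace ℝ (Fin 2)

/-- The vector of `ℝ²` with the given integer coordinates. -/
def vec (r : Fin 2 → ℤ) : Plane := WithLp.toLp 2 (fun i => (r i : ℝ))

/-- `x ↦ (x₂, -x₁)`. -/
def perp (x : Plane) : Plane := WithLp.toLp 2 ![x 1, -x 0]

/-- `e(x) = exp(2πix)`. -/
def e (x : ℝ) : ℂ := Complex.exp (2 * Real.pi * Complex.I * x)

/-- The two-dimensional delta symbol: `1` at the zero vector and `0` elsewhere. -/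
def delta (n : Fin 2 → ℤ) : ℂ := if n = 0 then 1 else 0

/-- The fixed weights: both are smooth, non-negative and of integral `1`; `ω₀` is even with
`ω₀(0) = 1` and compact support in `(-1/2, 1/2)`; `ω` has support in `(1/2, 1)`. -/
structure Weights (ω₀ ω : ℝ → ℝ) : Prop where
  smooth₀ : ContDiff ℝ (⊤ : ℕ∞) ω₀
  supp₀ : tsupport ω₀ ⊆ Set.Ioo (-(1 / 2)) (1 / 2)
  zero₀ : ω₀ 0 = 1
  even₀ : ∀ x, ω₀ (-x) = ω₀ x
  nonneg₀ : ∀ x, 0 ≤ ω₀ x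
  integral₀ : ∫ x, ω₀ x = 1
  smooth : ContDiff ℝ (⊤ : ℕ∞) ω
  supp : tsupport ω ⊆ Set.Ioo (1 / 2) 1
  nonneg : ∀ x, 0 ≤ ω x
  integral : ∫ x, ω x = 1

/-- The normalising constant `(∫_{ℝ²} ω(|x|) dx)⁻¹`. -/
def cst (ω : ℝ → ℝ) : ℝ := (∫ x : Plane, ω ‖x‖)⁻¹

/-- `h(y,z) = ∑_{j ≥ 1} (yj)⁻¹ (ω(yj) - ω(|z|/(yj)))`, a finite sum for every `y > 0`. -/
def h (ω : ℝ → ℝ) (y z : ℝ) : ℝ :=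
  ∑' j : ℕ+, 1 / (y * (j : ℝ)) * (ω (y * (j : ℝ)) - ω (|z| / (y * (j : ℝ))))

/-- The kernel `p_{1,q}`. The factor `2` accounts for the two primitive vectors `±c` orthogonal to
a given non-zero `n`, both of which occur in the sum over primitive vectors in `E2`. -/
def p1 (ω₀ ω : ℝ → ℝ) (Q : ℝ) (q : ℕ) (w : Plane) : ℂ :=
  -((2 * cst ω / Q : ℝ) : ℂ) * ∫ x : Plane,
    ((ω₀ (‖x‖ / Q ^ (3 / 2 : ℝ)) *
      ∑' j : ℕ+, 1 / ((q : ℝ) ^ 2 * (j : ℝ) ^ 2) * ω (‖x‖ / ((j : ℝ) * q * Q ^ (1 / 2 : ℝ))) : ℝ) : ℂ)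
      * e (-inner ℝ w x)

/-- The kernel `p_{2,r,k,q}`. -/
def p2 (ω₀ ω : ℝ → ℝ) (Q : ℝ) (r : Fin 2 → ℤ) (k q : ℕ) (w : Plane) : ℂ :=
  ((cst ω / Q ^ 3 : ℝ) : ℂ) * ∫ x : Plane,
    ((ω₀ (‖x‖ / Q ^ (3 / 2 : ℝ)) * h ω ((k : ℝ) * q / Q) (inner ℝ (vec r) x / Q ^ 2) : ℝ) : ℂ)
      * e (-inner ℝ w x)

/-- The major arc around the origin (used for `q ≤ Q^{1/2-δ}` only). -/
def majorArc (Q δ : ℝ) (q : ℕ) : Set Plane :=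
  {w | ‖w‖ < (q : ℝ)⁻¹ * Q ^ (-1 - δ)}

/-- The minor arc around the origin. -/
def minorArc (Q δ : ℝ) (q : ℕ) : Set Plane :=
  {w | ‖w‖ < (q : ℝ)⁻¹ * Q ^ (-(1 / 2) + δ) ∧
    ((q : ℝ) ≤ Q ^ (1 / 2 - δ) → (q : ℝ)⁻¹ * Q ^ (-1 - δ) ≤ ‖w‖)}

/-- Representatives of the vectors `a mod q` with `gcd(a, q) = 1`. -/
def reduced (q : ℕ) : Finset (Fin 2 → ℕ) :=
  (Fintype.piFinset fun _ => Finset.range q).filter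
    (fun a => Nat.gcd (Nat.gcd (a 0) (a 1)) q = 1)

/-- `e((a/q + w) · n)`. -/
def phase (n : Fin 2 → ℤ) (q : ℕ) (a : Fin 2 → ℕ) (w : Plane) : ℂ :=
  e (∑ i, ((a i : ℝ) / q + w i) * n i)

/-- The major arc term. -/
def M (Q δ : ℝ) (n : Fin 2 → ℤ) : ℂ :=
  ∑ q ∈ Finset.Icc 1 ⌊Q ^ (1 / 2 - δ)⌋₊, ∑ a ∈ reduced q,
    ∫ w in majorArc Q δ q, phase n q a w

/-- The minor arc term with the kernels `p_{1,q}`. -/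
def E1 (ω₀ ω : ℝ → ℝ) (Q δ : ℝ) (n : Fin 2 → ℤ) : ℂ :=
  ∑ q ∈ Finset.Icc 1 ⌊Q⌋₊, ∑ a ∈ reduced q,
    ∫ w in minorArc Q δ q, p1 ω₀ ω Q q w * phase n q a w

/-- Primitive integer vectors. -/
abbrev Primitive := {c : Fin 2 → ℤ // IsCoprime (c 0) (c 1)}

/-- The minor arc term with the kernels `p_{2,r,k,q}`, where `r = dkc`. Only finitely many
`(d, k, c)` contribute, because `ω(|r|/Q^{1/2}) = 0` unless `|r| < Q^{1/2}`. -/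
def E2 (ω₀ ω : ℝ → ℝ) (Q δ : ℝ) (n : Fin 2 → ℤ) : ℂ :=
  ∑' t : ℕ+ × ℕ+ × Primitive,
    let d : ℕ := t.1
    let k : ℕ := t.2.1
    let c : Fin 2 → ℤ := t.2.2
    let r : Fin 2 → ℤ := fun i => (d : ℤ) * k * c i
    (ω (‖vec r‖ / Q ^ (1 / 2 : ℝ)) : ℂ) *
      ∑ q ∈ (Finset.Icc 1 ⌊Q / k⌋₊).filter (fun q => d ∣ q ∧ Nat.gcd (q / d) k = 1),
        ∑ a ∈ (reduced q).filter
            (fun a => (q : ℤ) ∣ (d : ℤ) * (c 0 * (a 1 : ℤ) - c 1 * (a 0 : ℤ))),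
          ∫ w in minorArc Q δ q, p2 ω₀ ω Q r k q w * phase n q a w

end DeltaSymbol

end

/-!
The decomposition rests on divisor switching. A nonzero vector `n ∈ ℤ²` can be written as an integer
multiple of `r^⊥` exactly for the vectors `r = ±n^⊥/D`, where `D` runs through the common divisors
of the coordinates of `n`, so that
`∑_r ω(|r|/Q^{1/2}) 1[n ∈ ℤ r^⊥] = 2 ∑_{D ∣ n} ω(|n|/(D Q^{1/2}))`
(`sum_multiple_perp`). For `n = 0` the right-hand side vanishes, since `ω(0) = 0`, while
the left-hand side is the sum over all `r`, which is asymptotic to `Q/c_ω`. Hence `c_ω/Q` times the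
difference of the two sides is `δ_n` up to a negligible error.

The condition `n ∈ ℤ r^⊥` is detected by a delta symbol in one variable. If `l` is the greatest
common divisor of the coordinates of `r`, the sum of `h(lcm(q,l)/Q, r·n/Q²) e(a·n/q)` over the
reduced fractions `a/q` with `q ∣ r·a^⊥` is supported on `n ∈ ℤ r^⊥` (`Weights.sum_reduced_h`):
summing over the `q` that divide a given `D` produces all vectors modulo `D`, orthogonality leaves a
divisibility condition on `r·n`, and for `r·n ≠ 0` complementary divisors cancel because `h` is a
difference. The condition `D ∣ n` is detected by additive characters (`sum_reduced_e`). In both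
cases the weight in `n` is a smooth function of compact support, whose Fourier transform is
`p_{1,q}` or `p_{2,r,k,q}`, and Fourier inversion turns the expansion into integrals over the whole
plane for each `a/q` (`synthesis`, `Weights.exists_norm_synthesis_sub_delta_le`). The factorisation
`r = d k c` of `E_2` is recovered from `d = gcd(q, l)` and `k = l/d` (`Weights.E2_eq`).

The kernels are estimated after rescaling. The first is `-2c_ω ∑_j g(jq/Q)` for a smooth function
`g` of one variable with rapidly decaying Fourier transform (`ray`); for the second, integration
over the lines `r·x = const` (`slice`, `smear`) gives a sum of the same kind in one variable. Direct
estimation of the sums, and in the second case Poisson summation when the frequencies are small,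
gives the decay of the kernels (`Weights.exists_norm_p1_le`, `Weights.exists_norm_p2_le`); hence the
plane may be cut off at `|w| < q⁻¹Q^{-1/2+δ}`. On the major arcs Poisson summation gives main terms:
`1 - c_ω(Q/q) ĝ(0)` for `p_{1,q}`, and `c_ω T(r/Q^{1/2})` with a function `T` on the plane (`star`)
for `p_{2,r,k,q}` with its weight `ω(|r|/Q^{1/2})`. Poisson summation over the lattice of all `r`
with `q ∣ r·a^⊥`, which has index `q`, turns the sum of the values of `T` into `(Q/q) T̂(0)`, and
`T̂(0) = ĝ(0)` (`Weights.fourier_star_zero`). Thus all kernels together are `1` up to a negligible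
error (`Weights.exists_norm_kernel_sub_one_le`), and the major arcs contribute `M`.
-/

open MeasureTheory

namespace DeltaSymbol

open FourierTransform Filter Topology

/-! ### Smooth even functions of the norm -/

/-- The moments `∫₀¹ tᵏ g(tx) dt` of the dilates of a smooth function are smooth in `x`. -/
theorem contDiff_integral_dilate (n : ℕ) : ∀ (k : ℕ) (g : ℝ → ℝ), ContDiff ℝ (⊤ : ℕ∞) g →
    ContDiff ℝ n (fun x => ∫ t in (0 : ℝ)..1, t ^ k * g (t * x)) := by
  induction n with
  | zero =>
    intro k g hg
    have := hg.continuous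
    rw [Nat.cast_zero, contDiff_zero]
    exact intervalIntegral.continuous_parametric_intervalIntegral_of_continuous' (by fun_prop) _ _
  | succ n ih =>
    intro k g hg
    have hg' : ContDiff ℝ (⊤ : ℕ∞) (deriv g) := (contDiff_infty_iff_deriv.1 hg).2
    have hc := hg.continuous
    have hc' := hg'.continuous
    have key : ∀ x, HasDerivAt (fun x => ∫ t in (0 : ℝ)..1, t ^ k * g (t * x))
        (∫ t in (0 : ℝ)..1, t ^ (k + 1) * deriv g (t * x)) x := by
      intro x
      obtain ⟨B, hB⟩ :=
        (isCompact_Icc (a := -(|x| + 1)) (b := |x| + 1)).exists_bound_of_continuousOn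
        hc'.continuousOn
      refine (intervalIntegral.hasDerivAt_integral_of_dominated_loc_of_deriv_le
        (F' := fun x t => t ^ (k + 1) * deriv g (t * x)) (bound := fun _ => B)
        (Metric.ball_mem_nhds x one_pos) ?_ ?_ ?_ ?_ ?_ ?_).2
      · exact Eventually.of_forall fun y => (by fun_prop : Continuous _).aestronglyMeasurable
      · exact (by fun_prop : Continuous _).intervalIntegrable _ _
      · exact (by fun_prop : Continuous _).aestronglyMeasurable
      · refine Eventually.of_forall fun t ht y hy => ?_
        rw [Set.uIoc_of_le zero_le_one] at ht
        have hy' : |y| ≤ |x| + 1 := by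
          have := abs_sub_abs_le_abs_sub y x
          rw [Metric.mem_ball, Real.dist_eq] at hy
          linarith
        have h1 : |t * y| ≤ |x| + 1 := by
          rw [abs_mul, abs_of_pos ht.1]
          nlinarith [ht.2, abs_nonneg y, abs_nonneg x]
        have h2 := hB (t * y) (abs_le.1 h1)
        rw [norm_mul, norm_pow, Real.norm_of_nonneg ht.1.le]
        have h3 : t ^ (k + 1) ≤ 1 := pow_le_one₀ ht.1.le ht.2
        nlinarith [norm_nonneg (deriv g (t * y))]
      · exact intervalIntegrable_const
      · refine Eventually.of_forall fun t _ y _ => ?_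
        have h1 : HasDerivAt g (deriv g (t * y)) (t * y) :=
          (hg.differentiable (by simp)).differentiableAt.hasDerivAt
        have h2 := (h1.comp y ((hasDerivAt_id y).const_mul t)).const_mul (t ^ k)
        convert! h2 using 1
        ring
    rw [Nat.cast_succ, contDiff_succ_iff_deriv]
    refine ⟨fun x => (key x).differentiableAt, by simp, ?_⟩
    rw [funext fun x => (key x).deriv]
    exact ih (k + 1) _ hg'

/-- A smooth even function of the norm is smooth, also at the origin: its derivative at `u` is
`L(‖u‖) ⟨u, ·⟩`, where `L(x) = f'(x)/x` is again smooth and even. -/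
theorem contDiff_comp_norm {E : Type*} [NormedAddCommGroup E] [InnerProductSpace ℝ E] (n : ℕ) :
    ∀ f : ℝ → ℝ, ContDiff ℝ (⊤ : ℕ∞) f → (∀ x, f (-x) = f x) →
      ContDiff ℝ n (fun u : E => f ‖u‖) := by
  induction n with
  | zero =>
    intro f hf _
    rw [Nat.cast_zero, contDiff_zero]
    exact hf.continuous.comp continuous_norm
  | succ n ih =>
    intro f hf he
    have hf1 : ContDiff ℝ (⊤ : ℕ∞) (deriv f) := (contDiff_infty_iff_deriv.1 hf).2
    have hf2 : ContDiff ℝ (⊤ : ℕ∞) (deriv (deriv f)) := (contDiff_infty_iff_deriv.1 hf1).2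
    have hodd : ∀ x, deriv f (-x) = -deriv f x := by
      intro x
      have h1 : (fun x => f (-x)) = f := funext he
      have h2 := deriv_comp_neg f x
      rw [h1] at h2
      linarith
    have heven : ∀ x, deriv (deriv f) (-x) = deriv (deriv f) x := by
      intro x
      have h1 : (fun x => deriv f (-x)) = -deriv f := funext hodd
      have h2 := deriv_comp_neg (deriv f) x
      rw [h1, deriv.neg] at h2
      linarith
    -- The odd function `deriv f`, divided by its argument, is an average of its derivative.
    set l : ℝ → ℝ := fun x => ∫ t in (0 : ℝ)..1, t ^ 0 * deriv (deriv f) (t * x) with hl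
    have hl_smooth : ContDiff ℝ (⊤ : ℕ∞) l :=
      contDiff_infty.2 fun m => contDiff_integral_dilate m 0 _ hf2
    have hl_even : ∀ x, l (-x) = l x := by
      intro x
      simp only [hl, mul_neg, heven]
    have h0 : deriv f 0 = 0 := by
      have := hodd 0
      rw [neg_zero] at this
      linarith
    have hl_mul : ∀ x, deriv f x = x * l x := by
      intro x
      have := intervalIntegral.integral_unitInterval_deriv_eq_sub (𝕜 := ℝ) (f := deriv f)
        (f' := deriv (deriv f)) (z₀ := 0) (z₁ := x) (by
          have := hf2.continuous
          fun_prop) (fun t _ =>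
            (hf1.differentiable (by simp)).differentiableAt.hasDerivAt)
      simpa [hl, h0] using this.symm
    have key : ∀ u : E, HasFDerivAt (fun u : E => f ‖u‖) (l ‖u‖ • innerSL ℝ u) u := by
      intro u
      by_cases hu : u = 0
      · subst hu
        have h1 : HasDerivAt f 0 0 := by
          have := (hf.differentiable (by simp)).differentiableAt.hasDerivAt (x := (0 : ℝ))
          rwa [h0] at this
        rw [hasDerivAt_iff_isLittleO] at h1
        rw [hasFDerivAt_iff_isLittleO]
        have h2 : Tendsto (fun u : E => ‖u‖) (𝓝 0) (𝓝 0) := by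
          simpa using (continuous_norm (E := E)).tendsto 0
        have h3 := h1.comp_tendsto h2
        simp only [map_zero, smul_zero, sub_zero, Function.comp_def, norm_zero] at h3 ⊢
        exact Asymptotics.IsLittleO.of_norm_right (by simpa using h3)
      · have h1 : HasDerivAt f (deriv f ‖u‖) ‖u‖ :=
          (hf.differentiable (by simp)).differentiableAt.hasDerivAt
        have h2 : HasFDerivAt (fun u : E => ‖u‖) (‖u‖⁻¹ • innerSL ℝ u) u := by
          have h3 := (hasStrictFDerivAt_norm_sq u).hasFDerivAt.sqrt (by simpa using hu)
          simp only [Real.sqrt_sq (norm_nonneg _)] at h3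
          convert! h3 using 1
          ext v
          simp
          field_simp
        have h3 := h1.comp_hasFDerivAt u h2
        convert! h3 using 1
        rw [hl_mul, smul_smul]
        congr 1
        have : ‖u‖ ≠ 0 := norm_ne_zero_iff.2 hu
        field_simp
    rw [Nat.cast_succ, contDiff_succ_iff_hasFDerivAt]
    refine ⟨_, ?_, key⟩
    exact (ih l hl_smooth hl_even).smul (innerSL ℝ).contDiff

/-! ### The additive character and Fourier transforms -/

theorem e_eq_fourierChar (x : ℝ) : e x = (Real.fourierChar x : ℂ) := by
  rw [e, Real.fourierChar_apply]
  congr 1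
  push_cast
  ring

@[simp] theorem norm_e (x : ℝ) : ‖e x‖ = 1 := by
  rw [e_eq_fourierChar]
  exact Circle.norm_coe _

theorem e_add (x y : ℝ) : e (x + y) = e x * e y := by
  rw [e, e, e, ← Complex.exp_add]
  push_cast
  ring_nf

@[simp] theorem e_zero : e 0 = 1 := by simp [e]

@[simp] theorem e_intCast (m : ℤ) : e m = 1 := by
  rw [e, Complex.exp_eq_one_iff]
  exact ⟨m, by push_cast; ring⟩

@[fun_prop] theorem continuous_e : Continuous e := by
  unfold e
  fun_prop

section Fourier

variable {V : Type*} [NormedAddCommGroup V] [InnerProductSpace ℝ V] [FiniteDimensional ℝ V]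
  [MeasurableSpace V] [BorelSpace V]

theorem fourier_eq_integral (f : V → ℂ) (w : V) : 𝓕 f w = ∫ v, f v * e (-inner ℝ v w) := by
  rw [Real.fourier_eq]
  congr 1
  ext v
  rw [Circle.smul_def, smul_eq_mul, mul_comm, e_eq_fourierChar]

theorem fourierInv_eq_integral (f : V → ℂ) (w : V) : 𝓕⁻ f w = ∫ v, f v * e (inner ℝ v w) := by
  rw [Real.fourierInv_eq]
  congr 1
  ext v
  rw [Circle.smul_def, smul_eq_mul, mul_comm, e_eq_fourierChar]

theorem exists_fourier_decay {f : V → ℂ} (hf : ContDiff ℝ (⊤ : ℕ∞) f)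
    (hs : HasCompactSupport f) (N : ℕ) :
    ∃ C, 0 ≤ C ∧ ∀ ξ, ‖𝓕 f ξ‖ ≤ C / (1 + ‖ξ‖) ^ N := by
  set φ := 𝓕 (hs.toSchwartzMap hf) with hφ
  have h : ∀ ξ, 𝓕 f ξ = φ ξ := by
    intro ξ
    rw [hφ, SchwartzMap.fourier_coe]
    rfl
  refine ⟨2 ^ N * (Finset.Iic (N, 0)).sup (fun m => SchwartzMap.seminorm ℝ m.1 m.2) φ,
    by positivity, fun ξ => ?_⟩
  have := SchwartzMap.one_add_le_sup_seminorm_apply (𝕜 := ℝ) (m := (N, 0)) (k := N) (n := 0)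
    le_rfl le_rfl φ ξ
  rw [norm_iteratedFDeriv_zero] at this
  rw [h, le_div_iff₀ (by positivity), mul_comm]
  exact this

theorem continuous_fourier {f : V → ℂ} (hf : Integrable f) : Continuous (𝓕 f) :=
  VectorFourier.fourierIntegral_continuous Real.continuous_fourierChar
    (by exact continuous_inner) hf

theorem integrable_of_decay {g : V → ℂ} (hg : AEStronglyMeasurable g) {C : ℝ} {N : ℕ}
    (hN : Module.finrank ℝ V < N) (h : ∀ ξ, ‖g ξ‖ ≤ C / (1 + ‖ξ‖) ^ N) : Integrable g := by
  have h1 := (integrable_one_add_norm (μ := (volume : Measure V)) (r := N)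
    (by exact_mod_cast hN)).const_mul C
  refine h1.mono' hg (Eventually.of_forall fun ξ => (h ξ).trans_eq ?_)
  rw [Real.rpow_neg (by positivity), Real.rpow_natCast, div_eq_mul_inv]

/-- Fourier inversion for continuous integrable functions whose transform decays. -/
theorem eq_integral_fourier {f : V → ℂ} (hc : Continuous f) (hi : Integrable f) {C : ℝ} {N : ℕ}
    (hN : Module.finrank ℝ V < N) (h : ∀ ξ, ‖𝓕 f ξ‖ ≤ C / (1 + ‖ξ‖) ^ N) (x : V) :
    f x = ∫ ξ, 𝓕 f ξ * e (inner ℝ ξ x) := by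
  have h1 : Integrable (𝓕 f) :=
    integrable_of_decay (continuous_fourier hi).aestronglyMeasurable hN h
  rw [← fourierInv_eq_integral, hc.fourierInv_fourier_eq hi h1]

end Fourier

/-! ### Poisson summation on the line -/

/-- Poisson summation for a continuous function of compact support whose Fourier transform decays
quadratically; the transform is summable over the integers. -/
theorem poisson_line {f : ℝ → ℂ} (hc : Continuous f) {R : ℝ} (hR : ∀ x, R ≤ |x| → f x = 0)
    {K : ℝ} (hK : ∀ m : ℤ, m ≠ 0 → ‖𝓕 f m‖ ≤ K / |(m : ℝ)| ^ 2) :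
    Summable (fun m : ℤ => 𝓕 f m) ∧ ∑' j : ℤ, f j = ∑' m : ℤ, 𝓕 f m := by
  have hs : Summable (fun m : ℤ => 𝓕 f m) := by
    have h1 : Summable (fun m : ℤ => K / |(m : ℝ)| ^ 2) := by
      have := (Real.summable_one_div_int_pow (p := 2)).2 one_lt_two
      simpa [div_eq_mul_inv] using this.mul_left K
    refine (summable_congr_cofinite ?_).1 (h1.of_norm_bounded_eventually
      (f := fun m : ℤ => 𝓕 f m) ?_)
    · exact Eventually.of_forall fun _ => rfl
    · filter_upwards [(Set.finite_singleton (0 : ℤ)).compl_mem_cofinite] with m hm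
      exact hK m hm
  refine ⟨hs, ?_⟩
  have hO : f =O[cocompact ℝ] (fun x : ℝ => |x| ^ (-2 : ℝ)) := by
    refine Asymptotics.IsBigO.of_bound 1 ?_
    filter_upwards [tendsto_norm_cocompact_atTop.eventually_ge_atTop R] with x hx
    rw [hR x hx]
    simp only [norm_zero, one_mul]
    positivity
  have := Real.tsum_eq_tsum_fourier_of_rpow_decay_of_summable hc one_lt_two hO hs 0
  simpa using this

theorem fourier_comp_mul (f : ℝ → ℂ) {y : ℝ} (hy : 0 < y) (ξ : ℝ) :
    𝓕 (fun x => f (y * x)) ξ = (y⁻¹ : ℝ) * 𝓕 f (ξ / y) := by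
  rw [fourier_eq_integral, fourier_eq_integral]
  have := Measure.integral_comp_mul_left (fun x => f x * e (-inner ℝ x (ξ / y))) y
  rw [abs_of_pos (inv_pos.2 hy), Complex.real_smul] at this
  rw [← this]
  congr 1
  ext x
  congr 3
  simp
  field_simp

/-- A universal bound for `∑_{m ≠ 0} |m|^{-n}`, `n ≥ 2`. -/
theorem tsum_int_le {n : ℕ} (hn : 2 ≤ n) {g : ℤ → ℂ} (hg0 : g 0 = 0) {K : ℝ}
    (hg : ∀ m : ℤ, m ≠ 0 → ‖g m‖ ≤ K / |(m : ℝ)| ^ n) :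
    ‖∑' m, g m‖ ≤ (∑' m : ℤ, 1 / |(m : ℝ)| ^ 2) * K := by
  have hs : Summable (fun m : ℤ => 1 / |(m : ℝ)| ^ 2) := by
    have := (Real.summable_one_div_int_pow (p := 2)).2 one_lt_two
    simpa using this
  have hK : 0 ≤ K := by
    have := (norm_nonneg _).trans (hg 1 one_ne_zero)
    simpa using this
  refine tsum_of_norm_bounded (hs.hasSum.mul_right K) fun m => ?_
  by_cases hm : m = 0
  · rw [hm, hg0, norm_zero]
    positivity
  · refine (hg m hm).trans ?_
    have h1 : (1 : ℝ) ≤ |(m : ℝ)| := by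
      exact_mod_cast Int.one_le_abs hm
    rw [one_div, mul_comm, ← div_eq_mul_inv]
    gcongr

/-- The constant `∑_{m ≠ 0} m⁻²`. -/
noncomputable def zetaTwo : ℝ := ∑' m : ℤ, 1 / |(m : ℝ)| ^ 2

theorem zetaTwo_nonneg : 0 ≤ zetaTwo := tsum_nonneg fun _ => by positivity

/-- Half of Poisson summation for an even function sampled at step `y`: up to the contribution of
the non-zero frequencies, `∑_{j ≥ 1} f(yj)` is `f̂(0)/(2y) - f(0)/2`. -/
theorem norm_tsum_pnat_sub_le {f : ℝ → ℂ} (hc : Continuous f) (he : ∀ x, f (-x) = f x)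
    {R : ℝ} (hR : ∀ x, R ≤ |x| → f x = 0) {y : ℝ} (hy : 0 < y) {N : ℕ} {K : ℝ}
    (hK : ∀ ξ : ℝ, 1 / y ≤ |ξ| → ‖𝓕 f ξ‖ ≤ K / |ξ| ^ (N + 2)) :
    ‖∑' j : ℕ+, f (y * (j : ℝ)) - (𝓕 f 0 / (2 * y) - f 0 / 2)‖ ≤ zetaTwo * K * y ^ (N + 1) := by
  set g : ℝ → ℂ := fun x => f (y * x) with hg
  have hgc : Continuous g := by fun_prop
  have hgR : ∀ x, R / y ≤ |x| → g x = 0 := by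
    intro x hx
    apply hR
    rw [abs_mul, abs_of_pos hy]
    rwa [div_le_iff₀' hy] at hx
  have hgF : ∀ m : ℤ, m ≠ 0 → ‖𝓕 g m‖ ≤ K * y ^ (N + 1) / |(m : ℝ)| ^ (N + 2) := by
    intro m hm
    have h1 : (1 : ℝ) ≤ |(m : ℝ)| := by
      exact_mod_cast Int.one_le_abs hm
    rw [hg, fourier_comp_mul f hy, norm_mul, Complex.norm_real, Real.norm_of_nonneg (by positivity)]
    have h2 := hK (m / y) (by rw [abs_div, abs_of_pos hy]; gcongr)
    calc _ ≤ y⁻¹ * (K / |m / y| ^ (N + 2)) := by gcongr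
      _ = _ := by
        rw [abs_div, abs_of_pos hy, div_pow]
        field_simp
        ring
  have hK0 : 0 ≤ K := by
    have h1 := (norm_nonneg _).trans (hK (1 / y) (le_abs_self _))
    rw [abs_of_pos (by positivity)] at h1
    by_contra! hneg
    exact absurd h1 (not_le.2 (div_neg_of_neg_of_pos hneg (by positivity)))
  have hgF2 : ∀ m : ℤ, m ≠ 0 → ‖𝓕 g m‖ ≤ K * y ^ (N + 1) / |(m : ℝ)| ^ 2 := by
    intro m hm
    have h1 : (1 : ℝ) ≤ |(m : ℝ)| := by
      exact_mod_cast Int.one_le_abs hm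
    refine (hgF m hm).trans ?_
    gcongr
    omega
  obtain ⟨hsum, hpo⟩ := poisson_line hgc hgR hgF2
  have hgs : Summable (fun j : ℤ => g j) := by
    refine summable_of_hasFiniteSupport ?_
    refine (Set.finite_Icc (-⌈R / y⌉) ⌈R / y⌉).subset fun j hj => ?_
    have h1 : |(j : ℝ)| < R / y := by
      by_contra! h
      exact hj (hgR _ h)
    have h2 := abs_lt.1 (h1.trans_le (Int.le_ceil _))
    exact ⟨by exact_mod_cast h2.1.le, by exact_mod_cast h2.2.le⟩
  have hsplit : ∑' j : ℤ, g j = g 0 + 2 * ∑' j : ℕ+, g j := by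
    have h1 := tsum_int_eq_zero_add_two_mul_tsum_pnat (f := fun j : ℤ => g j)
      (fun j => by simp [hg, he]) hgs
    simpa using h1
  have hF : ∑' m : ℤ, 𝓕 g m = 𝓕 g 0 + ∑' m : ℤ, (if m = 0 then 0 else 𝓕 g m) := by
    have h1 := hsum.tsum_eq_add_tsum_ite 0
    simpa using h1
  have hF0 : 𝓕 g 0 = 𝓕 f 0 / y := by
    rw [hg, fourier_comp_mul f hy]
    simp [div_eq_mul_inv, mul_comm]
  have hg0 : g 0 = f 0 := by simp [hg]
  have htail : ‖∑' m : ℤ, (if m = 0 then 0 else 𝓕 g m)‖ ≤ zetaTwo * (K * y ^ (N + 1)) :=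
    tsum_int_le (n := N + 2) (by omega) (by simp) fun m hm => by
      rw [if_neg hm]; exact hgF m hm
  have heq : ∑' j : ℕ+, f (y * (j : ℝ)) - (𝓕 f 0 / (2 * y) - f 0 / 2) =
      (∑' m : ℤ, (if m = 0 then 0 else 𝓕 g m)) / 2 := by
    have h3 : ∑' j : ℕ+, g j =
        ((𝓕 f 0 / y + ∑' m : ℤ, (if m = 0 then 0 else 𝓕 g m)) - f 0) / 2 := by
      rw [← hF0, ← hF, ← hpo, hsplit, hg0]
      ring
    have h4 : ∑' j : ℕ+, f (y * (j : ℝ)) = ∑' j : ℕ+, g j := rfl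
    rw [h4, h3]
    have : (y : ℂ) ≠ 0 := by exact_mod_cast hy.ne'
    field_simp
    ring
  rw [heq, norm_div]
  have : ‖(2 : ℂ)‖ = 2 := by simp
  rw [this]
  have h0 : 0 ≤ zetaTwo * (K * y ^ (N + 1)) := (norm_nonneg _).trans htail
  calc _ ≤ zetaTwo * (K * y ^ (N + 1)) / 2 := by gcongr
    _ ≤ zetaTwo * (K * y ^ (N + 1)) := by linarith
    _ = _ := by ring

/-! ### Linear coordinates and Poisson summation on the plane -/

/-- The point of the plane with given coordinates. -/
def pt (x y : ℝ) : Plane := WithLp.toLp 2 ![x, y]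

@[simp] theorem pt_zero (x y : ℝ) : pt x y 0 = x := rfl
@[simp] theorem pt_one (x y : ℝ) : pt x y 1 = y := rfl

theorem plane_ext {u v : Plane} (h0 : u 0 = v 0) (h1 : u 1 = v 1) : u = v := by
  ext i
  fin_cases i
  · exact h0
  · exact h1

theorem inner_plane (u v : Plane) : inner ℝ u v = u 0 * v 0 + u 1 * v 1 := by
  simp [PiLp.inner_apply, Fin.sum_univ_two, mul_comm]

theorem norm_sq_plane (u : Plane) : ‖u‖ ^ 2 = u 0 ^ 2 + u 1 ^ 2 := by
  simp [EuclideanSpace.norm_sq_eq, Fin.sum_univ_two]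

theorem abs_coord_le (u : Plane) (i : Fin 2) : |u i| ≤ ‖u‖ := PiLp.norm_apply_le u i

theorem continuous_pt : Continuous fun p : ℝ × ℝ => pt p.1 p.2 := by
  unfold pt
  refine (PiLp.continuous_toLp 2 _).comp (continuous_pi fun i => ?_)
  fin_cases i
  · exact continuous_fst
  · exact continuous_snd

/-- A pair of vectors spanning a parallelogram of area `1` gives volume-preserving coordinates. -/
theorem measurePreserving_coords {α β : Plane} (h : |α 0 * β 1 - α 1 * β 0| = 1) :
    MeasurePreserving (fun p : ℝ × ℝ => p.1 • α + p.2 • β) := by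
  set A : Matrix (Fin 2) (Fin 2) ℝ := !![α 0, β 0; α 1, β 1] with hA
  have hdet : |A.det| = 1 := by
    rw [hA, Matrix.det_fin_two_of, ← h]
    congr 1
    ring
  have h0 : A.det ≠ 0 := by
    intro h0
    rw [h0] at hdet
    simp at hdet
  have h1 : MeasurePreserving (Matrix.toLin' A) := by
    refine ⟨(LinearMap.continuous_of_finiteDimensional _).measurable, ?_⟩
    rw [Real.map_matrix_volume_pi_eq_smul_volume_pi h0, abs_inv, hdet]
    simp
  have h2 := (PiLp.volume_preserving_toLp (Fin 2)).comp
    (h1.comp (volume_preserving_finTwoArrow ℝ).symm)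
  convert! h2 using 1
  ext p i
  fin_cases i <;> simp [hA, MeasurableEquiv.finTwoArrow]

theorem integral_coords {α β : Plane} (h : |α 0 * β 1 - α 1 * β 0| = 1) {f : Plane → ℂ}
    (hf : Integrable f) : ∫ x, f x = ∫ z : ℝ, ∫ s : ℝ, f (z • α + s • β) := by
  have hm := measurePreserving_coords h
  have hi : Integrable (fun p : ℝ × ℝ => f (p.1 • α + p.2 • β)) :=
    hm.integrable_comp_of_integrable hf
  rw [← integral_prod _ hi, ← Measure.volume_eq_prod]
  have h1 : AEStronglyMeasurable f (Measure.map (fun p : ℝ × ℝ => p.1 • α + p.2 • β) volume) := by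
    rw [hm.map_eq]
    exact hf.aestronglyMeasurable
  rw [← integral_map hm.measurable.aemeasurable h1, hm.map_eq]

theorem smul_add_smul_eq_pt (x y : ℝ) : x • pt 1 0 + y • pt 0 1 = pt x y := by
  apply plane_ext <;> simp

theorem integral_plane {f : Plane → ℂ} (hf : Integrable f) :
    ∫ x, f x = ∫ x : ℝ, ∫ y : ℝ, f (pt x y) := by
  rw [integral_coords (α := pt 1 0) (β := pt 0 1) (by simp) hf]
  simp only [smul_add_smul_eq_pt]

theorem integrable_of_continuous_of_eq_zero {V : Type*} [NormedAddCommGroup V] [ProperSpace V]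
    [MeasurableSpace V] [BorelSpace V] {μ : Measure V} [IsFiniteMeasureOnCompacts μ] {f : V → ℂ}
    (hc : Continuous f) {R : ℝ} (hR : ∀ x, R ≤ ‖x‖ → f x = 0) : Integrable f μ := by
  refine hc.integrable_of_hasCompactSupport ?_
  refine HasCompactSupport.intro (isCompact_closedBall (0 : V) R) fun x hx => hR x ?_
  rw [mem_closedBall_zero_iff, not_le] at hx
  exact hx.le

/-- Poisson summation on `ℤ²`, as an iterated sum. -/
theorem poisson_plane_iterated {T : Plane → ℂ} (hc : Continuous T) {R : ℝ}
    (hR : ∀ x, R ≤ ‖x‖ → T x = 0) {K : ℝ} (hK : ∀ ξ, ‖𝓕 T ξ‖ ≤ K / (1 + ‖ξ‖) ^ 4) :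
    ∑' i : ℤ, ∑' j : ℤ, T (pt i j) = ∑' i : ℤ, ∑' j : ℤ, 𝓕 T (pt i j) := by
  have hK0 : 0 ≤ K := by
    have := (norm_nonneg _).trans (hK 0)
    simpa using this
  have hTi : Integrable T := integrable_of_continuous_of_eq_zero hc hR
  have hR1 : ∀ x y : ℝ, R ≤ |x| → T (pt x y) = 0 := fun x y h =>
    hR _ (h.trans (abs_coord_le (pt x y) 0))
  have hR2 : ∀ x y : ℝ, R ≤ |y| → T (pt x y) = 0 := fun x y h =>
    hR _ (h.trans (abs_coord_le (pt x y) 1))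
  have hcp : Continuous fun p : ℝ × ℝ => T (pt p.1 p.2) := hc.comp continuous_pt
  -- the partial transform in the first variable
  set B : ℝ → ℝ → ℂ := fun ξ y => 𝓕 (fun x => T (pt x y)) ξ with hB
  have hBint : ∀ ξ y, B ξ y = ∫ x : ℝ, T (pt x y) * e (-(x * ξ)) := by
    intro ξ y
    rw [hB]
    simp only [fourier_eq_integral]
    congr 1
    ext x
    simp [mul_comm]
  have hBc : ∀ ξ, Continuous (B ξ) := by
    intro ξ
    rw [funext (hBint ξ)]
    have h1 : Continuous fun p : ℝ × ℝ => T (pt p.2 p.1) * e (-(p.2 * ξ)) := by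
      have : Continuous fun p : ℝ × ℝ => T (pt p.2 p.1) := hcp.comp continuous_swap
      exact this.mul (by fun_prop)
    have h2 := continuous_parametric_integral_of_continuous (μ := volume)
      (f := fun y x => T (pt x y) * e (-(x * ξ))) h1 (isCompact_Icc (a := -R) (b := R))
    refine h2.congr fun y => ?_
    rw [setIntegral_eq_integral_of_forall_compl_eq_zero]
    intro x hx
    rw [hR1 x y, zero_mul]
    by_contra! h
    exact hx ⟨(abs_lt.1 h).1.le, (abs_lt.1 h).2.le⟩
  have hBR : ∀ ξ y, R ≤ |y| → B ξ y = 0 := by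
    intro ξ y hy
    rw [hBint]
    simp [hR2 _ _ hy]
  have hBF : ∀ ξ η, 𝓕 (B ξ) η = 𝓕 T (pt ξ η) := by
    intro ξ η
    rw [fourier_eq_integral, fourier_eq_integral]
    have hi : Integrable fun v : Plane => T v * e (-inner ℝ v (pt ξ η)) :=
      integrable_of_continuous_of_eq_zero (by fun_prop) fun v hv => by rw [hR v hv, zero_mul]
    have hi2 := (measurePreserving_coords (α := pt 1 0) (β := pt 0 1)
      (by simp)).integrable_comp_of_integrable hi
    rw [integral_plane hi]
    simp only [Function.comp_def, smul_add_smul_eq_pt] at hi2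
    rw [integral_integral_swap (f := fun x y => T (pt x y) * e (-inner ℝ (pt x y) (pt ξ η)))
      (by rw [← Measure.volume_eq_prod]; exact hi2)]
    congr 1
    ext y
    rw [hBint, ← integral_mul_const]
    congr 1
    ext x
    rw [mul_assoc, ← e_add, inner_plane]
    simp only [pt_zero, pt_one, RCLike.inner_apply, conj_trivial]
    ring_nf
  have hBK : ∀ ξ η, ‖𝓕 (B ξ) η‖ ≤ K / ((1 + |ξ|) ^ 2 * (1 + |η|) ^ 2) := by
    intro ξ η
    rw [hBF]
    refine (hK _).trans ?_
    have h0 := abs_coord_le (pt ξ η) 0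
    have h1 := abs_coord_le (pt ξ η) 1
    rw [pt_zero] at h0
    rw [pt_one] at h1
    have : (1 + |ξ|) ^ 2 * (1 + |η|) ^ 2 ≤ (1 + ‖pt ξ η‖) ^ 4 := by
      calc _ ≤ (1 + ‖pt ξ η‖) ^ 2 * (1 + ‖pt ξ η‖) ^ 2 := by gcongr
        _ = _ := by ring
    gcongr
  have hsum2 : Summable fun m : ℤ => 1 / (1 + |(m : ℝ)|) ^ 2 := by
    refine Summable.of_norm_bounded_eventually
      (g := fun m : ℤ => 1 / |(m : ℝ)| ^ 2) ?_ ?_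
    · have := (Real.summable_one_div_int_pow (p := 2)).2 one_lt_two
      simpa using this
    · filter_upwards [(Set.finite_singleton (0 : ℤ)).compl_mem_cofinite] with m hm
      have hm' : (0 : ℝ) < |(m : ℝ)| := abs_pos.2 (by exact_mod_cast hm)
      rw [Real.norm_of_nonneg (by positivity)]
      gcongr
      linarith
  have hpB : ∀ ξ, Summable (fun m : ℤ => 𝓕 (B ξ) m) ∧
      ∑' j : ℤ, B ξ j = ∑' m : ℤ, 𝓕 (B ξ) m := by
    intro ξ
    refine poisson_line (hBc ξ) (hBR ξ) (K := K) fun m hm => (hBK ξ m).trans ?_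
    have hm' : (0 : ℝ) < |(m : ℝ)| := abs_pos.2 (by exact_mod_cast hm)
    have : |(m : ℝ)| ^ 2 ≤ (1 + |ξ|) ^ 2 * (1 + |(m : ℝ)|) ^ 2 := by
      have h1 : (1 : ℝ) ≤ (1 + |ξ|) ^ 2 := one_le_pow₀ (by linarith [abs_nonneg ξ])
      have h2 : |(m : ℝ)| ^ 2 ≤ (1 + |(m : ℝ)|) ^ 2 := by gcongr; linarith
      nlinarith [sq_nonneg |(m : ℝ)|]
    gcongr
  -- the sum over the second coordinate is finite
  set J : Finset ℤ := Finset.Icc (-⌈R⌉) ⌈R⌉ with hJ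
  have hJ' : ∀ j : ℤ, j ∉ J → R ≤ |(j : ℝ)| := by
    intro j hj
    by_contra! h
    have h2 := abs_lt.1 (h.trans_le (Int.le_ceil _))
    exact hj (Finset.mem_Icc.2 ⟨by exact_mod_cast h2.1.le, by exact_mod_cast h2.2.le⟩)
  set A : ℝ → ℂ := fun x => ∑ j ∈ J, T (pt x j) with hA
  have hAeq : ∀ x : ℝ, ∑' j : ℤ, T (pt x j) = A x := fun x =>
    tsum_eq_sum fun j hj => hR2 x j (hJ' j hj)
  have hslice : ∀ y : ℝ, Continuous fun x => T (pt x y) := fun y =>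
    hcp.comp (by fun_prop : Continuous fun x : ℝ => (x, y))
  have hAc : Continuous A := continuous_finsetSum _ fun j _ => hslice j
  have hAF : ∀ ξ, 𝓕 A ξ = ∑' m : ℤ, 𝓕 (B ξ) m := by
    intro ξ
    rw [← (hpB ξ).2, tsum_eq_sum (s := J) fun j hj => hBR ξ j (hJ' j hj), fourier_eq_integral]
    simp only [hA, Finset.sum_mul]
    rw [integral_finsetSum]
    · refine Finset.sum_congr rfl fun j _ => ?_
      simp only [hB, fourier_eq_integral]
    · intro j _
      have := hslice j
      exact integrable_of_continuous_of_eq_zero (R := R) (this.mul (by fun_prop)) fun x hx => by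
        rw [hR1 x j hx, zero_mul]
  have hAR : ∀ x, R ≤ |x| → A x = 0 := fun x hx =>
    Finset.sum_eq_zero fun j _ => hR1 x j hx
  have hAK : ∀ m : ℤ, m ≠ 0 →
      ‖𝓕 A m‖ ≤ ((∑' m : ℤ, 1 / (1 + |(m : ℝ)|) ^ 2) * K) / |(m : ℝ)| ^ 2 := by
    intro m hm
    have hm' : (0 : ℝ) < |(m : ℝ)| := abs_pos.2 (by exact_mod_cast hm)
    rw [hAF, mul_div_assoc]
    refine tsum_of_norm_bounded (hsum2.hasSum.mul_right _) fun n => (hBK m n).trans ?_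
    rw [one_div, inv_mul_eq_div, div_div]
    gcongr
    linarith
  have hpA := poisson_line hAc hAR hAK
  calc ∑' i : ℤ, ∑' j : ℤ, T (pt i j) = ∑' i : ℤ, A i := by simp only [hAeq]
    _ = ∑' i : ℤ, 𝓕 A i := hpA.2
    _ = _ := by simp only [hAF, hBF]

/-! ### Poisson summation over lattices in the plane -/

@[simp] theorem vec_apply (r : Fin 2 → ℤ) (i : Fin 2) : vec r i = r i := rfl

theorem vec_eq_pt (p : ℤ × ℤ) : vec ((finTwoArrowEquiv ℤ).symm p) = pt p.1 p.2 := by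
  apply plane_ext <;> simp [finTwoArrowEquiv]

theorem one_le_norm_vec {r : Fin 2 → ℤ} (hr : r ≠ 0) : 1 ≤ ‖vec r‖ := by
  obtain ⟨i, hi⟩ := Function.ne_iff.1 hr
  have h1 : (1 : ℝ) ≤ |(r i : ℝ)| := by exact_mod_cast Int.one_le_abs hi
  exact h1.trans (abs_coord_le (vec r) i)

theorem vec_zero : vec 0 = 0 := by
  apply plane_ext <;> simp

theorem summable_one_div_one_add_norm_vec :
    Summable fun v : Fin 2 → ℤ => 1 / (1 + ‖vec v‖) ^ 4 := by
  have hsum2 : Summable fun m : ℤ => 1 / (1 + |(m : ℝ)|) ^ 2 := by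
    refine Summable.of_norm_bounded_eventually
      (g := fun m : ℤ => 1 / |(m : ℝ)| ^ 2) ?_ ?_
    · have := (Real.summable_one_div_int_pow (p := 2)).2 one_lt_two
      simpa using this
    · filter_upwards [(Set.finite_singleton (0 : ℤ)).compl_mem_cofinite] with m hm
      have hm' : (0 : ℝ) < |(m : ℝ)| := abs_pos.2 (by exact_mod_cast hm)
      rw [Real.norm_of_nonneg (by positivity)]
      gcongr
      linarith
  have h1 := hsum2.mul_of_nonneg hsum2 (fun _ => by positivity) (fun _ => by positivity)
  rw [← (finTwoArrowEquiv ℤ).symm.summable_iff]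
  refine Summable.of_nonneg_of_le (fun _ => by rw [Function.comp_apply]; positivity)
    (fun p => ?_) h1
  rw [Function.comp_apply, vec_eq_pt, div_mul_div_comm, one_mul]
  have h0 := abs_coord_le (pt p.1 p.2) 0
  have h1 := abs_coord_le (pt p.1 p.2) 1
  rw [pt_zero] at h0
  rw [pt_one] at h1
  have : (1 + |(p.1 : ℝ)|) ^ 2 * (1 + |(p.2 : ℝ)|) ^ 2 ≤ (1 + ‖pt p.1 p.2‖) ^ 4 := by
    calc _ ≤ (1 + ‖pt p.1 p.2‖) ^ 2 * (1 + ‖pt p.1 p.2‖) ^ 2 := by gcongr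
      _ = _ := by ring
  gcongr

theorem finite_norm_vec_le (R : ℝ) : {r : Fin 2 → ℤ | ‖vec r‖ ≤ R}.Finite := by
  refine (Set.finite_Icc (fun _ => -⌈R⌉) (fun _ => ⌈R⌉)).subset fun r hr => ?_
  have h : ∀ i, |(r i : ℝ)| ≤ ⌈R⌉ := fun i =>
    (abs_coord_le (vec r) i).trans ((show ‖vec r‖ ≤ R from hr).trans (Int.le_ceil _))
  exact ⟨fun i => by exact_mod_cast (abs_le.1 (h i)).1, fun i => by
    exact_mod_cast (abs_le.1 (h i)).2⟩

/-- Poisson summation over `X⁻¹ℤ²` with a twist by a character. -/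
theorem poisson_plane_twisted {T : Plane → ℂ} (hc : Continuous T) {R : ℝ}
    (hR : ∀ x, R ≤ ‖x‖ → T x = 0) {K : ℝ} (hK : ∀ ξ, ‖𝓕 T ξ‖ ≤ K / (1 + ‖ξ‖) ^ 4)
    {X : ℝ} (hX : 0 < X) (θ : Plane) :
    Summable (fun v : Fin 2 → ℤ => 𝓕 T (X • (vec v - θ))) ∧
    ∑' r : Fin 2 → ℤ, T (X⁻¹ • vec r) * e (inner ℝ (vec r) θ) =
      X ^ 2 * ∑' v : Fin 2 → ℤ, 𝓕 T (X • (vec v - θ)) := by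
  have hK0 : 0 ≤ K := by
    have := (norm_nonneg _).trans (hK 0)
    simpa using this
  set S : Plane → ℂ := fun x => T (X⁻¹ • x) * e (inner ℝ x θ) with hS
  have hSc : Continuous S := by
    have : Continuous fun x : Plane => T (X⁻¹ • x) := hc.comp (by fun_prop)
    exact this.mul (by fun_prop)
  have hSR : ∀ x, X * R ≤ ‖x‖ → S x = 0 := by
    intro x hx
    rw [hS]
    simp only
    rw [hR, zero_mul]
    rw [norm_smul, Real.norm_of_nonneg (by positivity)]
    rwa [inv_mul_eq_div, le_div_iff₀' hX]
  have hSF : ∀ ξ, 𝓕 S ξ = X ^ 2 * 𝓕 T (X • (ξ - θ)) := by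
    intro ξ
    rw [fourier_eq_integral, fourier_eq_integral]
    have h1 := Measure.integral_comp_inv_smul (volume : Measure Plane)
      (fun x => T x * e (-inner ℝ x (X • (ξ - θ)))) X
    rw [finrank_euclideanSpace, Fintype.card_fin, abs_of_pos (by positivity),
      Complex.real_smul] at h1
    push_cast at h1
    rw [← h1]
    congr 1
    ext x
    rw [hS]
    simp only
    rw [mul_assoc, ← e_add, real_inner_smul_left, real_inner_smul_right, ← mul_assoc,
      inv_mul_cancel₀ hX.ne', one_mul, inner_sub_right]
    ring_nf
  set c : ℝ := ((1 + ‖θ‖) * (1 + X⁻¹)) ^ 4 * K with hcdef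
  have hTK : ∀ ξ, ‖𝓕 T (X • (ξ - θ))‖ ≤ c / (1 + ‖ξ‖) ^ 4 := by
    intro ξ
    refine (hK _).trans ?_
    rw [norm_smul, Real.norm_of_nonneg hX.le, div_le_div_iff₀ (by positivity) (by positivity),
      hcdef]
    have h1 : 1 + ‖ξ‖ ≤ (1 + ‖θ‖) * (1 + X⁻¹) * (1 + X * ‖ξ - θ‖) := by
      have h2 : ‖ξ‖ ≤ ‖ξ - θ‖ + ‖θ‖ := by
        simpa using norm_add_le (ξ - θ) θ
      have h3 : (1 + X⁻¹) * (1 + X * ‖ξ - θ‖) = 1 + X * ‖ξ - θ‖ + X⁻¹ + ‖ξ - θ‖ := by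
        field_simp
        ring
      rw [mul_assoc, h3]
      have h4 : 0 ≤ X * ‖ξ - θ‖ + X⁻¹ := by positivity
      nlinarith [norm_nonneg θ, norm_nonneg (ξ - θ)]
    calc K * (1 + ‖ξ‖) ^ 4 ≤ K * ((1 + ‖θ‖) * (1 + X⁻¹) * (1 + X * ‖ξ - θ‖)) ^ 4 := by gcongr
      _ = _ := by ring
  have hSK : ∀ ξ, ‖𝓕 S ξ‖ ≤ X ^ 2 * c / (1 + ‖ξ‖) ^ 4 := by
    intro ξ
    rw [hSF, norm_mul, norm_pow, Complex.norm_real, Real.norm_of_nonneg hX.le, mul_div_assoc]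
    gcongr
    exact hTK ξ
  have hsum : Summable (fun v : Fin 2 → ℤ => 𝓕 T (X • (vec v - θ))) := by
    refine Summable.of_norm_bounded (summable_one_div_one_add_norm_vec.mul_left c) fun v => ?_
    rw [mul_one_div]
    exact hTK _
  refine ⟨hsum, ?_⟩
  have hSsum : Summable fun r : Fin 2 → ℤ => S (vec r) := by
    refine summable_of_hasFiniteSupport ((finite_norm_vec_le (X * R)).subset fun r hr => ?_)
    by_contra! h
    exact hr (hSR _ (not_le.1 h).le)
  have key := poisson_plane_iterated hSc hSR hSK
  have h1 : ∑' r : Fin 2 → ℤ, S (vec r) = ∑' i : ℤ, ∑' j : ℤ, S (pt i j) := by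
    rw [← (finTwoArrowEquiv ℤ).symm.tsum_eq]
    rw [← (finTwoArrowEquiv ℤ).symm.summable_iff] at hSsum
    refine hSsum.tsum_prod.trans ?_
    simp only [Function.comp_apply, vec_eq_pt]
  have h2 : ∑' v : Fin 2 → ℤ, 𝓕 S (vec v) = ∑' i : ℤ, ∑' j : ℤ, 𝓕 S (pt i j) := by
    have h3 : Summable fun r : Fin 2 → ℤ => 𝓕 S (vec r) := by
      simp only [hSF]
      exact hsum.mul_left _
    rw [← (finTwoArrowEquiv ℤ).symm.tsum_eq]
    rw [← (finTwoArrowEquiv ℤ).symm.summable_iff] at h3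
    refine h3.tsum_prod.trans ?_
    simp only [Function.comp_apply, vec_eq_pt]
  calc _ = ∑' r : Fin 2 → ℤ, S (vec r) := rfl
    _ = ∑' v : Fin 2 → ℤ, 𝓕 S (vec v) := by rw [h1, key, h2]
    _ = _ := by simp only [hSF, tsum_mul_left]

/-- The constant `∑_{v ∈ ℤ²} (1 + |v|)⁻⁴`. -/
noncomputable def latticeConst : ℝ := ∑' v : Fin 2 → ℤ, 1 / (1 + ‖vec v‖) ^ 4

theorem latticeConst_nonneg : 0 ≤ latticeConst := tsum_nonneg fun _ => by positivity

theorem e_add_intCast (x : ℝ) (m : ℤ) : e (x + m) = e x := by rw [e_add, e_intCast, mul_one]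

theorem e_natCast_mul (b : ℕ) (x : ℝ) : e (b * x) = e x ^ b := by
  rw [e, e, ← Complex.exp_nat_mul]
  push_cast
  ring_nf

theorem sum_range_e {q : ℕ} (hq : 0 < q) (m : ℤ) :
    ∑ b ∈ Finset.range q, e (b * ((m : ℝ) / q)) = if (q : ℤ) ∣ m then (q : ℂ) else 0 := by
  have hq' : (q : ℝ) ≠ 0 := by positivity
  simp only [e_natCast_mul]
  split_ifs with h
  · obtain ⟨k, rfl⟩ := h
    have : e (((q * k : ℤ) : ℝ) / q) = 1 := by
      rw [show (((q * k : ℤ) : ℝ) / q) = ((k : ℤ) : ℝ) by push_cast; field_simp, e_intCast]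
    simp only [this, one_pow, Finset.sum_const, Finset.card_range, nsmul_eq_mul, mul_one]
  · have h1 : e ((m : ℝ) / q) ≠ 1 := by
      intro h1
      rw [e, Complex.exp_eq_one_iff] at h1
      obtain ⟨n, hn⟩ := h1
      have h2 : (((m : ℝ) / q : ℝ) : ℂ) = ((n : ℝ) : ℂ) := by
        have h3 : (2 * Real.pi * Complex.I : ℂ) ≠ 0 := Complex.two_pi_I_ne_zero
        apply mul_left_cancel₀ h3
        rw [hn]
        push_cast
        ring
      rw [Complex.ofReal_inj, div_eq_iff hq'] at h2
      exact h ⟨n, by rw [mul_comm]; exact_mod_cast h2⟩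
    rw [geom_sum_eq h1, ← e_natCast_mul, mul_div_cancel₀ _ hq', e_intCast, sub_self, zero_div]

/-- The symplectic pairing `r · a^⊥`. -/
def wedge (r : Fin 2 → ℤ) (a : Fin 2 → ℕ) : ℤ := r 0 * (a 1 : ℤ) - r 1 * (a 0 : ℤ)

/-- Summation of a smooth function over the lattice `{r : q ∣ r · a^⊥}`, of index `q` in `ℤ²`: the
zero frequency gives the main term, and every other dual frequency has norm at least `1/q`. -/
theorem norm_lattice_sum_sub_le {T : Plane → ℂ} (hc : Continuous T) {R : ℝ}
    (hR : ∀ x, R ≤ ‖x‖ → T x = 0) {K₀ : ℝ} (hK₀ : ∀ ξ, ‖𝓕 T ξ‖ ≤ K₀ / (1 + ‖ξ‖) ^ 4)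
    {X : ℝ} (hX : 0 < X) {q : ℕ} (hq : 0 < q) {N : ℕ} {K : ℝ}
    (hK : ∀ ξ, X / q ≤ ‖ξ‖ → ‖𝓕 T ξ‖ ≤ K / ‖ξ‖ ^ (N + 4)) {a : Fin 2 → ℕ} (ha : a ∈ reduced q) :
    ‖∑' r : Fin 2 → ℤ, (if (q : ℤ) ∣ wedge r a then T (X⁻¹ • vec r) else 0) -
      (X ^ 2 / q : ℝ) * 𝓕 T 0‖ ≤ X ^ 2 * (latticeConst * (K * (4 * q / X) ^ (N + 4))) := by
  have hq' : (0 : ℝ) < q := by exact_mod_cast hq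
  have hK0 : 0 ≤ K := by
    have h1 := (norm_nonneg _).trans (hK (pt (X / q) 0) (by
      simpa using (le_abs_self _).trans (abs_coord_le (pt (X / q) 0) 0)))
    have h2 : 0 < ‖pt (X / q) 0‖ := by
      refine lt_of_lt_of_le ?_ (abs_coord_le (pt (X / q) 0) 0)
      simp only [pt_zero]
      positivity
    by_contra! hneg
    exact absurd h1 (not_le.2 (div_neg_of_neg_of_pos hneg (by positivity)))
  have hgcd : Nat.gcd (Nat.gcd (a 0) (a 1)) q = 1 := (Finset.mem_filter.1 ha).2
  -- dual frequencies, reduced modulo one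
  set θ : ℕ → Plane := fun b =>
    pt (Int.fract (b * ((a 1 : ℝ) / q))) (Int.fract (-(b * ((a 0 : ℝ) / q)))) with hθ
  have hθe : ∀ (b : ℕ) (r : Fin 2 → ℤ),
      e (b * ((wedge r a : ℝ) / q)) = e (inner ℝ (vec r) (θ b)) := by
    intro b r
    rw [← e_add_intCast (inner ℝ (vec r) (θ b))
      (r 0 * ⌊b * ((a 1 : ℝ) / q)⌋ + r 1 * ⌊-(b * ((a 0 : ℝ) / q))⌋)]
    congr 1
    rw [inner_plane, hθ, wedge]
    simp only [vec_apply, pt_zero, pt_one, Int.fract]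
    push_cast
    ring
  have hθn : ∀ b, ‖θ b‖ ≤ 2 := by
    intro b
    have h1 := norm_sq_plane (θ b)
    simp only [hθ, pt_zero, pt_one] at h1
    have h2 := Int.fract_nonneg ((b : ℝ) * ((a 1 : ℝ) / q))
    have h3 := (Int.fract_lt_one ((b : ℝ) * ((a 1 : ℝ) / q))).le
    have h4 := Int.fract_nonneg (-((b : ℝ) * ((a 0 : ℝ) / q)))
    have h5 := (Int.fract_lt_one (-((b : ℝ) * ((a 0 : ℝ) / q)))).le
    simp only [hθ]
    nlinarith [norm_nonneg (pt (Int.fract (b * ((a 1 : ℝ) / q)))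
      (Int.fract (-(b * ((a 0 : ℝ) / q)))))]
  -- Since `q` times the difference is a nonzero integer vector, its norm is at least `1/q`.
  have hsep : ∀ b ∈ Finset.range q, ∀ v : Fin 2 → ℤ, (b ≠ 0 ∨ v ≠ 0) →
      1 / q ≤ ‖vec v - θ b‖ := by
    intro b hb v hbv
    rw [Finset.mem_range] at hb
    set u : Fin 2 → ℤ := ![q * v 0 - b * a 1 + q * ⌊(b : ℝ) * ((a 1 : ℝ) / q)⌋,
      q * v 1 + b * a 0 + q * ⌊-((b : ℝ) * ((a 0 : ℝ) / q))⌋] with hu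
    have huv : vec u = (q : ℝ) • (vec v - θ b) := by
      apply plane_ext
      · simp only [vec_apply, hu, hθ, Int.fract, PiLp.smul_apply, PiLp.sub_apply, pt_zero,
          smul_eq_mul, Matrix.cons_val_zero]
        push_cast
        field_simp
        ring
      · simp only [vec_apply, hu, hθ, Int.fract, PiLp.smul_apply, PiLp.sub_apply, pt_one,
          smul_eq_mul, Matrix.cons_val_one]
        push_cast
        field_simp
        ring
    have hu0 : u ≠ 0 := by
      intro h0
      have e0 := congrFun h0 0
      have e1 := congrFun h0 1
      simp only [hu, Matrix.cons_val_zero, Matrix.cons_val_one, Pi.zero_apply] at e0 e1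
      have d1 : (q : ℤ) ∣ b * a 1 := ⟨v 0 + ⌊(b : ℝ) * ((a 1 : ℝ) / q)⌋, by linarith⟩
      have d0 : (q : ℤ) ∣ b * a 0 := ⟨-(v 1 + ⌊-((b : ℝ) * ((a 0 : ℝ) / q))⌋), by linarith⟩
      have d1' : q ∣ b * a 1 := by exact_mod_cast d1
      have d0' : q ∣ b * a 0 := by exact_mod_cast d0
      have d : q ∣ b * Nat.gcd (Nat.gcd (a 0) (a 1)) q := by
        rw [← Nat.gcd_mul_left, ← Nat.gcd_mul_left]
        exact Nat.dvd_gcd (Nat.dvd_gcd d0' d1') (Dvd.intro_left b rfl)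
      rw [hgcd, mul_one] at d
      have hb0 : b = 0 := Nat.eq_zero_of_dvd_of_lt d hb
      subst hb0
      have hv : v ≠ 0 := by simpa using hbv
      apply hv
      simp only [Nat.cast_zero, zero_mul, Int.floor_zero, mul_zero, neg_zero, add_zero,
        sub_zero] at e0 e1
      ext i
      fin_cases i
      · simpa [hq.ne'] using e0
      · simpa [hq.ne'] using e1
    have h1 := one_le_norm_vec hu0
    rw [huv, norm_smul, Real.norm_of_nonneg hq'.le] at h1
    rw [div_le_iff₀' hq']
    exact h1
  -- Four of the `N + 4` powers are spent on the convergence of the sum over `v`.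
  have hterm : ∀ b ∈ Finset.range q, ∀ v : Fin 2 → ℤ, (b ≠ 0 ∨ v ≠ 0) →
      ‖𝓕 T (X • (vec v - θ b))‖ ≤ 1 / (1 + ‖vec v‖) ^ 4 * (K * (4 * q / X) ^ (N + 4)) := by
    intro b hb v hbv
    have h1 := hsep b hb v hbv
    have h1' : 1 ≤ q * ‖vec v - θ b‖ := by
      rwa [div_le_iff₀' hq'] at h1
    have hpos : 0 < ‖vec v - θ b‖ := lt_of_lt_of_le (by positivity) h1
    have h2 := hK (X • (vec v - θ b)) (by
      rw [norm_smul, Real.norm_of_nonneg hX.le, div_eq_mul_one_div]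
      gcongr)
    refine h2.trans ?_
    rw [norm_smul, Real.norm_of_nonneg hX.le]
    have h3 : 1 + ‖vec v‖ ≤ 4 * q * ‖vec v - θ b‖ := by
      have h4 : ‖vec v‖ ≤ ‖vec v - θ b‖ + ‖θ b‖ := by
        simpa using norm_add_le (vec v - θ b) (θ b)
      have h5 : (1 : ℝ) ≤ q := by exact_mod_cast hq
      nlinarith [hθn b]
    have h6 : (1 + ‖vec v‖) ^ 4 ≤ (4 * q * ‖vec v - θ b‖) ^ (N + 4) := by
      calc (1 + ‖vec v‖) ^ 4 ≤ (1 + ‖vec v‖) ^ (N + 4) :=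
            pow_le_pow_right₀ (by linarith [norm_nonneg (vec v)]) (by omega)
        _ ≤ _ := by gcongr
    have h7 : K / (X * ‖vec v - θ b‖) ^ (N + 4) =
        1 / (4 * q * ‖vec v - θ b‖) ^ (N + 4) * (K * (4 * q / X) ^ (N + 4)) := by
      rw [div_pow, mul_pow, mul_pow (4 * (q : ℝ))]
      field_simp
    rw [h7]
    gcongr
  set Z : ℝ := latticeConst * (K * (4 * q / X) ^ (N + 4)) with hZ
  have hb : ∀ b ∈ Finset.range q, ‖∑' v : Fin 2 → ℤ, 𝓕 T (X • (vec v - θ b)) -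
      if b = 0 then 𝓕 T 0 else 0‖ ≤ Z := by
    intro b hb
    have hs := (poisson_plane_twisted hc hR hK₀ hX (θ b)).1
    have hS := summable_one_div_one_add_norm_vec.hasSum.mul_right (K * (4 * q / X) ^ (N + 4))
    split_ifs with h0
    · have h1 := hs.tsum_eq_add_tsum_ite 0
      have h2 : 𝓕 T (X • (vec 0 - θ b)) = 𝓕 T 0 := by
        rw [h0, hθ, vec_zero]
        have : pt 0 0 = 0 := by apply plane_ext <;> simp
        simp [this]
      rw [h1, h2, add_sub_cancel_left]
      refine tsum_of_norm_bounded hS fun v => ?_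
      split_ifs with hv
      · rw [norm_zero]
        positivity
      · exact hterm b hb v (Or.inr hv)
    · rw [sub_zero]
      exact tsum_of_norm_bounded hS fun v => hterm b hb v (Or.inl h0)
  -- Additive characters modulo `q` detect the divisibility; each leads to a Poisson summation.
  have hexp : ∑' r : Fin 2 → ℤ, (if (q : ℤ) ∣ wedge r a then T (X⁻¹ • vec r) else 0) =
      (X ^ 2 / q : ℝ) * ∑ b ∈ Finset.range q, ∑' v : Fin 2 → ℤ, 𝓕 T (X • (vec v - θ b)) := by
    have h1 : ∀ b ∈ Finset.range q,
        Summable fun r : Fin 2 → ℤ => T (X⁻¹ • vec r) * e (inner ℝ (vec r) (θ b)) := by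
      intro b _
      refine summable_of_hasFiniteSupport ((finite_norm_vec_le (X * R)).subset fun r hr => ?_)
      by_contra! h
      refine hr ?_
      simp only
      rw [hR, zero_mul]
      rw [norm_smul, Real.norm_of_nonneg (by positivity), inv_mul_eq_div, le_div_iff₀' hX]
      exact (not_le.1 h).le
    have h2 : ∀ r : Fin 2 → ℤ, (if (q : ℤ) ∣ wedge r a then T (X⁻¹ • vec r) else 0) =
        (q : ℂ)⁻¹ * ∑ b ∈ Finset.range q, T (X⁻¹ • vec r) * e (inner ℝ (vec r) (θ b)) := by
      intro r
      rw [← Finset.mul_sum]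
      simp only [← hθe]
      rw [sum_range_e hq]
      have : (q : ℂ) ≠ 0 := by exact_mod_cast hq.ne'
      split_ifs
      · field_simp
      · simp
    simp only [h2]
    rw [tsum_mul_left, Summable.tsum_finsetSum h1]
    have h3 : ∀ b ∈ Finset.range q, ∑' r : Fin 2 → ℤ, T (X⁻¹ • vec r) * e (inner ℝ (vec r) (θ b)) =
        X ^ 2 * ∑' v : Fin 2 → ℤ, 𝓕 T (X • (vec v - θ b)) := fun b _ =>
      (poisson_plane_twisted hc hR hK₀ hX (θ b)).2
    rw [Finset.sum_congr rfl h3, ← Finset.mul_sum]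
    push_cast
    ring
  have hmain : (X ^ 2 / q : ℝ) * 𝓕 T 0 =
      (X ^ 2 / q : ℝ) * ∑ b ∈ Finset.range q, (if b = 0 then 𝓕 T 0 else 0) := by
    rw [Finset.sum_ite_eq' (Finset.range q) 0, if_pos (Finset.mem_range.2 hq)]
  rw [hexp, hmain, ← mul_sub, ← Finset.sum_sub_distrib, norm_mul, Complex.norm_real,
    Real.norm_of_nonneg (by positivity)]
  calc _ ≤ X ^ 2 / q * ∑ b ∈ Finset.range q, Z := by
        gcongr with b hb'
        exact norm_sum_le_of_le _ fun b hb' => hb b hb'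
    _ = _ := by
        rw [Finset.sum_const, Finset.card_range, nsmul_eq_mul]
        field_simp

/-! ### Products with dilates -/

section Dilate

variable {V : Type*} [NormedAddCommGroup V] [InnerProductSpace ℝ V] [FiniteDimensional ℝ V]
  [MeasurableSpace V] [BorelSpace V]

/-- The Fourier transform of `f · g(s ·)` as a convolution. -/
theorem fourier_mul_dilate {f g : V → ℂ} (hfi : Integrable f)
    (hg : Continuous g) (hgi : Integrable g) {C : ℝ} {N : ℕ} (hN : Module.finrank ℝ V < N)
    (h : ∀ ξ, ‖𝓕 g ξ‖ ≤ C / (1 + ‖ξ‖) ^ N) (s : ℝ) (ξ : V) :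
    𝓕 (fun u => f u * g (s • u)) ξ = ∫ η, 𝓕 g η * 𝓕 f (ξ - s • η) := by
  have hgF : Integrable (𝓕 g) :=
    integrable_of_decay (continuous_fourier hgi).aestronglyMeasurable hN h
  have h1 : ∀ u, f u * g (s • u) * e (-inner ℝ u ξ) =
      ∫ η, f u * 𝓕 g η * e (inner ℝ η (s • u) - inner ℝ u ξ) := by
    intro u
    rw [eq_integral_fourier hg hgi hN h (s • u), ← integral_const_mul, ← integral_mul_const]
    congr 1
    ext η
    rw [sub_eq_add_neg, e_add]
    ring
  have h2 : ∀ η, 𝓕 g η * 𝓕 f (ξ - s • η) =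
      ∫ u, f u * 𝓕 g η * e (inner ℝ η (s • u) - inner ℝ u ξ) := by
    intro η
    rw [fourier_eq_integral f, ← integral_const_mul]
    congr 1
    ext u
    rw [inner_sub_right, real_inner_smul_right, real_inner_smul_right, real_inner_comm η u]
    ring_nf
  rw [fourier_eq_integral]
  simp only [h1, h2]
  refine integral_integral_swap ?_
  refine (hfi.mul_prod hgF).mul_bdd (c := 1) ?_ (Eventually.of_forall fun p => (norm_e _).le)
  refine Continuous.aestronglyMeasurable ?_
  fun_prop

theorem one_add_norm_le_mul {V : Type*} [NormedAddCommGroup V] [NormedSpace ℝ V] {s : ℝ}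
    (hs : |s| ≤ 1) (ξ η : V) :
    1 + ‖ξ‖ ≤ (1 + ‖ξ - s • η‖) * (1 + ‖η‖) := by
  have h1 : ‖ξ‖ ≤ ‖ξ - s • η‖ + ‖s • η‖ := by
    simpa using norm_add_le (ξ - s • η) (s • η)
  have h2 : ‖s • η‖ ≤ ‖η‖ := by
    rw [norm_smul]
    exact mul_le_of_le_one_left (norm_nonneg _) hs
  nlinarith [norm_nonneg (ξ - s • η), norm_nonneg η]

/-- The decay of the Fourier transform of `f · g(s ·)` is uniform in `|s| ≤ 1`. -/
theorem exists_fourier_mul_dilate_decay {f g : V → ℂ} (hf : ContDiff ℝ (⊤ : ℕ∞) f)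
    (hfs : HasCompactSupport f) (hg : ContDiff ℝ (⊤ : ℕ∞) g) (hgs : HasCompactSupport g) (N : ℕ) :
    ∃ C, 0 ≤ C ∧ ∀ s : ℝ, |s| ≤ 1 → ∀ ξ,
      ‖𝓕 (fun u => f u * g (s • u)) ξ‖ ≤ C / (1 + ‖ξ‖) ^ N := by
  set d := Module.finrank ℝ V + 1
  obtain ⟨A, hA0, hA⟩ := exists_fourier_decay hf hfs N
  obtain ⟨B, hB0, hB⟩ := exists_fourier_decay hg hgs (N + d)
  have hfi : Integrable f := hf.continuous.integrable_of_hasCompactSupport hfs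
  have hgi : Integrable g := hg.continuous.integrable_of_hasCompactSupport hgs
  have hint : Integrable fun η : V => 1 / (1 + ‖η‖) ^ d := by
    refine integrable_of_decay (N := d) (C := 1) (g := fun η : V => ((1 / (1 + ‖η‖) ^ d : ℝ) : ℂ))
      ?_ (Nat.lt_succ_self _) (fun η => ?_) |>.re
    · refine Continuous.aestronglyMeasurable ?_
      refine Complex.continuous_ofReal.comp ?_
      exact continuous_const.div (by fun_prop) fun η => by positivity
    · rw [Complex.norm_real, Real.norm_of_nonneg (by positivity)]
  refine ⟨A * B * ∫ η : V, 1 / (1 + ‖η‖) ^ d, by positivity, fun s hs ξ => ?_⟩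
  rw [fourier_mul_dilate hfi hg.continuous hgi (N := N + d) (by omega) hB]
  have hb : ∀ η, ‖𝓕 g η * 𝓕 f (ξ - s • η)‖ ≤
      A * B / (1 + ‖ξ‖) ^ N * (1 / (1 + ‖η‖) ^ d) := by
    intro η
    rw [norm_mul]
    calc _ ≤ B / (1 + ‖η‖) ^ (N + d) * (A / (1 + ‖ξ - s • η‖) ^ N) := by
          gcongr
          exacts [hB η, hA _]
      _ = A * B / ((1 + ‖ξ - s • η‖) * (1 + ‖η‖)) ^ N * (1 / (1 + ‖η‖) ^ d) := by
          rw [mul_pow, pow_add]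
          field_simp
      _ ≤ _ := by
          have := one_add_norm_le_mul hs ξ η
          gcongr
  refine (norm_integral_le_of_norm_le (hint.const_mul _) (Eventually.of_forall hb)).trans_eq ?_
  rw [integral_const_mul]
  ring

end Dilate

/-! ### The weights -/

/-- The radial function `ω₀(|u|)` on the plane. -/
noncomputable def radial₀ (ω₀ : ℝ → ℝ) (u : Plane) : ℂ := (ω₀ ‖u‖ : ℂ)

/-- The radial function `ω(|u|)` on the plane. -/
noncomputable def radial (ω : ℝ → ℝ) (u : Plane) : ℂ := (ω ‖u‖ : ℂ)

namespace Weights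

variable {ω₀ ω : ℝ → ℝ} (hω : Weights ω₀ ω)
include hω

theorem om_eq_zero {x : ℝ} (hx : x ≤ 1 / 2 ∨ 1 ≤ x) : ω x = 0 := by
  by_contra h
  have := hω.supp (subset_tsupport _ h)
  rcases hx with hx | hx
  · exact absurd this.1 (not_lt.2 hx)
  · exact absurd this.2 (not_lt.2 hx)

theorem om₀_eq_zero {x : ℝ} (hx : 1 / 2 ≤ |x|) : ω₀ x = 0 := by
  by_contra h
  have := hω.supp₀ (subset_tsupport _ h)
  exact absurd (abs_lt.2 ⟨by linarith [this.1], this.2⟩) (not_lt.2 hx)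

theorem lt_half_of_om₀_ne_zero {x : ℝ} (hx : ω₀ x ≠ 0) : |x| < 1 / 2 := by
  by_contra! h
  exact hx (hω.om₀_eq_zero h)

theorem om₀_abs (x : ℝ) : ω₀ |x| = ω₀ x := by
  rcases abs_choice x with h | h <;> simp [h, hω.even₀]

theorem exists_bound : ∃ B, 0 ≤ B ∧ ∀ x, ω x ≤ B := by
  have hc : HasCompactSupport ω :=
    HasCompactSupport.intro (isCompact_Icc (a := (0 : ℝ)) (b := 1)) fun x hx => by
      apply hω.om_eq_zero
      by_contra! h
      exact hx ⟨by linarith [h.1], h.2.le⟩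
  obtain ⟨B, hB⟩ := hω.smooth.continuous.bounded_above_of_compact_support hc
  exact ⟨B, (norm_nonneg _).trans (hB 0), fun x => (le_abs_self _).trans (hB x)⟩

theorem contDiff_om_abs : ContDiff ℝ (⊤ : ℕ∞) fun x => ω |x| := by
  have h : (fun x => ω |x|) = fun x => ω x + ω (-x) := by
    ext x
    rcases le_total 0 x with hx | hx
    · rw [abs_of_nonneg hx, hω.om_eq_zero (x := -x) (Or.inl (by linarith)), add_zero]
    · rw [abs_of_nonpos hx, hω.om_eq_zero (x := x) (Or.inl (by linarith)), zero_add]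
  rw [h]
  exact hω.smooth.add (hω.smooth.comp contDiff_neg)

theorem contDiff_om_abs_div : ContDiff ℝ (⊤ : ℕ∞) fun x => ω |x| / |x| := by
  rw [contDiff_iff_contDiffAt]
  intro x
  by_cases hx : x = 0
  · subst hx
    refine (contDiffAt_const (c := (0 : ℝ))).congr_of_eventuallyEq ?_
    filter_upwards [Metric.ball_mem_nhds (0 : ℝ) (by norm_num : (0 : ℝ) < 1 / 2)] with y hy
    rw [Metric.mem_ball, dist_zero_right, Real.norm_eq_abs] at hy
    rw [hω.om_eq_zero (Or.inl hy.le), zero_div]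
  · exact hω.contDiff_om_abs.contDiffAt.div (contDiffAt_abs hx) (abs_ne_zero.2 hx)

theorem om_abs_eq_zero {x : ℝ} (hx : 1 ≤ |x|) : ω |x| = 0 := hω.om_eq_zero (Or.inr hx)

theorem contDiff_radial₀ : ContDiff ℝ (⊤ : ℕ∞) (radial₀ ω₀) := by
  have h : ContDiff ℝ (⊤ : ℕ∞) fun u : Plane => ω₀ ‖u‖ :=
    contDiff_infty.2 fun n => contDiff_comp_norm n ω₀ hω.smooth₀ hω.even₀
  exact Complex.ofRealCLM.contDiff.comp h

theorem contDiff_radial : ContDiff ℝ (⊤ : ℕ∞) (radial ω) := by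
  have h : ContDiff ℝ (⊤ : ℕ∞) fun u : Plane => ω |‖u‖| :=
    contDiff_infty.2 fun n => contDiff_comp_norm n (fun x => ω |x|) hω.contDiff_om_abs
      fun x => by rw [abs_neg]
  simp only [abs_norm] at h
  exact Complex.ofRealCLM.contDiff.comp h

theorem radial₀_eq_zero {u : Plane} (hu : 1 / 2 ≤ ‖u‖) : radial₀ ω₀ u = 0 := by
  rw [radial₀, hω.om₀_eq_zero (by rwa [abs_norm]), Complex.ofReal_zero]

theorem radial_eq_zero {u : Plane} (hu : ‖u‖ ≤ 1 / 2 ∨ 1 ≤ ‖u‖) : radial ω u = 0 := by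
  rw [radial, hω.om_eq_zero hu, Complex.ofReal_zero]

theorem radial₀_smul (s : ℝ) (u : Plane) : radial₀ ω₀ (s • u) = ω₀ (s * ‖u‖) := by
  rw [radial₀, norm_smul, ← hω.om₀_abs (s * ‖u‖), abs_mul, abs_norm, Real.norm_eq_abs]

theorem hasCompactSupport_radial₀ : HasCompactSupport (radial₀ ω₀) :=
  HasCompactSupport.intro (isCompact_closedBall (0 : Plane) 1) fun u hu => by
    rw [mem_closedBall_zero_iff, not_le] at hu
    exact hω.radial₀_eq_zero (by linarith)

theorem hasCompactSupport_radial : HasCompactSupport (radial ω) :=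
  HasCompactSupport.intro (isCompact_closedBall (0 : Plane) 1) fun u hu => by
    rw [mem_closedBall_zero_iff, not_le] at hu
    exact hω.radial_eq_zero (Or.inr hu.le)

/-- The product `ω(|u|) ω₀(s|u|)` vanishes identically when `|s| ≥ 1`. -/
theorem radial_mul_eq_zero {s : ℝ} {u : Plane} (h : 1 ≤ |s| ∨ 1 ≤ ‖u‖) :
    radial ω u * radial₀ ω₀ (s • u) = 0 := by
  by_cases hu : ‖u‖ ≤ 1 / 2 ∨ 1 ≤ ‖u‖
  · rw [hω.radial_eq_zero hu, zero_mul]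
  · push Not at hu
    rcases h with h | h
    · rw [hω.radial₀_eq_zero, mul_zero]
      rw [norm_smul, Real.norm_eq_abs]
      nlinarith [hu.1]
    · exact absurd h (not_le.2 hu.2)

theorem cst_pos : 0 < cst ω := by
  have hc : Continuous fun u : Plane => ω ‖u‖ := hω.smooth.continuous.comp continuous_norm
  have hs : HasCompactSupport fun u : Plane => ω ‖u‖ :=
    HasCompactSupport.intro (isCompact_closedBall (0 : Plane) 1) fun u hu => by
      rw [mem_closedBall_zero_iff, not_le] at hu
      exact hω.om_eq_zero (Or.inr hu.le)
  rw [cst, inv_pos]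
  obtain ⟨x, hx⟩ : ∃ x, ω x ≠ 0 := by
    by_contra! h
    have := hω.integral
    simp [h] at this
  refine hc.integral_pos_of_hasCompactSupport_nonneg_nonzero hs (fun u => hω.nonneg _)
    (x := pt x 0) ?_
  have hx0 : 0 ≤ x := by
    by_contra! h
    exact hx (hω.om_eq_zero (Or.inl (by linarith)))
  have : ‖pt x 0‖ = x := by
    have := norm_sq_plane (pt x 0)
    simp only [pt_zero, pt_one] at this
    exact (sq_eq_sq₀ (norm_nonneg _) hx0).1 (by simpa using this)
  rwa [this]

end Weights

/-! ### The function of one variable behind the first kernel -/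

/-- `g_W(s) = ∫ ω(|u|) ω₀(s|u|) e(-s W·u) du`. In rescaled variables, the kernel `p_{1,q}` is
`-2c ∑_{j ≥ 1} g_W(jq/Q)`. -/
noncomputable def ray (ω₀ ω : ℝ → ℝ) (W : Plane) (s : ℝ) : ℂ :=
  𝓕 (fun u => radial ω u * radial₀ ω₀ (s • u)) (s • W)

/-- The linear isometry `x ↦ x^⊥`. -/
noncomputable def perpIso : Plane ≃ₗᵢ[ℝ] Plane where
  toFun := perp
  invFun x := -perp x
  map_add' x y := by
    apply plane_ext <;> simp [perp, add_comm]
  map_smul' c x := by apply plane_ext <;> simp [perp]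
  left_inv x := by apply plane_ext <;> simp [perp]
  right_inv x := by apply plane_ext <;> simp [perp]
  norm_map' x := by
    have h1 := norm_sq_plane (perp x)
    have h2 := norm_sq_plane x
    refine (sq_eq_sq₀ (norm_nonneg _) (norm_nonneg _)).1 ?_
    refine Eq.trans ?_ (h1.trans ?_)
    · rfl
    · rw [h2]
      simp [perp, add_comm]

theorem perpIso_apply (x : Plane) : perpIso x = perp x := rfl

theorem norm_perp (x : Plane) : ‖perp x‖ = ‖x‖ := perpIso.norm_map x

@[fun_prop] theorem continuous_perp : Continuous perp := perpIso.continuous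

theorem inner_perp_left (x y : Plane) : inner ℝ (perp x) y = -inner ℝ x (perp y) := by
  rw [inner_plane, inner_plane]
  simp [perp]

/-- The function `T(x) = ω(|x|) ∫ ω₀(s|x|) e(-s W·x^⊥) ds`. Summed over the points of a lattice, it
gives the main part of the second kernel. -/
noncomputable def star (ω₀ ω : ℝ → ℝ) (W : Plane) (x : Plane) : ℂ :=
  ∫ s : ℝ, radial ω x * radial₀ ω₀ (s • x) * e (-(s * inner ℝ W (perp x)))

namespace Weights

variable {ω₀ ω : ℝ → ℝ} (hω : Weights ω₀ ω)
include hω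

theorem exists_dilate_decay (N : ℕ) : ∃ C, 0 ≤ C ∧ ∀ s : ℝ, |s| ≤ 1 → ∀ ξ : Plane,
    ‖𝓕 (fun u => radial ω u * radial₀ ω₀ (s • u)) ξ‖ ≤ C / (1 + ‖ξ‖) ^ N :=
  exists_fourier_mul_dilate_decay hω.contDiff_radial hω.hasCompactSupport_radial
    hω.contDiff_radial₀ hω.hasCompactSupport_radial₀ N

theorem continuous_radial_mul :
    Continuous fun p : ℝ × Plane => radial ω p.2 * radial₀ ω₀ (p.1 • p.2) := by
  have h1 := hω.contDiff_radial.continuous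
  have h2 := hω.contDiff_radial₀.continuous
  fun_prop

theorem dilate_eq_zero {s : ℝ} (hs : 1 ≤ |s|) (ξ : Plane) :
    𝓕 (fun u => radial ω u * radial₀ ω₀ (s • u)) ξ = 0 := by
  rw [fourier_eq_integral]
  simp [hω.radial_mul_eq_zero (Or.inl hs)]

theorem ray_eq_zero (W : Plane) {s : ℝ} (hs : 1 ≤ |s|) : ray ω₀ ω W s = 0 :=
  hω.dilate_eq_zero hs _

omit hω in
theorem ray_eq_integral (W : Plane) (s : ℝ) : ray ω₀ ω W s =
    ∫ u : Plane, radial ω u * radial₀ ω₀ (s • u) * e (-(s * inner ℝ u W)) := by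
  rw [ray, fourier_eq_integral]
  simp only [real_inner_smul_right]

theorem continuous_ray (W : Plane) : Continuous (ray ω₀ ω W) := by
  rw [funext (ray_eq_integral W)]
  have h1 : Continuous fun p : ℝ × Plane =>
      radial ω p.2 * radial₀ ω₀ (p.1 • p.2) * e (-(p.1 * inner ℝ p.2 W)) :=
    hω.continuous_radial_mul.mul (by fun_prop)
  have h2 := continuous_parametric_integral_of_continuous (μ := volume)
    (f := fun (s : ℝ) u => radial ω u * radial₀ ω₀ (s • u) * e (-(s * inner ℝ u W))) h1
    (isCompact_closedBall (0 : Plane) 1)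
  refine h2.congr fun s => ?_
  rw [setIntegral_eq_integral_of_forall_compl_eq_zero]
  intro u hu
  rw [mem_closedBall_zero_iff, not_le] at hu
  rw [hω.radial_mul_eq_zero (Or.inr hu.le), zero_mul]

omit hω in
theorem radial_neg (u : Plane) : radial ω (-u) = radial ω u := by rw [radial, norm_neg, radial]

omit hω in
theorem radial₀_neg (u : Plane) : radial₀ ω₀ (-u) = radial₀ ω₀ u := by
  rw [radial₀, norm_neg, radial₀]

omit hω in
theorem ray_neg (W : Plane) (s : ℝ) : ray ω₀ ω W (-s) = ray ω₀ ω W s := by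
  rw [ray_eq_integral, ray_eq_integral, ← integral_neg_eq_self]
  congr 1
  ext u
  rw [radial_neg, smul_neg, neg_smul, neg_neg, inner_neg_left, neg_mul_neg]

theorem ray_zero (W : Plane) : ray ω₀ ω W 0 = ((cst ω)⁻¹ : ℝ) := by
  rw [ray_eq_integral, cst, inv_inv, ← integral_complex_ofReal]
  simp [radial, radial₀, hω.zero₀]

theorem exists_norm_ray_le (N : ℕ) : ∃ C, 0 ≤ C ∧ ∀ (W : Plane) (s : ℝ),
    ‖ray ω₀ ω W s‖ ≤ C / (1 + |s| * ‖W‖) ^ N := by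
  obtain ⟨C, hC0, hC⟩ := hω.exists_dilate_decay N
  refine ⟨C, hC0, fun W s => ?_⟩
  rcases le_total |s| 1 with hs | hs
  · have := hC s hs (s • W)
    rwa [norm_smul, Real.norm_eq_abs] at this
  · rw [hω.ray_eq_zero W hs, norm_zero]
    positivity

theorem exists_fourier_om₀_decay (N : ℕ) : ∃ C, 0 ≤ C ∧ ∀ ξ : ℝ,
    ‖𝓕 (fun x : ℝ => (ω₀ x : ℂ)) ξ‖ ≤ C / (1 + ‖ξ‖) ^ N := by
  refine exists_fourier_decay (Complex.ofRealCLM.contDiff.comp hω.smooth₀)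
    (HasCompactSupport.intro (isCompact_Icc (a := (-1 : ℝ)) (b := 1)) fun x hx => ?_) N
  rw [Function.comp_apply, hω.om₀_eq_zero, map_zero]
  by_contra! h
  have := abs_lt.1 h
  exact hx ⟨by linarith [this.1], by linarith [this.2]⟩

/-- The transform of `g_W` decays beyond the frequency `2|W|`, uniformly in `W`. -/
theorem exists_norm_fourier_ray_le (N : ℕ) : ∃ C, 0 ≤ C ∧ ∀ (W : Plane) (ξ : ℝ),
    2 * ‖W‖ ≤ |ξ| → ‖𝓕 (ray ω₀ ω W) ξ‖ ≤ C / (1 + |ξ|) ^ N := by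
  obtain ⟨C, hC0, hC⟩ := hω.exists_fourier_om₀_decay N
  obtain ⟨B, hB0, hB⟩ := hω.exists_bound
  have hfin : volume (Metric.closedBall (0 : Plane) 1) < ⊤ := measure_closedBall_lt_top
  refine ⟨B * 2 * (2 ^ N * C) * volume.real (Metric.closedBall (0 : Plane) 1), by positivity,
    fun W ξ hξ => ?_⟩
  have hcont : Continuous fun p : ℝ × Plane => radial ω p.2 * radial₀ ω₀ (p.1 • p.2) *
      e (-(p.1 * inner ℝ p.2 W)) * e (-(ξ * p.1)) :=
    (hω.continuous_radial_mul.mul (by fun_prop)).mul (by fun_prop)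
  have hint : Integrable (fun p : ℝ × Plane => radial ω p.2 * radial₀ ω₀ (p.1 • p.2) *
      e (-(p.1 * inner ℝ p.2 W)) * e (-(ξ * p.1))) (volume.prod volume) := by
    refine integrable_of_continuous_of_eq_zero (R := 1) hcont fun p hp => ?_
    rw [Prod.norm_def, le_max_iff] at hp
    rw [hω.radial_mul_eq_zero hp, zero_mul, zero_mul]
  have h1 : 𝓕 (ray ω₀ ω W) ξ = ∫ u : Plane, radial ω u *
      ∫ s : ℝ, radial₀ ω₀ (s • u) * e (-(s * inner ℝ u W)) * e (-(ξ * s)) := by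
    rw [fourier_eq_integral]
    have h2 : ∀ s : ℝ, ray ω₀ ω W s * e (-inner ℝ s ξ) = ∫ u : Plane,
        radial ω u * radial₀ ω₀ (s • u) * e (-(s * inner ℝ u W)) * e (-(ξ * s)) := by
      intro s
      rw [ray_eq_integral, ← integral_mul_const]
      simp [mul_comm]
    simp only [h2]
    rw [integral_integral_swap hint]
    congr 1
    ext u
    rw [← integral_const_mul]
    congr 1
    ext s
    ring
  rw [h1]
  have h3 : ∀ u : Plane, ‖radial ω u *
      ∫ s : ℝ, radial₀ ω₀ (s • u) * e (-(s * inner ℝ u W)) * e (-(ξ * s))‖ ≤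
      B * 2 * (2 ^ N * C) / (1 + |ξ|) ^ N := by
    intro u
    by_cases hu : ‖u‖ ≤ 1 / 2 ∨ 1 ≤ ‖u‖
    · rw [hω.radial_eq_zero hu, zero_mul, norm_zero]
      positivity
    push Not at hu
    have hu0 : 0 < ‖u‖ := by linarith [hu.1]
    -- Along the line through `u` the weight is a dilate of `ω₀` by `‖u‖ ∈ (1/2, 1)`, so that the
    -- inner integral is a transform in one variable, evaluated near `ξ`.
    have h4 : ∫ s : ℝ, radial₀ ω₀ (s • u) * e (-(s * inner ℝ u W)) * e (-(ξ * s)) =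
        𝓕 (fun s : ℝ => (ω₀ (‖u‖ * s) : ℂ)) (inner ℝ u W + ξ) := by
      rw [fourier_eq_integral]
      congr 1
      ext s
      rw [hω.radial₀_smul, mul_assoc, ← e_add, mul_comm s]
      congr 2
      simp
      ring
    rw [h4, fourier_comp_mul (fun s : ℝ => (ω₀ s : ℂ)) hu0, norm_mul, norm_mul, radial,
      Complex.norm_real, Complex.norm_real, Real.norm_of_nonneg (hω.nonneg _),
      Real.norm_of_nonneg (by positivity)]
    have h5 : |inner ℝ u W| ≤ ‖W‖ := by
      refine (abs_real_inner_le_norm u W).trans ?_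
      exact mul_le_of_le_one_left (norm_nonneg _) hu.2.le
    have h6 : (1 + |ξ|) / 2 ≤ 1 + ‖(inner ℝ u W + ξ) / ‖u‖‖ := by
      rw [norm_div, norm_norm, Real.norm_eq_abs]
      have h7 : |inner ℝ u W + ξ| ≤ |inner ℝ u W + ξ| / ‖u‖ := by
        rw [le_div_iff₀ hu0]
        exact mul_le_of_le_one_right (abs_nonneg _) hu.2.le
      have h8 : |ξ| - |inner ℝ u W| ≤ |inner ℝ u W + ξ| := by
        have := abs_sub_abs_le_abs_sub ξ (-inner ℝ u W)
        rw [abs_neg, sub_neg_eq_add, add_comm] at this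
        exact this
      linarith
    have h9 : ‖u‖⁻¹ ≤ 2 := by
      rw [inv_le_comm₀ hu0 two_pos]
      linarith [hu.1]
    calc _ ≤ B * (2 * (C / ((1 + |ξ|) / 2) ^ N)) := by
          gcongr
          · exact hB _
          · refine (hC _).trans ?_
            gcongr
      _ = _ := by
          rw [div_pow]
          field_simp
  have h10 : ∀ u ∉ Metric.closedBall (0 : Plane) 1, radial ω u *
      ∫ s : ℝ, radial₀ ω₀ (s • u) * e (-(s * inner ℝ u W)) * e (-(ξ * s)) = 0 := by
    intro u hu
    rw [mem_closedBall_zero_iff, not_le] at hu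
    rw [hω.radial_eq_zero (Or.inr hu.le), zero_mul]
  rw [← setIntegral_eq_integral_of_forall_compl_eq_zero h10]
  refine (norm_setIntegral_le_of_norm_le_const hfin fun u _ => h3 u).trans_eq ?_
  ring

/-! ### The main part of the second kernel -/

theorem star_eq_zero (W : Plane) {x : Plane} (hx : 1 ≤ ‖x‖) : star ω₀ ω W x = 0 := by
  simp [star, hω.radial_eq_zero (Or.inr hx)]

theorem continuous_star (W : Plane) : Continuous (star ω₀ ω W) := by
  have h1 : Continuous fun p : Plane × ℝ =>
      radial ω p.1 * radial₀ ω₀ (p.2 • p.1) * e (-(p.2 * inner ℝ W (perp p.1))) :=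
    (hω.continuous_radial_mul.comp continuous_swap).mul (by fun_prop)
  have h2 := continuous_parametric_integral_of_continuous (μ := volume)
    (f := fun (x : Plane) (s : ℝ) => radial ω x * radial₀ ω₀ (s • x) *
      e (-(s * inner ℝ W (perp x)))) h1 (isCompact_Icc (a := (-1 : ℝ)) (b := 1))
  refine h2.congr fun x => ?_
  rw [star, setIntegral_eq_integral_of_forall_compl_eq_zero]
  intro s hs
  rw [hω.radial_mul_eq_zero (Or.inl ?_), zero_mul]
  by_contra! h
  exact hs ⟨(abs_lt.1 h).1.le, (abs_lt.1 h).2.le⟩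

theorem fourier_star (W ξ : Plane) : 𝓕 (star ω₀ ω W) ξ =
    ∫ s : ℝ, 𝓕 (fun u => radial ω u * radial₀ ω₀ (s • u)) (ξ - s • perp W) := by
  have hcont : Continuous fun p : Plane × ℝ => radial ω p.1 * radial₀ ω₀ (p.2 • p.1) *
      e (-(p.2 * inner ℝ W (perp p.1))) * e (-inner ℝ p.1 ξ) :=
    ((hω.continuous_radial_mul.comp continuous_swap).mul (by fun_prop)).mul (by fun_prop)
  have hint : Integrable (fun p : Plane × ℝ => radial ω p.1 * radial₀ ω₀ (p.2 • p.1) *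
      e (-(p.2 * inner ℝ W (perp p.1))) * e (-inner ℝ p.1 ξ)) (volume.prod volume) := by
    refine integrable_of_continuous_of_eq_zero (R := 1) hcont fun p hp => ?_
    rw [Prod.norm_def, le_max_iff] at hp
    rw [hω.radial_mul_eq_zero hp.symm, zero_mul, zero_mul]
  rw [fourier_eq_integral]
  simp only [star, ← integral_mul_const]
  rw [integral_integral_swap hint]
  congr 1
  ext s
  rw [fourier_eq_integral]
  congr 1
  ext u
  rw [mul_assoc, ← e_add, inner_sub_right, real_inner_smul_right, real_inner_comm (perp W) u,
    inner_perp_left]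
  ring_nf

omit hω in
theorem fourier_dilate_perp (s : ℝ) (ξ : Plane) :
    𝓕 (fun u => radial ω u * radial₀ ω₀ (s • u)) (perp ξ) =
      𝓕 (fun u => radial ω u * radial₀ ω₀ (s • u)) ξ := by
  rw [← perpIso_apply, ← Real.fourier_comp_linearIsometry]
  refine congrArg (fun f : Plane → ℂ => 𝓕 f ξ) (funext fun u => ?_)
  simp [radial, radial₀, norm_smul]

/-- Both kernels have the same main term on the major arcs: this makes them cancel there. -/
theorem fourier_star_zero (W : Plane) : 𝓕 (star ω₀ ω W) 0 = 𝓕 (ray ω₀ ω W) 0 := by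
  -- Transforms of radial functions are invariant under the rotation by a right angle, which removes
  -- the rotation of `W` in `T`.
  rw [hω.fourier_star, fourier_eq_integral, ← integral_neg_eq_self]
  congr 1
  ext s
  rw [inner_zero_right, neg_zero, e_zero, mul_one, ray, zero_sub, neg_smul, neg_neg,
    ← perpIso_apply, ← map_smul, perpIso_apply, fourier_dilate_perp]
  refine congrArg (fun f : Plane → ℂ => 𝓕 f (s • W)) (funext fun u => ?_)
  rw [neg_smul, radial₀_neg]

/-- The transform of `T` decays beyond the frequency `2|W|`, uniformly in `W`. -/
theorem exists_norm_fourier_star_le (N : ℕ) : ∃ C, 0 ≤ C ∧ ∀ W ξ : Plane,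
    ‖𝓕 (star ω₀ ω W) ξ‖ ≤ C * (1 + ‖W‖) ^ N / (1 + ‖ξ‖) ^ N ∧
    (2 * ‖W‖ ≤ ‖ξ‖ → ‖𝓕 (star ω₀ ω W) ξ‖ ≤ C / (1 + ‖ξ‖) ^ N) := by
  obtain ⟨C, hC0, hC⟩ := hω.exists_dilate_decay N
  have hgen : ∀ (W ξ : Plane) (D : ℝ), 0 ≤ D → (∀ s : ℝ, |s| ≤ 1 →
      C / (1 + ‖ξ - s • perp W‖) ^ N ≤ D) → ‖𝓕 (star ω₀ ω W) ξ‖ ≤ D * 2 := by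
    intro W ξ D hD0 hD
    rw [hω.fourier_star]
    have h1 : ∀ s ∉ Set.Icc (-1 : ℝ) 1,
        𝓕 (fun u => radial ω u * radial₀ ω₀ (s • u)) (ξ - s • perp W) = 0 := by
      intro s hs
      refine hω.dilate_eq_zero ?_ _
      by_contra! h
      exact hs ⟨(abs_lt.1 h).1.le, (abs_lt.1 h).2.le⟩
    rw [← setIntegral_eq_integral_of_forall_compl_eq_zero h1]
    refine (norm_setIntegral_le_of_norm_le_const (C := D) (by simp) fun s hs => ?_).trans_eq ?_
    · have hs' : |s| ≤ 1 := abs_le.2 hs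
      exact (hC s hs' _).trans (hD s hs')
    · norm_num
  refine ⟨2 ^ N * C * 2, by positivity, fun W ξ => ⟨?_, fun hξ => ?_⟩⟩
  · have := hgen W ξ (C * (1 + ‖W‖) ^ N / (1 + ‖ξ‖) ^ N) (by positivity) fun s hs => by
      have h1 := one_add_norm_le_mul hs ξ (perp W)
      rw [norm_perp] at h1
      rw [div_le_div_iff₀ (by positivity) (by positivity)]
      calc C * (1 + ‖ξ‖) ^ N ≤ C * ((1 + ‖ξ - s • perp W‖) * (1 + ‖W‖)) ^ N := by gcongr
        _ = _ := by rw [mul_pow]; ring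
    refine this.trans ?_
    have h2 : (1 : ℝ) ≤ 2 ^ N := one_le_pow₀ one_le_two
    rw [div_mul_eq_mul_div]
    refine div_le_div_of_nonneg_right ?_ (by positivity)
    have h3 : 0 ≤ C * 2 * (1 + ‖W‖) ^ N := by positivity
    nlinarith
  · have := hgen W ξ (2 ^ N * C / (1 + ‖ξ‖) ^ N) (by positivity) fun s hs => by
      have h1 : (1 + ‖ξ‖) ≤ 2 * (1 + ‖ξ - s • perp W‖) := by
        have h2 := norm_sub_norm_le ξ (s • perp W)
        have h3 : ‖s • perp W‖ ≤ ‖W‖ := by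
          rw [norm_smul, norm_perp]
          exact mul_le_of_le_one_left (norm_nonneg _) hs
        linarith
      rw [div_le_div_iff₀ (by positivity) (by positivity)]
      calc C * (1 + ‖ξ‖) ^ N ≤ C * (2 * (1 + ‖ξ - s • perp W‖)) ^ N := by gcongr
        _ = _ := by rw [mul_pow]; ring
    refine this.trans_eq ?_
    ring

end Weights

/-! ### The first kernel -/

theorem tsum_pnat_eq_sum_range {E : Type*} [NormedAddCommGroup E] {f : ℕ → E} {n : ℕ}
    (h : ∀ j, n < j → f j = 0) : ∑' j : ℕ+, f j = ∑ j ∈ Finset.range n, f (j + 1) := by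
  rw [tsum_pnat_eq_tsum_succ (f := f)]
  refine tsum_eq_sum fun j hj => h _ ?_
  rw [Finset.mem_range] at hj
  omega

theorem rpow_three_halves {Q : ℝ} (hQ : 0 < Q) : Q ^ (3 / 2 : ℝ) = Q * Q ^ (1 / 2 : ℝ) := by
  nth_rewrite 2 [← Real.rpow_one Q]
  rw [← Real.rpow_add hQ]
  norm_num

theorem rpow_half_sq {Q : ℝ} (hQ : 0 < Q) : (Q ^ (1 / 2 : ℝ)) ^ 2 = Q := by
  rw [← Real.sqrt_eq_rpow, Real.sq_sqrt hQ.le]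

theorem lt_mul_of_floor_div_lt {a b : ℝ} (hb : 0 < b) {j : ℕ} (hj : ⌊a / b⌋₊ < j) : a < b * j := by
  have := Nat.lt_of_floor_lt hj
  rwa [div_lt_iff₀' hb] at this

theorem sum_range_one_div_sq_le {A : ℝ} (hA : 0 ≤ A) (n : ℕ) :
    ∑ j ∈ Finset.range n, 1 / (1 + (j + 1 : ℝ) * A) ^ 2 ≤ n / (1 + n * A) := by
  induction n with
  | zero => simp
  | succ n ih =>
    rw [Finset.sum_range_succ]
    have h1 : (n : ℝ) / (1 + n * A) + 1 / ((1 + (n + 1) * A) * (1 + n * A)) =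
        (n + 1) / (1 + (n + 1) * A) := by
      field_simp
      ring
    push_cast
    rw [← h1]
    have h2 : 1 / (1 + (n + 1 : ℝ) * A) ^ 2 ≤ 1 / ((1 + (n + 1) * A) * (1 + n * A)) := by
      rw [sq]
      gcongr
      linarith
    linarith

theorem one_div_pow_ceil_le {t : ℝ} (ht : 0 ≤ t) (N : ℝ) :
    1 / (1 + t) ^ ⌈N⌉₊ ≤ (1 + t) ^ (-N) := by
  rw [one_div, ← Real.rpow_natCast, ← Real.rpow_neg (by positivity)]
  exact Real.rpow_le_rpow_of_exponent_le (by linarith) (neg_le_neg (Nat.le_ceil N))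

namespace Weights

variable {ω₀ ω : ℝ → ℝ} (hω : Weights ω₀ ω)
include hω

/-- The first kernel in rescaled variables: substituting `x = jqQ^{1/2} u` in the `j`-th term. -/
theorem p1_eq {Q : ℝ} (hQ : 0 < Q) {q : ℕ} (hq : 0 < q) (w : Plane) :
    p1 ω₀ ω Q q w = -((2 * cst ω : ℝ) : ℂ) *
      ∑' j : ℕ+, ray ω₀ ω (Q ^ (3 / 2 : ℝ) • w) ((q / Q : ℝ) * (j : ℝ)) := by
  have hq' : (0 : ℝ) < q := by exact_mod_cast hq
  set X := Q ^ (3 / 2 : ℝ) with hX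
  set Y := Q ^ (1 / 2 : ℝ) with hY
  have hX0 : 0 < X := by positivity
  have hY0 : 0 < Y := by positivity
  have hXY : X = Q * Y := rpow_three_halves hQ
  set n := ⌊Q / q⌋₊ with hn
  have hlarge : ∀ j : ℕ, n < j → Q < q * j := fun j hj => lt_mul_of_floor_div_lt hq' hj
  have h1 : ∑' j : ℕ+, ray ω₀ ω (X • w) ((q / Q : ℝ) * (j : ℝ)) =
      ∑ j ∈ Finset.range n, ray ω₀ ω (X • w) ((q / Q : ℝ) * ((j + 1 : ℕ) : ℝ)) := by
    refine tsum_pnat_eq_sum_range (f := fun j : ℕ => ray ω₀ ω (X • w) ((q / Q : ℝ) * (j : ℝ)))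
      fun j hj => hω.ray_eq_zero _ ?_
    refine le_trans ?_ (le_abs_self _)
    rw [div_mul_eq_mul_div, le_div_iff₀ hQ, one_mul]
    exact (hlarge j hj).le
  have h2 : ∀ x : Plane, ((ω₀ (‖x‖ / X) * ∑' j : ℕ+, 1 / ((q : ℝ) ^ 2 * (j : ℝ) ^ 2) *
      ω (‖x‖ / ((j : ℝ) * q * Y)) : ℝ) : ℂ) * e (-inner ℝ w x) =
      ∑ j ∈ Finset.range n, ((1 / ((q : ℝ) ^ 2 * ((j + 1 : ℕ) : ℝ) ^ 2) : ℝ) : ℂ) *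
        (((ω₀ (‖x‖ / X) * ω (‖x‖ / (((j + 1 : ℕ) : ℝ) * q * Y)) : ℝ) : ℂ) * e (-inner ℝ w x)) := by
    intro x
    by_cases hx : ω₀ (‖x‖ / X) = 0
    · simp [hx]
    have hx1 := hω.lt_half_of_om₀_ne_zero hx
    rw [abs_of_nonneg (by positivity), div_lt_iff₀ hX0] at hx1
    rw [tsum_pnat_eq_sum_range (f := fun j : ℕ => 1 / ((q : ℝ) ^ 2 * (j : ℝ) ^ 2) *
      ω (‖x‖ / ((j : ℝ) * q * Y))) (n := n) fun j hj => ?_]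
    · push_cast
      rw [Finset.mul_sum, Finset.sum_mul]
      refine Finset.sum_congr rfl fun j _ => ?_
      ring
    · have hj' := hlarge j hj
      have hj0 : 0 < (j : ℝ) * q * Y := by
        have : 0 < q * (j : ℝ) := hQ.trans hj'
        rw [mul_comm (j : ℝ)]
        positivity
      rw [hω.om_eq_zero (Or.inl ?_), mul_zero]
      rw [div_le_iff₀ hj0]
      rw [hXY] at hx1
      nlinarith
  have hintg : ∀ j : ℕ, Integrable fun x : Plane =>
      ((ω₀ (‖x‖ / X) * ω (‖x‖ / (((j + 1 : ℕ) : ℝ) * q * Y)) : ℝ) : ℂ) * e (-inner ℝ w x) := by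
    intro j
    have c1 := hω.smooth₀.continuous
    have c2 := hω.smooth.continuous
    refine integrable_of_continuous_of_eq_zero (R := X) ?_ fun x hx => ?_
    · fun_prop
    · rw [hω.om₀_eq_zero, zero_mul, Complex.ofReal_zero, zero_mul]
      rw [abs_of_nonneg (by positivity), le_div_iff₀ hX0]
      linarith
  have h3 : ∀ j : ℕ, ∫ x : Plane,
      ((ω₀ (‖x‖ / X) * ω (‖x‖ / (((j + 1 : ℕ) : ℝ) * q * Y)) : ℝ) : ℂ) * e (-inner ℝ w x) =
      (((((j + 1 : ℕ) : ℝ) * q * Y) ^ 2 : ℝ) : ℂ) *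
        ray ω₀ ω (X • w) ((q / Q : ℝ) * ((j + 1 : ℕ) : ℝ)) := by
    intro j
    set Z : ℝ := ((j + 1 : ℕ) : ℝ) * q * Y with hZ
    have hZ0 : 0 < Z := by positivity
    have h4 := Measure.integral_comp_smul (volume : Measure Plane) (fun x : Plane =>
      ((ω₀ (‖x‖ / X) * ω (‖x‖ / Z) : ℝ) : ℂ) * e (-inner ℝ w x)) Z
    rw [finrank_euclideanSpace, Fintype.card_fin, abs_of_pos (by positivity),
      Complex.real_smul] at h4
    have h5 : ∫ x : Plane, ((ω₀ (‖Z • x‖ / X) * ω (‖Z • x‖ / Z) : ℝ) : ℂ) *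
        e (-inner ℝ w (Z • x)) = ray ω₀ ω (X • w) ((q / Q : ℝ) * ((j + 1 : ℕ) : ℝ)) := by
      rw [ray_eq_integral]
      congr 1
      ext u
      have e1 : (q / Q : ℝ) * ((j + 1 : ℕ) : ℝ) = Z / X := by
        rw [hZ, hXY]
        field_simp
      rw [e1, hω.radial₀_smul, radial, norm_smul, Real.norm_of_nonneg hZ0.le,
        mul_div_cancel_left₀ _ hZ0.ne', real_inner_smul_right, real_inner_smul_right,
        real_inner_comm, div_mul_eq_mul_div]
      push_cast
      rw [show Z / X * (X * inner ℝ u w) = Z * inner ℝ u w by field_simp]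
      ring
    rw [h5] at h4
    rw [h4, ← mul_assoc, ← Complex.ofReal_mul, mul_inv_cancel₀ (by positivity),
      Complex.ofReal_one, one_mul]
  rw [p1, h1]
  simp only [← hX, ← hY, h2]
  rw [integral_finsetSum _ fun j _ => (hintg j).const_mul _, Finset.mul_sum, Finset.mul_sum]
  refine Finset.sum_congr rfl fun j _ => ?_
  rw [integral_const_mul, h3, ← mul_assoc, ← mul_assoc, ← Complex.ofReal_neg, ← Complex.ofReal_neg,
    ← Complex.ofReal_mul, ← Complex.ofReal_mul]
  congr 2
  have hYQ : Y ^ 2 = Q := rpow_half_sq hQ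
  rw [mul_pow, hYQ]
  field_simp

theorem exists_norm_p1_le (N : ℕ) : ∃ C, 0 ≤ C ∧ ∀ Q : ℝ, 1 ≤ Q → ∀ q : ℕ, 1 ≤ q →
    ∀ w : Plane, ‖p1 ω₀ ω Q q w‖ ≤ C * (Q / (q * (1 + ‖w‖ * Q ^ (3 / 2 : ℝ))) *
      (1 / (1 + ‖w‖ * q * Q ^ (1 / 2 : ℝ)) ^ N)) := by
  -- Two of the `N + 2` powers of decay are spent on the sum over `j`.
  obtain ⟨C, hC0, hC⟩ := hω.exists_norm_ray_le (N + 2)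
  have hcst := hω.cst_pos
  refine ⟨2 * cst ω * C, by positivity, fun Q hQ q hq w => ?_⟩
  have hQ0 : 0 < Q := by linarith
  have hq' : (0 : ℝ) < q := by exact_mod_cast hq
  set A : ℝ := ‖w‖ * q * Q ^ (1 / 2 : ℝ) with hA
  have hA0 : 0 ≤ A := by positivity
  rw [hω.p1_eq hQ0 hq, norm_mul, norm_neg, Complex.norm_real, Real.norm_of_nonneg (by positivity),
    mul_assoc (2 * cst ω)]
  gcongr
  set n := ⌊Q / q⌋₊ with hn
  rw [tsum_pnat_eq_sum_range
    (f := fun j : ℕ => ray ω₀ ω (Q ^ (3 / 2 : ℝ) • w) ((q / Q : ℝ) * (j : ℝ))) (n := n)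
    fun j hj => hω.ray_eq_zero _ (by
      refine le_trans ?_ (le_abs_self _)
      rw [div_mul_eq_mul_div, le_div_iff₀ hQ0, one_mul]
      exact (lt_mul_of_floor_div_lt hq' hj).le)]
  have hterm : ∀ j : ℕ, ‖ray ω₀ ω (Q ^ (3 / 2 : ℝ) • w) ((q / Q : ℝ) * ((j + 1 : ℕ) : ℝ))‖ ≤
      C * (1 / (1 + A) ^ N) * (1 / (1 + (j + 1 : ℝ) * A) ^ 2) := by
    intro j
    refine (hC _ _).trans ?_
    have h1 : |(q / Q : ℝ) * ((j + 1 : ℕ) : ℝ)| * ‖Q ^ (3 / 2 : ℝ) • w‖ = (j + 1 : ℝ) * A := by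
      rw [abs_of_nonneg (by positivity), norm_smul, Real.norm_of_nonneg (by positivity),
        rpow_three_halves hQ0, hA]
      push_cast
      field_simp
    rw [h1, pow_add, mul_one_div, mul_one_div, div_div]
    gcongr
    nlinarith [(Nat.cast_nonneg j : (0 : ℝ) ≤ j)]
  refine (norm_sum_le_of_le _ fun j _ => hterm j).trans ?_
  rw [← Finset.mul_sum, mul_assoc, mul_comm (1 / (1 + A) ^ N)]
  gcongr
  refine (sum_range_one_div_sq_le hA0 n).trans ?_
  have hnle : (n : ℝ) ≤ Q / q := Nat.floor_le (by positivity)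
  have h2 : Q / (q * (1 + ‖w‖ * Q ^ (3 / 2 : ℝ))) = (Q / q) / (1 + (Q / q) * A) := by
    rw [hA, rpow_three_halves hQ0]
    field_simp
  rw [h2, div_le_div_iff₀ (by positivity) (by positivity)]
  nlinarith

/-- The first kernel near the origin: the term `1` is the one that survives on the major arcs. -/
theorem exists_norm_p1_sub_le (N : ℕ) : ∃ C, 0 ≤ C ∧ ∀ Q : ℝ, 0 < Q → ∀ q : ℕ, 0 < q →
    ∀ w : Plane, 2 * ‖Q ^ (3 / 2 : ℝ) • w‖ ≤ Q / q →
    ‖p1 ω₀ ω Q q w - (1 - (cst ω * (Q / q) : ℝ) * 𝓕 (ray ω₀ ω (Q ^ (3 / 2 : ℝ) • w)) 0)‖ ≤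
      C * (q / Q) ^ (N + 1) := by
  obtain ⟨C, hC0, hC⟩ := hω.exists_norm_fourier_ray_le (N + 2)
  have hcst := hω.cst_pos
  have hz := zetaTwo_nonneg
  refine ⟨2 * cst ω * (zetaTwo * C), by positivity, fun Q hQ q hq w hw => ?_⟩
  have hq' : (0 : ℝ) < q := by exact_mod_cast hq
  set W := Q ^ (3 / 2 : ℝ) • w with hW
  have h1 := norm_tsum_pnat_sub_le (hω.continuous_ray W) (ray_neg W) (R := 1)
    (fun x hx => hω.ray_eq_zero W hx) (y := q / Q) (by positivity) (N := N) (K := C) (by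
      intro ξ hξ
      rw [one_div_div] at hξ
      have hξ0 : 0 < |ξ| := lt_of_lt_of_le (by positivity) hξ
      refine (hC W ξ (hw.trans hξ)).trans ?_
      gcongr
      linarith)
  rw [hω.p1_eq hQ hq, ← hW]
  have h2 : -((2 * cst ω : ℝ) : ℂ) * ∑' j : ℕ+, ray ω₀ ω W ((q / Q : ℝ) * (j : ℝ)) -
      (1 - (cst ω * (Q / q) : ℝ) * 𝓕 (ray ω₀ ω W) 0) =
      -((2 * cst ω : ℝ) : ℂ) * (∑' j : ℕ+, ray ω₀ ω W ((q / Q : ℝ) * (j : ℝ)) -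
        (𝓕 (ray ω₀ ω W) 0 / (2 * (q / Q : ℝ)) - ray ω₀ ω W 0 / 2)) := by
    rw [hω.ray_zero]
    have e1 : (Q : ℂ) ≠ 0 := by exact_mod_cast hQ.ne'
    have e2 : (q : ℂ) ≠ 0 := by exact_mod_cast hq.ne'
    have e3 : (cst ω : ℂ) ≠ 0 := by exact_mod_cast hcst.ne'
    push_cast
    field_simp
    ring
  rw [h2, norm_mul, norm_neg, Complex.norm_real, Real.norm_of_nonneg (by positivity)]
  calc _ ≤ 2 * cst ω * (zetaTwo * C * (q / Q) ^ (N + 1)) := by gcongr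
    _ = _ := by ring

end Weights

/-! ### The second kernel: reduction to one variable -/

/-- The vector `ρ/|ρ|²`. -/
noncomputable def dual (ρ : Plane) : Plane := (‖ρ‖ ^ 2)⁻¹ • ρ

/-- The point `u` with `ρ·u = z` and `ρ^⊥`-coordinate `s`. -/
noncomputable def framePt (ρ : Plane) (z s : ℝ) : Plane := z • dual ρ + s • perp ρ

/-- The integral of `ω₀(|u|) e(-W·u)` over the line `ρ·u = z`. -/
noncomputable def slice (ω₀ : ℝ → ℝ) (ρ W : Plane) (z : ℝ) : ℂ :=
  ∫ s : ℝ, radial₀ ω₀ (framePt ρ z s) * e (-inner ℝ W (framePt ρ z s))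

/-- The average `∫ ω(|z|) G(vz) dz` of the dilates of the slice function `G`. -/
noncomputable def smear (ω₀ ω : ℝ → ℝ) (ρ W : Plane) (v : ℝ) : ℂ :=
  ∫ z : ℝ, (ω |z| : ℂ) * slice ω₀ ρ W (v * z)

section Frame

variable {ρ : Plane}

theorem inner_perp_self (ρ : Plane) : inner ℝ ρ (perp ρ) = 0 := by
  rw [inner_plane]
  simp [perp]
  ring

theorem inner_dual (h : 0 < ‖ρ‖) : inner ℝ ρ (dual ρ) = 1 := by
  rw [dual, real_inner_smul_right, real_inner_self_eq_norm_sq]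
  field_simp

theorem inner_framePt (h : 0 < ‖ρ‖) (z s : ℝ) : inner ℝ ρ (framePt ρ z s) = z := by
  rw [framePt, inner_add_right, real_inner_smul_right, real_inner_smul_right, inner_perp_self,
    inner_dual h]
  ring

theorem norm_sq_framePt (h : 0 < ‖ρ‖) (z s : ℝ) :
    ‖framePt ρ z s‖ ^ 2 = z ^ 2 / ‖ρ‖ ^ 2 + s ^ 2 * ‖ρ‖ ^ 2 := by
  have h1 : inner ℝ (z • dual ρ) (s • perp ρ) = 0 := by
    rw [dual, real_inner_smul_left, real_inner_smul_left, real_inner_smul_right, inner_perp_self]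
    ring
  rw [framePt, norm_add_sq_real, h1, norm_smul, norm_smul, dual, norm_smul, norm_perp]
  simp only [norm_inv, norm_pow, mul_pow, Real.norm_eq_abs, sq_abs]
  field_simp
  ring

theorem abs_le_norm_framePt (h1 : 1 / 2 ≤ ‖ρ‖) (h2 : ‖ρ‖ ≤ 1) (z s : ℝ) :
    |z| ≤ ‖framePt ρ z s‖ ∧ |s| / 2 ≤ ‖framePt ρ z s‖ := by
  have h0 : 0 < ‖ρ‖ := by linarith
  have h := norm_sq_framePt h0 z s
  have hz : z ^ 2 ≤ z ^ 2 / ‖ρ‖ ^ 2 := by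
    rw [le_div_iff₀ (by positivity)]
    exact mul_le_of_le_one_right (sq_nonneg _) (pow_le_one₀ h0.le h2)
  have hs : s ^ 2 * (1 / 2) ^ 2 ≤ s ^ 2 * ‖ρ‖ ^ 2 := by gcongr
  constructor
  · refine abs_le_of_sq_le_sq ?_ (norm_nonneg _)
    rw [h]
    nlinarith [mul_nonneg (sq_nonneg s) (sq_nonneg ‖ρ‖)]
  · rw [← abs_of_pos (two_pos (α := ℝ)), ← abs_div]
    refine abs_le_of_sq_le_sq ?_ (norm_nonneg _)
    rw [h]
    have : 0 ≤ z ^ 2 / ‖ρ‖ ^ 2 := by positivity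
    nlinarith

theorem framePt_det (h : 0 < ‖ρ‖) : |dual ρ 0 * perp ρ 1 - dual ρ 1 * perp ρ 0| = 1 := by
  have h1 := norm_sq_plane ρ
  have : dual ρ 0 * perp ρ 1 - dual ρ 1 * perp ρ 0 = -1 := by
    simp only [dual, perp, PiLp.smul_apply, smul_eq_mul]
    simp only [Matrix.cons_val_zero, Matrix.cons_val_one]
    have h2 : (‖ρ‖ ^ 2)⁻¹ * ‖ρ‖ ^ 2 = 1 := inv_mul_cancel₀ (by positivity)
    rw [h1] at h2 ⊢
    linarith
  rw [this, abs_neg, abs_one]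

theorem continuous_framePt : Continuous fun p : ℝ × ℝ => framePt ρ p.1 p.2 := by
  unfold framePt
  fun_prop

end Frame

namespace Weights

variable {ω₀ ω : ℝ → ℝ} (hω : Weights ω₀ ω)
include hω

section Slice

variable {ρ : Plane} (h1 : 1 / 2 ≤ ‖ρ‖) (h2 : ‖ρ‖ ≤ 1) (W : Plane)
include h1 h2

theorem radial₀_framePt_eq_zero {z s : ℝ} (h : 1 / 2 ≤ |z| ∨ 1 ≤ |s|) :
    radial₀ ω₀ (framePt ρ z s) = 0 := by
  have h3 := abs_le_norm_framePt h1 h2 z s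
  refine hω.radial₀_eq_zero ?_
  rcases h with h | h
  · exact h.trans h3.1
  · linarith [h3.2]

theorem slice_eq_zero {z : ℝ} (hz : 1 / 2 ≤ |z|) : slice ω₀ ρ W z = 0 := by
  simp [slice, hω.radial₀_framePt_eq_zero h1 h2 (Or.inl hz)]

theorem continuous_slice : Continuous (slice ω₀ ρ W) := by
  have h3 : Continuous fun p : ℝ × ℝ =>
      radial₀ ω₀ (framePt ρ p.1 p.2) * e (-inner ℝ W (framePt ρ p.1 p.2)) := by
    have := hω.contDiff_radial₀.continuous
    have := continuous_framePt (ρ := ρ)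
    fun_prop
  have h4 := continuous_parametric_integral_of_continuous (μ := volume)
    (f := fun z s => radial₀ ω₀ (framePt ρ z s) * e (-inner ℝ W (framePt ρ z s))) h3
    (isCompact_Icc (a := (-1 : ℝ)) (b := 1))
  refine h4.congr fun z => ?_
  rw [slice, setIntegral_eq_integral_of_forall_compl_eq_zero]
  intro s hs
  rw [hω.radial₀_framePt_eq_zero h1 h2 (Or.inr ?_), zero_mul]
  by_contra! h
  exact hs ⟨(abs_lt.1 h).1.le, (abs_lt.1 h).2.le⟩

theorem integrable_mul_slice {k : ℝ → ℂ} (hk : Continuous k) :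
    Integrable fun z => k z * slice ω₀ ρ W z := by
  refine integrable_of_continuous_of_eq_zero (R := 1) (hk.mul (hω.continuous_slice h1 h2 W))
    fun z hz => ?_
  rw [hω.slice_eq_zero h1 h2 W (by rw [Real.norm_eq_abs] at hz; linarith), mul_zero]

theorem integrable_slice : Integrable (slice ω₀ ρ W) := by
  simpa using hω.integrable_mul_slice h1 h2 W (k := fun _ => 1) continuous_const

omit h2 in
/-- Integration over the plane against a function of `ρ·u` alone. -/
theorem integral_mul_slice {k : ℝ → ℂ} (hk : Continuous k) :
    ∫ u : Plane, radial₀ ω₀ u * k (inner ℝ ρ u) * e (-inner ℝ W u) =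
      ∫ z, k z * slice ω₀ ρ W z := by
  have h0 : 0 < ‖ρ‖ := by linarith
  have hc := hω.contDiff_radial₀.continuous
  have hi : Integrable fun u : Plane => radial₀ ω₀ u * k (inner ℝ ρ u) * e (-inner ℝ W u) := by
    refine integrable_of_continuous_of_eq_zero (R := 1) (by fun_prop) fun u hu => ?_
    rw [hω.radial₀_eq_zero (by linarith), zero_mul, zero_mul]
  rw [integral_coords (framePt_det h0) hi]
  congr 1
  ext z
  rw [slice, ← integral_const_mul]
  congr 1
  ext s
  have h3 : z • dual ρ + s • perp ρ = framePt ρ z s := rfl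
  rw [h3, inner_framePt h0]
  ring

omit h2 in
theorem fourier_slice (ξ : ℝ) : 𝓕 (slice ω₀ ρ W) ξ = 𝓕 (radial₀ ω₀) (W + ξ • ρ) := by
  have h3 := hω.integral_mul_slice h1 W (k := fun z => e (-(z * ξ))) (by fun_prop)
  rw [fourier_eq_integral, fourier_eq_integral]
  have h4 : ∀ z, slice ω₀ ρ W z * e (-inner ℝ z ξ) = e (-(z * ξ)) * slice ω₀ ρ W z := by
    intro z
    simp [mul_comm]
  simp only [h4]
  rw [← h3]
  congr 1
  ext u
  rw [mul_assoc, ← e_add, inner_add_right, real_inner_smul_right, real_inner_comm u W,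
    real_inner_comm u ρ]
  ring_nf

omit h2 in
theorem integral_slice : ∫ z, slice ω₀ ρ W z = 𝓕 (radial₀ ω₀) W := by
  have h3 := hω.fourier_slice h1 W 0
  rw [zero_smul, add_zero, fourier_eq_integral] at h3
  simpa using h3

omit h1 h2 in
theorem radial_mul_slice_zero : radial ω ρ * slice ω₀ ρ W 0 = star ω₀ ω W ρ := by
  rw [slice, star, ← integral_const_mul]
  congr 1
  ext s
  have : framePt ρ 0 s = s • perp ρ := by simp [framePt]
  rw [this, hω.radial₀_smul, hω.radial₀_smul, norm_perp, real_inner_smul_right, mul_assoc]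

/-! ### The second kernel: the smeared slices -/

theorem smear_eq_zero {v : ℝ} (hv : 1 ≤ |v|) : smear ω₀ ω ρ W v = 0 := by
  have h3 : ∀ z, (ω |z| : ℂ) * slice ω₀ ρ W (v * z) = 0 := by
    intro z
    by_cases hz : |z| ≤ 1 / 2
    · rw [hω.om_eq_zero (Or.inl hz), Complex.ofReal_zero, zero_mul]
    · push Not at hz
      rw [hω.slice_eq_zero h1 h2 W, mul_zero]
      rw [abs_mul]
      nlinarith
  simp [smear, h3]

theorem continuous_smear : Continuous (smear ω₀ ω ρ W) := by
  have hc := hω.continuous_slice h1 h2 W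
  have hc' := hω.contDiff_om_abs.continuous
  have h3 : Continuous fun p : ℝ × ℝ => (ω |p.2| : ℂ) * slice ω₀ ρ W (p.1 * p.2) := by
    exact (Complex.continuous_ofReal.comp (hc'.comp continuous_snd)).mul
      (hc.comp (continuous_fst.mul continuous_snd))
  have h4 := continuous_parametric_integral_of_continuous (μ := volume)
    (f := fun v z : ℝ => (ω |z| : ℂ) * slice ω₀ ρ W (v * z)) h3
    (isCompact_Icc (a := (-1 : ℝ)) (b := 1))
  refine h4.congr fun v => ?_
  rw [smear, setIntegral_eq_integral_of_forall_compl_eq_zero]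
  intro z hz
  rw [hω.om_abs_eq_zero, Complex.ofReal_zero, zero_mul]
  by_contra! h
  exact hz ⟨(abs_lt.1 h).1.le, (abs_lt.1 h).2.le⟩

omit hω h1 h2 in
theorem smear_neg (v : ℝ) : smear ω₀ ω ρ W (-v) = smear ω₀ ω ρ W v := by
  rw [smear, smear, ← integral_neg_eq_self]
  simp

omit h1 h2 in
theorem smear_zero : smear ω₀ ω ρ W 0 = 2 * slice ω₀ ρ W 0 := by
  simp only [smear, zero_mul]
  rw [integral_mul_const]
  congr 1
  rw [integral_complex_ofReal, integral_comp_abs (f := ω)]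
  have h3 : ∫ x in Set.Ioi (0 : ℝ), ω x = 1 := by
    rw [setIntegral_eq_integral_of_forall_compl_eq_zero, hω.integral]
    intro x hx
    rw [Set.mem_Ioi, not_lt] at hx
    exact hω.om_eq_zero (Or.inl (by linarith))
  rw [h3]
  norm_num

theorem fourier_smear (ξ : ℝ) : 𝓕 (smear ω₀ ω ρ W) ξ =
    ∫ z : ℝ, ((ω |z| / |z| : ℝ) : ℂ) * 𝓕 (radial₀ ω₀) (W + (ξ / z) • ρ) := by
  have hc := hω.continuous_slice h1 h2 W
  have hc' := hω.contDiff_om_abs.continuous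
  have hcont : Continuous fun p : ℝ × ℝ =>
      (ω |p.2| : ℂ) * slice ω₀ ρ W (p.1 * p.2) * e (-(ξ * p.1)) := by
    exact ((Complex.continuous_ofReal.comp (hc'.comp continuous_snd)).mul
      (hc.comp (continuous_fst.mul continuous_snd))).mul (by fun_prop)
  have hint : Integrable (fun p : ℝ × ℝ =>
      (ω |p.2| : ℂ) * slice ω₀ ρ W (p.1 * p.2) * e (-(ξ * p.1))) (volume.prod volume) := by
    refine integrable_of_continuous_of_eq_zero (R := 1) hcont fun p hp => ?_
    rw [Prod.norm_def, le_max_iff, Real.norm_eq_abs, Real.norm_eq_abs] at hp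
    by_cases h3 : |p.2| ≤ 1 / 2 ∨ 1 ≤ |p.2|
    · rw [hω.om_eq_zero h3, Complex.ofReal_zero, zero_mul, zero_mul]
    · push Not at h3
      rw [hω.slice_eq_zero h1 h2 W, mul_zero, zero_mul]
      rw [abs_mul]
      rcases hp with hp | hp
      · nlinarith [h3.1]
      · linarith [h3.2]
  rw [fourier_eq_integral]
  have h3 : ∀ v : ℝ, smear ω₀ ω ρ W v * e (-inner ℝ v ξ) =
      ∫ z : ℝ, (ω |z| : ℂ) * slice ω₀ ρ W (v * z) * e (-(ξ * v)) := by
    intro v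
    rw [smear, ← integral_mul_const]
    simp
  simp only [h3]
  rw [integral_integral_swap hint]
  congr 1
  ext z
  by_cases hz : z = 0
  · simp [hz, hω.om_eq_zero (x := 0) (Or.inl (by norm_num))]
  rw [← hω.fourier_slice h1, fourier_eq_integral]
  simp only [mul_assoc]
  rw [integral_const_mul]
  have h4 := Measure.integral_comp_mul_left
    (fun x => slice ω₀ ρ W x * e (-inner ℝ x (ξ / z))) z
  have h5 : ∀ v : ℝ, slice ω₀ ρ W (v * z) * e (-(ξ * v)) =
      slice ω₀ ρ W (z * v) * e (-inner ℝ (z * v) (ξ / z)) := by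
    intro v
    rw [mul_comm v z]
    congr 3
    simp
    field_simp
  simp only [h5]
  rw [h4, Complex.real_smul, ← mul_assoc, ← Complex.ofReal_mul, abs_inv,
    ← div_eq_mul_inv (ω |z|)]

omit hω in
theorem norm_bounds (ξ : ℝ) : |inner ℝ W (perp ρ)| ≤ ‖W + ξ • ρ‖ ∧
    |inner ℝ W (dual ρ) + ξ| ≤ 2 * ‖W + ξ • ρ‖ := by
  have h0 : 0 < ‖ρ‖ := by linarith
  constructor
  · have h3 : inner ℝ (W + ξ • ρ) (perp ρ) = inner ℝ W (perp ρ) := by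
      rw [inner_add_left, real_inner_smul_left, inner_perp_self]
      ring
    rw [← h3]
    refine (abs_real_inner_le_norm _ _).trans ?_
    rw [norm_perp]
    exact mul_le_of_le_one_right (norm_nonneg _) h2
  · have h3 : inner ℝ (W + ξ • ρ) (dual ρ) = inner ℝ W (dual ρ) + ξ := by
      rw [inner_add_left, real_inner_smul_left, inner_dual h0]
      ring
    rw [← h3]
    refine (abs_real_inner_le_norm _ _).trans ?_
    have h4 : ‖dual ρ‖ ≤ 2 := by
      rw [dual, norm_smul, norm_inv, norm_pow, norm_norm, sq, mul_inv, mul_assoc,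
        inv_mul_cancel₀ h0.ne', mul_one, inv_le_comm₀ h0 two_pos]
      linarith
    rw [mul_comm]
    gcongr

omit hω in
theorem norm_le_add : ‖W‖ ≤ |inner ℝ W (dual ρ)| + 2 * |inner ℝ W (perp ρ)| := by
  have h0 : 0 < ‖ρ‖ := by linarith
  have h3 : ‖W‖ ^ 2 * ‖ρ‖ ^ 2 = (inner ℝ W ρ) ^ 2 + (inner ℝ W (perp ρ)) ^ 2 := by
    rw [norm_sq_plane, norm_sq_plane, inner_plane, inner_plane]
    simp [perp]
    ring
  have h4 : inner ℝ W ρ = ‖ρ‖ ^ 2 * inner ℝ W (dual ρ) := by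
    rw [dual, real_inner_smul_right]
    field_simp
  rw [h4] at h3
  set a := inner ℝ W (dual ρ)
  set b := inner ℝ W (perp ρ)
  have h5 : ‖W‖ ^ 2 = ‖ρ‖ ^ 2 * a ^ 2 + b ^ 2 / ‖ρ‖ ^ 2 := by
    field_simp
    linarith
  have h6 : b ^ 2 / ‖ρ‖ ^ 2 ≤ 4 * b ^ 2 := by
    rw [div_le_iff₀ (by positivity)]
    have : (1 / 2) ^ 2 ≤ ‖ρ‖ ^ 2 := by gcongr
    nlinarith [sq_nonneg b]
  have h7 : ‖ρ‖ ^ 2 * a ^ 2 ≤ a ^ 2 :=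
    mul_le_of_le_one_left (sq_nonneg _) (pow_le_one₀ h0.le h2)
  refine (le_abs_self _).trans (abs_le_of_sq_le_sq ?_ (by positivity))
  nlinarith [sq_abs a, sq_abs b, mul_nonneg (abs_nonneg a) (abs_nonneg b)]

end Slice

end Weights

/-! ### The second kernel: decay of the smeared slices -/

namespace Weights

variable {ω₀ ω : ℝ → ℝ} (hω : Weights ω₀ ω)
include hω

/-- Decay of the smeared slices, uniformly in `ρ` and `W`. It comes from
`Φ(v) = ∫ Ĝ(η) Ω(-vη) dη`, where `Ω` is the transform of `ω(|·|)`. -/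
theorem exists_norm_smear_le (N : ℕ) : ∃ C, 0 ≤ C ∧ ∀ ρ : Plane, 1 / 2 ≤ ‖ρ‖ → ‖ρ‖ ≤ 1 →
    ∀ (W : Plane) (v : ℝ), ‖smear ω₀ ω ρ W v‖ ≤
      C / (1 + |v| * |inner ℝ W (dual ρ)| + |inner ℝ W (perp ρ)|) ^ N := by
  -- Two of the `N + 2` powers of decay are spent on integrability in `η`.
  obtain ⟨A, hA0, hA⟩ := exists_fourier_decay hω.contDiff_radial₀ hω.hasCompactSupport_radial₀
    (N + 2)
  have hs1 : ContDiff ℝ (⊤ : ℕ∞) fun x : ℝ => (ω |x| : ℂ) :=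
    Complex.ofRealCLM.contDiff.comp hω.contDiff_om_abs
  have hs2 : HasCompactSupport fun x : ℝ => (ω |x| : ℂ) :=
    HasCompactSupport.intro (isCompact_Icc (a := (-1 : ℝ)) (b := 1)) fun x hx => by
      rw [hω.om_abs_eq_zero, Complex.ofReal_zero]
      by_contra! h
      exact hx ⟨(abs_lt.1 h).1.le, (abs_lt.1 h).2.le⟩
  obtain ⟨B, hB0, hB⟩ := exists_fourier_decay hs1 hs2 N
  have hint : Integrable fun x : ℝ => 1 / (1 + |x|) ^ 2 := by
    have := integrable_one_add_norm (μ := (volume : Measure ℝ)) (r := 2) (by simp)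
    refine this.congr (Eventually.of_forall fun x => ?_)
    simp only
    rw [Real.rpow_neg (by positivity), one_div, Real.norm_eq_abs]
    norm_cast
  refine ⟨A * B * 3 ^ N * 4 * ∫ x : ℝ, 1 / (1 + |x|) ^ 2, by positivity,
    fun ρ h1 h2 W v => ?_⟩
  set α := inner ℝ W (dual ρ) with hα
  set b := |inner ℝ W (perp ρ)| with hb
  have hb0 : 0 ≤ b := abs_nonneg _
  rcases lt_or_ge 1 |v| with hv | hv
  · rw [hω.smear_eq_zero h1 h2 W hv.le, norm_zero]
    positivity
  have hdec : ∀ η : ℝ, ‖𝓕 (slice ω₀ ρ W) η‖ ≤ 4 * A / (1 + |α + η|) ^ 2 *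
      (1 / (1 + ‖W + η • ρ‖) ^ N) := by
    intro η
    rw [hω.fourier_slice h1]
    refine (hA _).trans ?_
    have h3 := (norm_bounds h1 h2 W η).2
    rw [pow_add, mul_one_div, div_div, div_le_div_iff₀ (by positivity) (by positivity)]
    have h4 : (1 + |α + η|) ^ 2 ≤ (2 * (1 + ‖W + η • ρ‖)) ^ 2 := by
      gcongr
      linarith
    calc A * ((1 + |α + η|) ^ 2 * (1 + ‖W + η • ρ‖) ^ N)
        ≤ A * ((2 * (1 + ‖W + η • ρ‖)) ^ 2 * (1 + ‖W + η • ρ‖) ^ N) := by gcongr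
      _ = _ := by ring
  have hdec2 : ∀ η : ℝ, ‖𝓕 (slice ω₀ ρ W) η‖ ≤ 4 * A * (1 + |α|) ^ 2 / (1 + ‖η‖) ^ 2 := by
    intro η
    refine (hdec η).trans ?_
    have h3 : 1 / (1 + ‖W + η • ρ‖) ^ N ≤ 1 := by
      rw [div_le_one (by positivity)]
      exact one_le_pow₀ (by linarith [norm_nonneg (W + η • ρ)])
    refine (mul_le_of_le_one_right (by positivity) h3).trans ?_
    rw [div_le_div_iff₀ (by positivity) (by positivity), Real.norm_eq_abs]
    have h4 : 1 + |η| ≤ (1 + |α|) * (1 + |α + η|) := by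
      have h5 : |η| ≤ |α + η| + |α| := by
        have := abs_sub (α + η) α
        rwa [add_sub_cancel_left] at this
      nlinarith [abs_nonneg α, abs_nonneg (α + η)]
    calc 4 * A * (1 + |η|) ^ 2 ≤ 4 * A * ((1 + |α|) * (1 + |α + η|)) ^ 2 := by gcongr
      _ = _ := by ring
  have hformula : smear ω₀ ω ρ W v =
      ∫ η, 𝓕 (slice ω₀ ρ W) η * 𝓕 (fun x : ℝ => (ω |x| : ℂ)) (0 - v • η) := by
    rw [← fourier_mul_dilate (hs1.continuous.integrable_of_hasCompactSupport hs2)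
      (hω.continuous_slice h1 h2 W) (hω.integrable_slice h1 h2 W) (N := 2) (by simp) hdec2 v 0,
      fourier_eq_integral, smear]
    simp
  rw [hformula]
  have hbound : ∀ η, ‖𝓕 (slice ω₀ ρ W) η * 𝓕 (fun x : ℝ => (ω |x| : ℂ)) (0 - v • η)‖ ≤
      A * B * 3 ^ N * 4 / (1 + |v| * |α| + b) ^ N * (1 / (1 + |α + η|) ^ 2) := by
    intro η
    have h3 := norm_bounds h1 h2 W η
    have h4 := hB (0 - v • η)
    rw [zero_sub, norm_neg, norm_smul, Real.norm_eq_abs, Real.norm_eq_abs] at h4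
    rw [norm_mul, zero_sub]
    -- If `|α|` is large, then so is one of `|α + η|`, `|η|`, and both transforms together decay.
    have h5 : 1 + |v| * |α| + b ≤ 3 * ((1 + ‖W + η • ρ‖) * (1 + |v| * |η|)) := by
      have h6 : |α| ≤ |α + η| + |η| := by
        have := abs_sub (α + η) η
        rwa [add_sub_cancel_right] at this
      have h7 : |v| * |α| ≤ |α + η| + |v| * |η| := by
        nlinarith [abs_nonneg v, abs_nonneg (α + η)]
      have h8 : 0 ≤ |v| * |η| := by positivity
      nlinarith [norm_nonneg (W + η • ρ), h3.1, h3.2]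
    calc _ ≤ 4 * A / (1 + |α + η|) ^ 2 * (1 / (1 + ‖W + η • ρ‖) ^ N) *
          (B / (1 + |v| * |η|) ^ N) := by
          gcongr
          exact hdec η
      _ = 4 * A * B * 3 ^ N / (3 * ((1 + ‖W + η • ρ‖) * (1 + |v| * |η|))) ^ N *
          (1 / (1 + |α + η|) ^ 2) := by
          rw [mul_pow, mul_pow]
          field_simp
      _ ≤ 4 * A * B * 3 ^ N / (1 + |v| * |α| + b) ^ N * (1 / (1 + |α + η|) ^ 2) := by gcongr
      _ = _ := by ring
  refine (norm_integral_le_of_norm_le ((hint.comp_add_left α).const_mul _)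
    (Eventually.of_forall hbound)).trans_eq ?_
  rw [integral_const_mul, integral_add_left_eq_self (fun x : ℝ => 1 / (1 + |x|) ^ 2) α]
  ring

/-- The transform of the smeared slices beyond the frequency `2|W·ρ|/|ρ|²`. -/
theorem exists_norm_fourier_smear_le (N M : ℕ) : ∃ C, 0 ≤ C ∧ ∀ ρ : Plane, 1 / 2 ≤ ‖ρ‖ →
    ‖ρ‖ ≤ 1 → ∀ (W : Plane) (ξ : ℝ), 2 * |inner ℝ W (dual ρ)| ≤ |ξ| → 0 < |ξ| →
      ‖𝓕 (smear ω₀ ω ρ W) ξ‖ ≤ C / (1 + |inner ℝ W (perp ρ)|) ^ N / |ξ| ^ M := by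
  obtain ⟨A, hA0, hA⟩ := exists_fourier_decay hω.contDiff_radial₀ hω.hasCompactSupport_radial₀
    (N + M)
  obtain ⟨B, hB0, hB⟩ := hω.exists_bound
  refine ⟨2 * B * (4 ^ M * A) * 2, by positivity, fun ρ h1 h2 W ξ hξ hξ0 => ?_⟩
  set b := |inner ℝ W (perp ρ)| with hb
  have hb0 : 0 ≤ b := abs_nonneg _
  rw [hω.fourier_smear h1 h2]
  have h3 : ∀ z ∉ Set.Icc (-1 : ℝ) 1,
      ((ω |z| / |z| : ℝ) : ℂ) * 𝓕 (radial₀ ω₀) (W + (ξ / z) • ρ) = 0 := by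
    intro z hz
    rw [hω.om_abs_eq_zero, zero_div, Complex.ofReal_zero, zero_mul]
    by_contra! h
    exact hz ⟨(abs_lt.1 h).1.le, (abs_lt.1 h).2.le⟩
  have h4 : ∀ z ∈ Set.Icc (-1 : ℝ) 1,
      ‖((ω |z| / |z| : ℝ) : ℂ) * 𝓕 (radial₀ ω₀) (W + (ξ / z) • ρ)‖ ≤
        2 * B * (4 ^ M * A / ((1 + b) ^ N * |ξ| ^ M)) := by
    intro z hz
    by_cases hz1 : |z| ≤ 1 / 2
    · rw [hω.om_eq_zero (Or.inl hz1), zero_div, Complex.ofReal_zero, zero_mul, norm_zero]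
      positivity
    push Not at hz1
    have hz2 : |z| ≤ 1 := abs_le.2 hz
    have hz0 : 0 < |z| := by linarith
    have h5 := norm_bounds h1 h2 W (ξ / z)
    have h6 : |ξ| ≤ |ξ / z| := by
      rw [abs_div, le_div_iff₀ hz0]
      exact mul_le_of_le_one_right (abs_nonneg _) hz2
    have h7 : |ξ / z| ≤ |inner ℝ W (dual ρ) + ξ / z| + |inner ℝ W (dual ρ)| := by
      have := abs_sub (inner ℝ W (dual ρ) + ξ / z) (inner ℝ W (dual ρ))
      rwa [add_sub_cancel_left] at this
    have h8 : |ξ| / 4 ≤ 1 + ‖W + (ξ / z) • ρ‖ := by linarith [h5.2]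
    have h9 : ω |z| / |z| ≤ 2 * B := by
      rw [div_le_iff₀ hz0]
      nlinarith [hB |z|]
    rw [norm_mul, Complex.norm_real, Real.norm_of_nonneg (div_nonneg (hω.nonneg _) hz0.le)]
    gcongr
    refine (hA _).trans ?_
    calc A / (1 + ‖W + (ξ / z) • ρ‖) ^ (N + M) ≤ A / ((1 + b) ^ N * (|ξ| / 4) ^ M) := by
          rw [pow_add]
          have := h5.1
          gcongr
      _ = _ := by
          rw [div_pow]
          field_simp
  rw [← setIntegral_eq_integral_of_forall_compl_eq_zero h3]
  refine (norm_setIntegral_le_of_norm_le_const (by simp) h4).trans_eq ?_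
  rw [measureReal_def, Real.volume_Icc]
  norm_num
  field_simp

/-- For `|z| ≤ 1/2` both halves of the summand defining `h(y, z)` vanish as soon as `yj > 1`. -/
theorem h_eq_sum {y : ℝ} (hy : 0 < y) {z : ℝ} (hz : |z| ≤ 1 / 2) :
    h ω y z = ∑ j ∈ Finset.range ⌊1 / y⌋₊, 1 / (y * ((j + 1 : ℕ) : ℝ)) *
      (ω (y * ((j + 1 : ℕ) : ℝ)) - ω (|z| / (y * ((j + 1 : ℕ) : ℝ)))) := by
  refine tsum_pnat_eq_sum_range (f := fun j : ℕ => 1 / (y * (j : ℝ)) *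
    (ω (y * (j : ℝ)) - ω (|z| / (y * (j : ℝ))))) fun j hj => ?_
  have hj' := lt_mul_of_floor_div_lt hy hj
  rw [hω.om_eq_zero (Or.inr hj'.le), hω.om_eq_zero (Or.inl ?_), sub_zero, mul_zero]
  rw [div_le_iff₀ (by linarith)]
  linarith

/-- The second kernel in rescaled variables: integrating over the lines `ρ·u = z` turns the integral
over the plane into sums of slices. -/
theorem p2_eq {Q : ℝ} (hQ : 0 < Q) {r : Fin 2 → ℤ} (hr1 : Q ^ (1 / 2 : ℝ) / 2 ≤ ‖vec r‖)
    (hr2 : ‖vec r‖ ≤ Q ^ (1 / 2 : ℝ)) {k q : ℕ} (hk : 0 < k) (hq : 0 < q) (w : Plane)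
    {ρ W : Plane} (hρ : ρ = (Q ^ (1 / 2 : ℝ))⁻¹ • vec r) (hW : W = Q ^ (3 / 2 : ℝ) • w) {y : ℝ}
    (hy : y = (k : ℝ) * q / Q) :
    p2 ω₀ ω Q r k q w = (cst ω : ℂ) *
      ((∑ j ∈ Finset.range ⌊1 / y⌋₊,
          ((ω |y * ((j + 1 : ℕ) : ℝ)| / |y * ((j + 1 : ℕ) : ℝ)| : ℝ) : ℂ)) * 𝓕 (radial₀ ω₀) W -
        ∑ j ∈ Finset.range ⌊1 / y⌋₊, smear ω₀ ω ρ W (y * ((j + 1 : ℕ) : ℝ))) := by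
  set X := Q ^ (3 / 2 : ℝ) with hX
  set Y := Q ^ (1 / 2 : ℝ) with hY
  have hX0 : 0 < X := by positivity
  have hY0 : 0 < Y := by positivity
  have hXY : X = Q * Y := rpow_three_halves hQ
  have hYQ : Y ^ 2 = Q := rpow_half_sq hQ
  have hk' : (0 : ℝ) < k := by exact_mod_cast hk
  have hq' : (0 : ℝ) < q := by exact_mod_cast hq
  have hy0 : 0 < y := by rw [hy]; positivity
  have hρn : ‖ρ‖ = ‖vec r‖ / Y := by
    rw [hρ, norm_smul, Real.norm_of_nonneg (by positivity)]
    field_simp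
  have h1 : 1 / 2 ≤ ‖ρ‖ := by
    rw [hρn, le_div_iff₀ hY0]
    linarith
  have h2 : ‖ρ‖ ≤ 1 := by
    rw [hρn, div_le_one hY0]
    exact hr2
  set n := ⌊1 / y⌋₊ with hn
  have h3 := Measure.integral_comp_smul (volume : Measure Plane) (fun x : Plane =>
    ((ω₀ (‖x‖ / X) * h ω ((k : ℝ) * q / Q) (inner ℝ (vec r) x / Q ^ 2) : ℝ) : ℂ) *
      e (-inner ℝ w x)) X
  rw [finrank_euclideanSpace, Fintype.card_fin, abs_of_pos (by positivity),
    Complex.real_smul] at h3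
  set k0 : ℕ → ℝ → ℝ := fun j z => 1 / (y * ((j + 1 : ℕ) : ℝ)) *
      (ω |y * ((j + 1 : ℕ) : ℝ)| - ω (|z| / (y * ((j + 1 : ℕ) : ℝ)))) with hk0
  have hpos : ∀ j : ℕ, 0 < y * ((j + 1 : ℕ) : ℝ) := fun j => by positivity
  have hk0c : ∀ j, Continuous (k0 j) := by
    intro j
    have c2 := hω.smooth.continuous
    fun_prop
  have h4 : ∀ u : Plane, ((ω₀ (‖X • u‖ / X) * h ω ((k : ℝ) * q / Q)
      (inner ℝ (vec r) (X • u) / Q ^ 2) : ℝ) : ℂ) * e (-inner ℝ w (X • u)) =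
      ∑ j ∈ Finset.range n,
        radial₀ ω₀ u * (k0 j (inner ℝ ρ u) : ℂ) * e (-inner ℝ W u) := by
    intro u
    rw [norm_smul, Real.norm_of_nonneg hX0.le, mul_div_cancel_left₀ _ hX0.ne', ← hy,
      real_inner_smul_right, real_inner_smul_right]
    have e1 : X * inner ℝ (vec r) u / Q ^ 2 = inner ℝ ρ u := by
      rw [hρ, real_inner_smul_left, hXY]
      have : Q ^ 2 = Q * Y ^ 2 := by rw [hYQ]; ring
      rw [this]
      field_simp
    have e2 : X * inner ℝ w u = inner ℝ W u := by rw [hW, real_inner_smul_left]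
    rw [e1, e2]
    by_cases hu : 1 / 2 ≤ ‖u‖
    · simp [hω.om₀_eq_zero (x := ‖u‖) (by rwa [abs_norm]), radial₀]
    push Not at hu
    have hz : |inner ℝ ρ u| ≤ 1 / 2 := by
      refine (abs_real_inner_le_norm _ _).trans ?_
      nlinarith [norm_nonneg u]
    rw [hω.h_eq_sum hy0 hz, radial₀]
    push_cast
    rw [Finset.mul_sum, Finset.sum_mul]
    refine Finset.sum_congr rfl fun j _ => ?_
    simp only [hk0, abs_of_pos (hpos j)]
    push_cast
    ring
  have hi : ∀ j : ℕ, Integrable fun u : Plane =>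
      radial₀ ω₀ u * (k0 j (inner ℝ ρ u) : ℂ) * e (-inner ℝ W u) := by
    intro j
    have c1 := hω.contDiff_radial₀.continuous
    have c2 := hk0c j
    refine integrable_of_continuous_of_eq_zero (R := 1) (by fun_prop) fun u hu => ?_
    rw [hω.radial₀_eq_zero (by linarith), zero_mul, zero_mul]
  have h5 : ∀ j : ℕ, ∫ u : Plane, radial₀ ω₀ u * (k0 j (inner ℝ ρ u) : ℂ) * e (-inner ℝ W u) =
      ((ω |y * ((j + 1 : ℕ) : ℝ)| / |y * ((j + 1 : ℕ) : ℝ)| : ℝ) : ℂ) * 𝓕 (radial₀ ω₀) W -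
        smear ω₀ ω ρ W (y * ((j + 1 : ℕ) : ℝ)) := by
    intro j
    set v := y * ((j + 1 : ℕ) : ℝ) with hv
    have hv0 : 0 < v := hpos j
    rw [hω.integral_mul_slice h1 W (k := fun z => (k0 j z : ℂ))
      (Complex.continuous_ofReal.comp (hk0c j))]
    have c2 := hω.smooth.continuous
    have e1 : ∀ z, (k0 j z : ℂ) * slice ω₀ ρ W z =
        ((ω |v| / |v| : ℝ) : ℂ) * slice ω₀ ρ W z -
          ((1 / v * ω (|z| / v) : ℝ) : ℂ) * slice ω₀ ρ W z := by
      intro z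
      simp only [hk0, ← hv]
      rw [abs_of_pos hv0]
      push_cast
      ring
    simp only [e1]
    rw [integral_sub (hω.integrable_mul_slice h1 h2 W continuous_const)
      (hω.integrable_mul_slice h1 h2 W (by fun_prop)), integral_const_mul,
      hω.integral_slice h1]
    congr 1
    have e2 := Measure.integral_comp_mul_left
      (fun z => ((1 / v * ω (|z| / v) : ℝ) : ℂ) * slice ω₀ ρ W z) v
    rw [abs_of_pos (by positivity), Complex.real_smul] at e2
    have e3 : ∫ z : ℝ, ((1 / v * ω (|v * z| / v) : ℝ) : ℂ) * slice ω₀ ρ W (v * z) =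
        ((v⁻¹ : ℝ) : ℂ) * smear ω₀ ω ρ W v := by
      rw [smear, ← integral_const_mul]
      congr 1
      ext z
      rw [abs_mul, abs_of_pos hv0, mul_div_cancel_left₀ _ hv0.ne']
      push_cast
      ring
    rw [e3] at e2
    have hvc : ((v⁻¹ : ℝ) : ℂ) ≠ 0 := by
      rw [Complex.ofReal_ne_zero]
      positivity
    exact (mul_left_cancel₀ hvc e2).symm
  simp only [h4] at h3
  rw [integral_finsetSum _ fun j _ => hi j] at h3
  simp only [h5] at h3
  rw [Finset.sum_sub_distrib, ← Finset.sum_mul] at h3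
  rw [h3, p2, ← mul_assoc, ← Complex.ofReal_mul]
  congr 2
  have : X ^ 2 = Q ^ 3 := by rw [hXY, mul_pow, hYQ]; ring
  rw [this]
  field_simp

end Weights

/-! ### The second kernel: decay and behaviour near the origin -/

/-- The second kernel in rescaled variables `ρ = r/Q^{1/2}`, `W = Q^{3/2}w`, `y = kq/Q`, without
the factor `c_ω`. -/
noncomputable def rescaledKernel (ω₀ ω : ℝ → ℝ) (ρ W : Plane) (y : ℝ) : ℂ :=
  (∑ j ∈ Finset.range ⌊1 / y⌋₊,
      ((ω |y * ((j + 1 : ℕ) : ℝ)| / |y * ((j + 1 : ℕ) : ℝ)| : ℝ) : ℂ)) * 𝓕 (radial₀ ω₀) W -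
    ∑ j ∈ Finset.range ⌊1 / y⌋₊, smear ω₀ ω ρ W (y * ((j + 1 : ℕ) : ℝ))

namespace Weights

variable {ω₀ ω : ℝ → ℝ} (hω : Weights ω₀ ω)
include hω

/-- For small `y` and `y|W|` the function `h(y, ·)` acts on the slices like a delta measure at
the origin: Poisson summation is applied to both halves of the sum defining `h`, and the two zero
frequencies cancel. -/
theorem exists_norm_rescaledKernel_sub_le (N m : ℕ) : ∃ C, 0 ≤ C ∧ ∀ ρ : Plane, 1 / 2 ≤ ‖ρ‖ →
    ‖ρ‖ ≤ 1 → ∀ (W : Plane) (y : ℝ), 0 < y → 2 * |inner ℝ W (dual ρ)| * y ≤ 1 →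
      ‖rescaledKernel ω₀ ω ρ W y - slice ω₀ ρ W 0‖ ≤
        C * y ^ (m + 1) / (1 + |inner ℝ W (perp ρ)|) ^ N := by
  obtain ⟨A, hA0, hA⟩ := exists_fourier_decay hω.contDiff_radial₀ hω.hasCompactSupport_radial₀ N
  obtain ⟨D, hD0, hD⟩ := hω.exists_norm_fourier_smear_le N (m + 2)
  set κ : ℝ → ℂ := fun x => ((ω |x| / |x| : ℝ) : ℂ) with hκ
  have hκ1 : ContDiff ℝ (⊤ : ℕ∞) κ := Complex.ofRealCLM.contDiff.comp hω.contDiff_om_abs_div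
  have hκR : ∀ x, 1 ≤ |x| → κ x = 0 := by
    intro x hx
    rw [hκ]
    simp only
    rw [hω.om_abs_eq_zero hx, zero_div, Complex.ofReal_zero]
  have hκ2 : HasCompactSupport κ :=
    HasCompactSupport.intro (isCompact_Icc (a := (-1 : ℝ)) (b := 1)) fun x hx => by
      apply hκR
      by_contra! h
      exact hx ⟨(abs_lt.1 h).1.le, (abs_lt.1 h).2.le⟩
  obtain ⟨B, hB0, hB⟩ := exists_fourier_decay hκ1 hκ2 (m + 2)
  have hz := zetaTwo_nonneg
  refine ⟨zetaTwo * B * A + zetaTwo * D, by positivity, fun ρ h1 h2 W y hy hay => ?_⟩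
  set b := |inner ℝ W (perp ρ)| with hb
  have hb0 : 0 ≤ b := abs_nonneg _
  have hlarge : ∀ j : ℕ, ⌊1 / y⌋₊ < j → 1 ≤ |y * (j : ℝ)| := fun j hj =>
    (lt_mul_of_floor_div_lt hy hj).le.trans (le_abs_self _)
  have s1 : ∑ j ∈ Finset.range ⌊1 / y⌋₊, κ (y * ((j + 1 : ℕ) : ℝ)) =
      ∑' j : ℕ+, κ (y * (j : ℝ)) :=
    (tsum_pnat_eq_sum_range (f := fun j : ℕ => κ (y * (j : ℝ)))
      fun j hj => hκR _ (hlarge j hj)).symm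
  have s2 : ∑ j ∈ Finset.range ⌊1 / y⌋₊, smear ω₀ ω ρ W (y * ((j + 1 : ℕ) : ℝ)) =
      ∑' j : ℕ+, smear ω₀ ω ρ W (y * (j : ℝ)) :=
    (tsum_pnat_eq_sum_range (f := fun j : ℕ => smear ω₀ ω ρ W (y * (j : ℝ)))
      fun j hj => hω.smear_eq_zero h1 h2 W (hlarge j hj)).symm
  have p1 := norm_tsum_pnat_sub_le hκ1.continuous (fun x => by simp [hκ]) hκR hy (N := m) (K := B)
    (by
      intro ξ hξ
      have hξ0 : 0 < |ξ| := lt_of_lt_of_le (by positivity) hξ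
      refine (hB ξ).trans ?_
      rw [Real.norm_eq_abs]
      gcongr
      linarith)
  have p2 := norm_tsum_pnat_sub_le (hω.continuous_smear h1 h2 W) (smear_neg W)
    (fun x hx => hω.smear_eq_zero h1 h2 W hx) hy (N := m) (K := D / (1 + b) ^ N) (by
      intro ξ hξ
      have hξ0 : 0 < |ξ| := lt_of_lt_of_le (by positivity) hξ
      refine hD ρ h1 h2 W ξ (le_trans ?_ hξ) hξ0
      rwa [le_div_iff₀ hy])
  have hκ0 : κ 0 = 0 := by simp [hκ]
  have hF0 : 𝓕 (smear ω₀ ω ρ W) 0 = 𝓕 κ 0 * 𝓕 (radial₀ ω₀) W := by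
    rw [hω.fourier_smear h1 h2, fourier_eq_integral κ, ← integral_mul_const]
    simp [hκ]
  have heq : rescaledKernel ω₀ ω ρ W y - slice ω₀ ρ W 0 =
      (∑' j : ℕ+, κ (y * (j : ℝ)) - (𝓕 κ 0 / (2 * y) - κ 0 / 2)) * 𝓕 (radial₀ ω₀) W -
      (∑' j : ℕ+, smear ω₀ ω ρ W (y * (j : ℝ)) -
        (𝓕 (smear ω₀ ω ρ W) 0 / (2 * y) - smear ω₀ ω ρ W 0 / 2)) := by
    rw [rescaledKernel, s1, s2, hF0, hκ0, hω.smear_zero]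
    ring
  rw [heq]
  have hbW : b ≤ ‖W‖ := by simpa using (norm_bounds h1 h2 W 0).1
  have hFW : ‖𝓕 (radial₀ ω₀) W‖ ≤ A / (1 + b) ^ N := by
    refine (hA W).trans ?_
    gcongr
  refine (norm_sub_le _ _).trans ?_
  rw [norm_mul]
  calc _ ≤ zetaTwo * B * y ^ (m + 1) * (A / (1 + b) ^ N) +
        zetaTwo * (D / (1 + b) ^ N) * y ^ (m + 1) := by gcongr
    _ = _ := by ring

theorem exists_norm_rescaledKernel_le (N : ℕ) : ∃ C, 0 ≤ C ∧ ∀ ρ : Plane, 1 / 2 ≤ ‖ρ‖ →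
    ‖ρ‖ ≤ 1 → ∀ (W : Plane) (y : ℝ), 0 < y →
      ‖rescaledKernel ω₀ ω ρ W y‖ ≤ C * (1 / (1 + y * ‖W‖ + |inner ℝ W (perp ρ)|) ^ N) := by
  -- One additional power of decay pays for a factor `a`, two for the sum over `j`.
  obtain ⟨A, hA0, hA⟩ := exists_fourier_decay hω.contDiff_radial₀ hω.hasCompactSupport_radial₀
    (N + 1)
  obtain ⟨B, hB0, hB⟩ := hω.exists_bound
  obtain ⟨D, hD0, hD⟩ := hω.exists_norm_smear_le N
  obtain ⟨E, hE0, hE⟩ := hω.exists_norm_smear_le (N + 2)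
  obtain ⟨G, hG0, hG⟩ := hω.exists_norm_rescaledKernel_sub_le N 0
  refine ⟨3 ^ N * (G + D) + (2 ^ N * (8 * B * A) + 3 ^ N * (2 * E)), by positivity,
    fun ρ h1 h2 W y hy => ?_⟩
  set a := |inner ℝ W (dual ρ)| with ha
  set b := |inner ℝ W (perp ρ)| with hb
  have ha0 : 0 ≤ a := abs_nonneg _
  have hb0 : 0 ≤ b := abs_nonneg _
  have hW := norm_le_add h1 h2 W
  have hbW : b ≤ ‖W‖ := by simpa using (norm_bounds h1 h2 W 0).1
  have haW : a ≤ 2 * ‖W‖ := by simpa using (norm_bounds h1 h2 W 0).2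
  -- For `y > 1` both sums over `j` are empty.
  rcases lt_or_ge 1 y with hy1 | hy1
  · have hfl : ⌊1 / y⌋₊ = 0 := by
      rw [Nat.floor_eq_zero, div_lt_one hy]
      exact hy1
    rw [rescaledKernel, hfl]
    simp only [Finset.range_zero, Finset.sum_empty, zero_mul, sub_zero, norm_zero]
    positivity
  -- If `y` is small compared with `1 / a`, Poisson summation shows that the kernel is close to the
  -- slice through the origin. Otherwise both sums are bounded by their absolute values.
  rcases le_or_gt (2 * a * y) 1 with hay | hay
  · have e1 := hG ρ h1 h2 W y hy hay
    have e2 := hD ρ h1 h2 W 0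
    rw [hω.smear_zero, norm_mul, abs_zero, zero_mul, add_zero] at e2
    have e3 : ‖(2 : ℂ)‖ = 2 := by simp
    rw [e3] at e2
    have e4 : ‖rescaledKernel ω₀ ω ρ W y‖ ≤ (G + D) / (1 + b) ^ N := by
      have e5 := norm_add_le (rescaledKernel ω₀ ω ρ W y - slice ω₀ ρ W 0) (slice ω₀ ρ W 0)
      rw [sub_add_cancel] at e5
      have e6 : G * y ^ (0 + 1) / (1 + b) ^ N ≤ G / (1 + b) ^ N := by
        gcongr
        rw [zero_add, pow_one]
        exact mul_le_of_le_one_right hG0 hy1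
      rw [add_div]
      linarith [norm_nonneg (slice ω₀ ρ W 0)]
    have e7 : 1 + y * ‖W‖ + b ≤ 3 * (1 + b) := by nlinarith
    calc _ ≤ (G + D) / (1 + b) ^ N := e4
      _ = 3 ^ N * (G + D) * (1 / (3 * (1 + b)) ^ N) := by
        rw [mul_pow]
        field_simp
      _ ≤ 3 ^ N * (G + D) * (1 / (1 + y * ‖W‖ + b) ^ N) := by gcongr
      _ ≤ _ := by
        gcongr
        have : 0 ≤ 2 ^ N * (8 * B * A) + 3 ^ N * (2 * E) := by positivity
        linarith
  · set n := ⌊1 / y⌋₊ with hn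
    have hnle : (n : ℝ) ≤ 1 / y := Nat.floor_le (by positivity)
    have ha' : 0 < a := by
      by_contra! h
      nlinarith
    have hya : 0 < y * a := by positivity
    -- The number of terms is at most `1 / y < 2 a`.
    have e1 : ‖∑ j ∈ Finset.range n,
        ((ω |y * ((j + 1 : ℕ) : ℝ)| / |y * ((j + 1 : ℕ) : ℝ)| : ℝ) : ℂ)‖ ≤ 4 * B * a := by
      have e2 : ∀ j ∈ Finset.range n,
          ‖((ω |y * ((j + 1 : ℕ) : ℝ)| / |y * ((j + 1 : ℕ) : ℝ)| : ℝ) : ℂ)‖ ≤ 2 * B := by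
        intro j _
        rw [Complex.norm_real, Real.norm_of_nonneg (div_nonneg (hω.nonneg _) (abs_nonneg _))]
        set v := |y * ((j + 1 : ℕ) : ℝ)|
        by_cases hv : v ≤ 1 / 2
        · rw [hω.om_eq_zero (Or.inl hv), zero_div]
          positivity
        · push Not at hv
          rw [div_le_iff₀ (by linarith)]
          nlinarith [hB v]
      refine (norm_sum_le_of_le _ e2).trans ?_
      rw [Finset.sum_const, Finset.card_range, nsmul_eq_mul]
      calc (n : ℝ) * (2 * B) ≤ 1 / y * (2 * B) := by gcongr
        _ ≤ (2 * a) * (2 * B) := by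
          gcongr
          rw [div_le_iff₀ hy]
          exact hay.le
        _ = _ := by ring
    have e3 : ‖∑ j ∈ Finset.range n, smear ω₀ ω ρ W (y * ((j + 1 : ℕ) : ℝ))‖ ≤
        2 * E / (1 + y * a + b) ^ N := by
      have e4 : ∀ j ∈ Finset.range n, ‖smear ω₀ ω ρ W (y * ((j + 1 : ℕ) : ℝ))‖ ≤
          E / (1 + y * a + b) ^ N * (1 / (1 + (j + 1 : ℝ) * (y * a)) ^ 2) := by
        intro j _
        refine (hE ρ h1 h2 W _).trans ?_
        rw [abs_of_pos (by positivity), pow_add, mul_one_div, div_div]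
        push_cast
        have e5 : y * a ≤ y * (j + 1) * a := by
          have : (0 : ℝ) ≤ j := Nat.cast_nonneg j
          nlinarith
        have e6 : 1 + (j + 1 : ℝ) * (y * a) ≤ 1 + y * (j + 1) * a + b := by
          linarith
        gcongr
      refine (norm_sum_le_of_le _ e4).trans ?_
      rw [← Finset.mul_sum]
      have e7 := sum_range_one_div_sq_le hya.le n
      have e8 : (n : ℝ) / (1 + n * (y * a)) ≤ 2 := by
        rw [div_le_iff₀ (by positivity)]
        have : (0 : ℝ) ≤ n := Nat.cast_nonneg n
        nlinarith
      calc _ ≤ E / (1 + y * a + b) ^ N * 2 := by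
            gcongr
            exact e7.trans e8
        _ = _ := by ring
    have e9 : 1 + y * ‖W‖ + b ≤ 3 * (1 + y * a + b) := by
      have : y * ‖W‖ ≤ y * (a + 2 * b) := by gcongr
      nlinarith
    have e10 : 1 + y * ‖W‖ + b ≤ 2 * (1 + ‖W‖) := by nlinarith [norm_nonneg W]
    have e11 : 4 * B * a * (A / (1 + ‖W‖) ^ (N + 1)) ≤
        2 ^ N * (8 * B * A) * (1 / (1 + y * ‖W‖ + b) ^ N) := by
      calc _ ≤ 4 * B * (2 * (1 + ‖W‖)) * (A / (1 + ‖W‖) ^ (N + 1)) := by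
            gcongr
            linarith
        _ = 2 ^ N * (8 * B * A) * (1 / (2 * (1 + ‖W‖)) ^ N) := by
            rw [pow_succ, mul_pow]
            field_simp
            ring
        _ ≤ _ := by gcongr
    have e12 : 2 * E / (1 + y * a + b) ^ N ≤
        3 ^ N * (2 * E) * (1 / (1 + y * ‖W‖ + b) ^ N) := by
      calc _ = 3 ^ N * (2 * E) * (1 / (3 * (1 + y * a + b)) ^ N) := by
            rw [mul_pow]
            field_simp
        _ ≤ _ := by gcongr
    rw [rescaledKernel]
    refine (norm_sub_le _ _).trans ?_
    rw [norm_mul]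
    calc _ ≤ 4 * B * a * (A / (1 + ‖W‖) ^ (N + 1)) + 2 * E / (1 + y * a + b) ^ N := by
          gcongr
          exact hA W
      _ ≤ (2 ^ N * (8 * B * A) + 3 ^ N * (2 * E)) * (1 / (1 + y * ‖W‖ + b) ^ N) := by
          rw [add_mul]
          exact add_le_add e11 e12
      _ ≤ _ := by
          refine mul_le_mul_of_nonneg_right ?_ (by positivity)
          have : 0 ≤ 3 ^ N * (G + D) := by positivity
          linarith

theorem exists_norm_p2_le (N : ℕ) : ∃ C, 0 ≤ C ∧ ∀ Q : ℝ, 0 < Q → ∀ r : Fin 2 → ℤ,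
    Q ^ (1 / 2 : ℝ) / 2 ≤ ‖vec r‖ → ‖vec r‖ ≤ Q ^ (1 / 2 : ℝ) →
    ∀ k q : ℕ, 1 ≤ k → 1 ≤ q → ∀ w : Plane, ‖p2 ω₀ ω Q r k q w‖ ≤
      C * (1 / (1 + ‖w‖ * k * q * Q ^ (1 / 2 : ℝ) + |inner ℝ w (perp (vec r))| * Q) ^ N) := by
  obtain ⟨C, hC0, hC⟩ := hω.exists_norm_rescaledKernel_le N
  have hcst := hω.cst_pos
  refine ⟨cst ω * C, by positivity, fun Q hQ r hr1 hr2 k q hk hq w => ?_⟩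
  have hk' : (0 : ℝ) < k := by exact_mod_cast hk
  have hq' : (0 : ℝ) < q := by exact_mod_cast hq
  set Y := Q ^ (1 / 2 : ℝ) with hY
  have hY0 : 0 < Y := by positivity
  have hYQ : Y ^ 2 = Q := rpow_half_sq hQ
  have hX0 : 0 < Q ^ (3 / 2 : ℝ) := by positivity
  have hρn : ‖Y⁻¹ • vec r‖ = ‖vec r‖ / Y := by
    rw [norm_smul, Real.norm_of_nonneg (by positivity)]
    field_simp
  have := hC (Y⁻¹ • vec r) (by rw [hρn, le_div_iff₀ hY0]; linarith)
    (by rw [hρn, div_le_one hY0]; exact hr2) (Q ^ (3 / 2 : ℝ) • w) ((k : ℝ) * q / Q)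
    (by positivity)
  rw [hω.p2_eq hQ hr1 hr2 hk hq w rfl rfl rfl, norm_mul, Complex.norm_real,
    Real.norm_of_nonneg hcst.le, mul_assoc (cst ω)]
  gcongr
  refine this.trans_eq ?_
  rw [norm_smul, Real.norm_of_nonneg hX0.le, ← perpIso_apply, map_smul, perpIso_apply,
    real_inner_smul_left, real_inner_smul_right, abs_mul, abs_mul, abs_of_pos hX0,
    abs_of_pos (inv_pos.2 hY0), rpow_three_halves hQ, ← hY]
  congr 3
  field_simp

/-- When `kq/Q` is small and `w` is close to the origin, the second kernel weighted by `ω` is the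
value of `c_ω T` at `r/Q^{1/2}`, up to a negligible error. -/
theorem exists_norm_p2_sub_le (m : ℕ) : ∃ C, 0 ≤ C ∧ ∀ Q : ℝ, 0 < Q → ∀ r : Fin 2 → ℤ,
    Q ^ (1 / 2 : ℝ) / 2 ≤ ‖vec r‖ → ‖vec r‖ ≤ Q ^ (1 / 2 : ℝ) →
    ∀ k q : ℕ, 1 ≤ k → 1 ≤ q → ∀ w : Plane,
    4 * ‖Q ^ (3 / 2 : ℝ) • w‖ * (k * q / Q) ≤ 1 →
    ‖(ω (‖vec r‖ / Q ^ (1 / 2 : ℝ)) : ℂ) * p2 ω₀ ω Q r k q w -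
      cst ω * star ω₀ ω (Q ^ (3 / 2 : ℝ) • w) ((Q ^ (1 / 2 : ℝ))⁻¹ • vec r)‖ ≤
        C * (k * q / Q) ^ (m + 1) := by
  obtain ⟨C, hC0, hC⟩ := hω.exists_norm_rescaledKernel_sub_le 0 m
  obtain ⟨B, hB0, hB⟩ := hω.exists_bound
  have hcst := hω.cst_pos
  refine ⟨B * cst ω * C, by positivity, fun Q hQ r hr1 hr2 k q hk hq w hw => ?_⟩
  have hk' : (0 : ℝ) < k := by exact_mod_cast hk
  have hq' : (0 : ℝ) < q := by exact_mod_cast hq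
  set Y := Q ^ (1 / 2 : ℝ) with hY
  have hY0 : 0 < Y := by positivity
  have hρn : ‖Y⁻¹ • vec r‖ = ‖vec r‖ / Y := by
    rw [norm_smul, Real.norm_of_nonneg (by positivity)]
    field_simp
  set ρ := Y⁻¹ • vec r with hρ
  set W := Q ^ (3 / 2 : ℝ) • w with hW
  have h1 : 1 / 2 ≤ ‖ρ‖ := by
    rw [hρn, le_div_iff₀ hY0]
    linarith
  have h2 : ‖ρ‖ ≤ 1 := by
    rw [hρn, div_le_one hY0]
    exact hr2
  have hdual : |inner ℝ W (dual ρ)| ≤ 2 * ‖W‖ := by simpa using (norm_bounds h1 h2 W 0).2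
  have hy0 : 0 < (k : ℝ) * q / Q := by positivity
  have := hC ρ h1 h2 W ((k : ℝ) * q / Q) hy0 (by nlinarith)
  rw [pow_zero, div_one] at this
  have heq : (ω (‖vec r‖ / Y) : ℂ) * p2 ω₀ ω Q r k q w - cst ω * star ω₀ ω W ρ =
      (ω ‖ρ‖ : ℂ) * cst ω * (rescaledKernel ω₀ ω ρ W ((k : ℝ) * q / Q) - slice ω₀ ρ W 0) := by
    rw [hω.p2_eq hQ hr1 hr2 hk hq w hρ hW rfl, ← hω.radial_mul_slice_zero, hρn, radial, hρn,
      rescaledKernel]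
    ring
  rw [heq, norm_mul, norm_mul, Complex.norm_real, Complex.norm_real,
    Real.norm_of_nonneg hcst.le, Real.norm_of_nonneg (hω.nonneg _), mul_assoc (B * cst ω)]
  gcongr
  exact hB _

end Weights

/-! ### Sums over reduced residues -/

/-- The integer pairing `a·n`. -/
def dot (a : Fin 2 → ℕ) (n : Fin 2 → ℤ) : ℤ := a 0 * n 0 + a 1 * n 1

/-- All representatives of vectors modulo `D`. -/
def box (D : ℕ) : Finset (Fin 2 → ℕ) := Fintype.piFinset fun _ => Finset.range D

theorem mem_box {D : ℕ} {a : Fin 2 → ℕ} : a ∈ box D ↔ a 0 < D ∧ a 1 < D := by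
  simp [box, Fin.forall_fin_two]

theorem mem_reduced {q : ℕ} {a : Fin 2 → ℕ} :
    a ∈ reduced q ↔ (a 0 < q ∧ a 1 < q) ∧ Nat.gcd (Nat.gcd (a 0) (a 1)) q = 1 := by
  rw [reduced, Finset.mem_filter, ← box, mem_box]

/-- Every vector modulo `D` is `(D/q)a` for a unique divisor `q` of `D` and a unique reduced
vector `a` modulo `q`. -/
theorem sum_divisors_reduced {D : ℕ} (hD : 0 < D) (r n : Fin 2 → ℤ) :
    ∑ q ∈ D.divisors, ∑ a ∈ (reduced q).filter (fun a => (q : ℤ) ∣ wedge r a),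
      e ((dot a n : ℝ) / q) =
    ∑ A ∈ (box D).filter (fun A => (D : ℤ) ∣ wedge r A), e ((dot A n : ℝ) / D) := by
  rw [Finset.sum_sigma']
  refine Finset.sum_bij' (fun x _ => fun i => D / x.1 * x.2 i)
    (fun A _ => ⟨D / Nat.gcd (Nat.gcd (A 0) (A 1)) D,
      fun i => A i / Nat.gcd (Nat.gcd (A 0) (A 1)) D⟩) ?_ ?_ ?_ ?_ ?_
  · rintro ⟨q, a⟩ hx
    simp only [Finset.mem_sigma, Nat.mem_divisors, Finset.mem_filter, mem_reduced] at hx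
    obtain ⟨⟨⟨g, rfl⟩, _⟩, ⟨⟨h0, h1⟩, _⟩, hw⟩ := hx
    have hq : 0 < q := by omega
    have hg : 0 < g := Nat.pos_of_ne_zero (by rintro rfl; simp at hD)
    simp only [Finset.mem_filter, mem_box, Nat.mul_div_cancel_left g hq]
    refine ⟨⟨by rw [mul_comm q]; gcongr, by rw [mul_comm q]; gcongr⟩, ?_⟩
    obtain ⟨c, hc⟩ := hw
    refine ⟨c, ?_⟩
    rw [wedge] at hc ⊢
    push_cast
    linear_combination (g : ℤ) * hc
  · intro A hA
    simp only [Finset.mem_filter, mem_box] at hA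
    obtain ⟨⟨h0, h1⟩, hw⟩ := hA
    set g := Nat.gcd (Nat.gcd (A 0) (A 1)) D with hg
    have hg0 : 0 < g := Nat.gcd_pos_of_pos_right _ hD
    have d0 : g ∣ A 0 := (Nat.gcd_dvd_left _ _).trans (Nat.gcd_dvd_left _ _)
    have d1 : g ∣ A 1 := (Nat.gcd_dvd_left _ _).trans (Nat.gcd_dvd_right _ _)
    have dD : g ∣ D := Nat.gcd_dvd_right _ _
    simp only [Finset.mem_sigma, Nat.mem_divisors, Finset.mem_filter, mem_reduced]
    refine ⟨⟨Nat.div_dvd_of_dvd dD, hD.ne'⟩, ⟨⟨Nat.div_lt_div_of_lt_of_dvd dD h0,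
      Nat.div_lt_div_of_lt_of_dvd dD h1⟩, ?_⟩, ?_⟩
    · rw [Nat.gcd_div d0 d1, Nat.gcd_div (Nat.dvd_gcd d0 d1) dD, ← hg, Nat.div_self hg0]
    · obtain ⟨a0, ha0⟩ := d0
      obtain ⟨a1, ha1⟩ := d1
      obtain ⟨q, hq⟩ := dD
      rw [wedge, ha0, ha1, hq] at hw
      rw [wedge, ha0, ha1, hq, Nat.mul_div_cancel_left _ hg0, Nat.mul_div_cancel_left _ hg0,
        Nat.mul_div_cancel_left _ hg0]
      have hgz : (g : ℤ) ≠ 0 := by exact_mod_cast hg0.ne'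
      refine (mul_dvd_mul_iff_left hgz).1 ?_
      push_cast at hw
      convert! hw using 1
      ring
  · rintro ⟨q, a⟩ hx
    simp only [Finset.mem_sigma, Nat.mem_divisors, Finset.mem_filter, mem_reduced] at hx
    obtain ⟨⟨⟨g, rfl⟩, _⟩, ⟨⟨h0, h1⟩, hgcd⟩, hw⟩ := hx
    have hq : 0 < q := by omega
    have hg : 0 < g := Nat.pos_of_ne_zero (by rintro rfl; simp at hD)
    have e1 : Nat.gcd (Nat.gcd (q * g / q * a 0) (q * g / q * a 1)) (q * g) = g := by
      rw [Nat.mul_div_cancel_left g hq, Nat.gcd_mul_left, mul_comm q, Nat.gcd_mul_left, hgcd,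
        mul_one]
    simp only [e1]
    rw [Nat.mul_div_cancel _ hg]
    congr 1
    ext i
    rw [Nat.mul_div_cancel_left g hq, Nat.mul_div_cancel_left _ hg]
  · intro A hA
    have hg0 : 0 < Nat.gcd (Nat.gcd (A 0) (A 1)) D := Nat.gcd_pos_of_pos_right _ hD
    ext i
    simp only
    rw [Nat.div_div_self (Nat.gcd_dvd_right _ _) hD.ne']
    refine Nat.mul_div_cancel' ((Nat.gcd_dvd_left _ _).trans ?_)
    fin_cases i
    · exact Nat.gcd_dvd_left _ _
    · exact Nat.gcd_dvd_right _ _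
  · rintro ⟨q, a⟩ hx
    simp only [Finset.mem_sigma, Nat.mem_divisors, Finset.mem_filter, mem_reduced] at hx
    obtain ⟨⟨⟨g, rfl⟩, _⟩, ⟨⟨h0, h1⟩, hgcd⟩, hw⟩ := hx
    have hq : 0 < q := by omega
    have hg : 0 < g := Nat.pos_of_ne_zero (by rintro rfl; simp at hD)
    have hq' : (q : ℝ) ≠ 0 := by positivity
    have hg' : (g : ℝ) ≠ 0 := by positivity
    congr 1
    simp only [dot, Nat.mul_div_cancel_left g hq]
    push_cast
    field_simp

theorem sum_box_e {D : ℕ} (hD : 0 < D) (m : Fin 2 → ℤ) :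
    ∑ A ∈ box D, e (((A 0 * m 0 + A 1 * m 1 : ℤ) : ℝ) / D) =
      if (D : ℤ) ∣ m 0 ∧ (D : ℤ) ∣ m 1 then (D : ℂ) ^ 2 else 0 := by
  have h1 : ∀ A : Fin 2 → ℕ, e (((A 0 * m 0 + A 1 * m 1 : ℤ) : ℝ) / D) =
      ∏ i, e ((A i : ℝ) * ((m i : ℝ) / D)) := by
    intro A
    rw [Fin.prod_univ_two, ← e_add]
    congr 1
    push_cast
    ring
  simp only [h1]
  rw [box, ← Finset.prod_univ_sum (fun _ => Finset.range D)
    (fun i x => e ((x : ℝ) * ((m i : ℝ) / D))), Fin.prod_univ_two, sum_range_e hD, sum_range_e hD]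
  by_cases h0 : (D : ℤ) ∣ m 0 <;> by_cases h1 : (D : ℤ) ∣ m 1 <;> simp [h0, h1, sq]

/-- Detection of the line of direction `c^⊥` modulo `m`, and of divisibility by `l`. -/
theorem sum_box_wedge {l m : ℕ} (hl : 0 < l) (hm : 0 < m) (c n : Fin 2 → ℤ) :
    ∑ A ∈ (box (l * m)).filter (fun A => (m : ℤ) ∣ wedge c A), e ((dot A n : ℝ) / (l * m : ℕ)) =
      (l : ℂ) ^ 2 * m * ((Finset.range m).filter (fun b : ℕ => ((l * m : ℕ) : ℤ) ∣ n 0 - l * b * c 1 ∧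
        ((l * m : ℕ) : ℤ) ∣ n 1 + l * b * c 0)).card := by
  have hm' : (m : ℂ) ≠ 0 := by exact_mod_cast hm.ne'
  have hmr : (m : ℝ) ≠ 0 := by positivity
  have hlr : (l : ℝ) ≠ 0 := by positivity
  have h1 : ∀ A : Fin 2 → ℕ, (if (m : ℤ) ∣ wedge c A then e ((dot A n : ℝ) / (l * m : ℕ)) else 0) =
      (m : ℂ)⁻¹ * ∑ b ∈ Finset.range m, e (((A 0 * (n 0 - l * b * c 1) +
        A 1 * (n 1 + l * b * c 0) : ℤ) : ℝ) / (l * m : ℕ)) := by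
    intro A
    have h2 : ∀ b : ℕ, e (((A 0 * (n 0 - l * b * c 1) +
        A 1 * (n 1 + l * b * c 0) : ℤ) : ℝ) / (l * m : ℕ)) =
        e ((dot A n : ℝ) / (l * m : ℕ)) * e (b * ((wedge c A : ℝ) / m)) := by
      intro b
      rw [← e_add]
      congr 1
      rw [dot, wedge]
      push_cast
      field_simp
      ring
    simp only [h2]
    rw [← Finset.mul_sum, sum_range_e hm]
    split_ifs
    · field_simp
    · simp
  rw [Finset.sum_filter]
  simp only [h1]
  rw [← Finset.mul_sum, Finset.sum_comm]
  have h3 : ∀ b ∈ Finset.range m, ∑ A ∈ box (l * m), e (((A 0 * (n 0 - l * b * c 1) +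
        A 1 * (n 1 + l * b * c 0) : ℤ) : ℝ) / (l * m : ℕ)) =
      if ((l * m : ℕ) : ℤ) ∣ n 0 - l * b * c 1 ∧ ((l * m : ℕ) : ℤ) ∣ n 1 + l * b * c 0 then
        ((l * m : ℕ) : ℂ) ^ 2 else 0 := fun b _ =>
    sum_box_e (Nat.mul_pos hl hm) ![n 0 - l * b * c 1, n 1 + l * b * c 0]
  rw [Finset.sum_congr rfl h3, ← Finset.sum_filter, Finset.sum_const, nsmul_eq_mul]
  push_cast
  field_simp

/-- The modular count in `sum_box_wedge` is the indicator of a divisibility. -/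
theorem card_line {l m : ℕ} (hl : 0 < l) (hm : 0 < m) {c : Fin 2 → ℤ} (hc : IsCoprime (c 0) (c 1))
    (n : Fin 2 → ℤ) :
    ((Finset.range m).filter (fun b : ℕ => ((l * m : ℕ) : ℤ) ∣ n 0 - l * b * c 1 ∧
        ((l * m : ℕ) : ℤ) ∣ n 1 + l * b * c 0)).card =
      if (l : ℤ) ∣ n 0 ∧ (l : ℤ) ∣ n 1 ∧ (m : ℤ) ∣ c 0 * (n 0 / l) + c 1 * (n 1 / l) then 1 else 0 := by
  have hlz : (l : ℤ) ≠ 0 := by exact_mod_cast hl.ne'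
  have hmz : (m : ℤ) ≠ 0 := by exact_mod_cast hm.ne'
  obtain ⟨u, v, huv⟩ := hc
  split_ifs with h
  · obtain ⟨⟨n0, h0⟩, ⟨n1, h1⟩, h2⟩ := h
    rw [h0, h1, Int.mul_ediv_cancel_left _ hlz, Int.mul_ediv_cancel_left _ hlz] at h2
    obtain ⟨t, ht⟩ := h2
    rw [Finset.card_eq_one]
    set b0 : ℤ := (v * n0 - u * n1) % m with hb0
    have hb0n : 0 ≤ b0 := Int.emod_nonneg _ hmz
    have hb0lt : b0 < m := Int.emod_lt_of_pos _ (by exact_mod_cast hm)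
    have hb0' : (m : ℤ) ∣ (v * n0 - u * n1) - b0 := Int.dvd_self_sub_emod
    obtain ⟨s, hs⟩ := hb0'
    refine ⟨b0.toNat, ?_⟩
    ext b
    simp only [Finset.mem_filter, Finset.mem_range, Finset.mem_singleton]
    constructor
    · rintro ⟨hb, ⟨x, hx⟩, ⟨y, hy⟩⟩
      rw [h0] at hx
      rw [h1] at hy
      push_cast at hx hy
      have e1 : n0 - b * c 1 = m * x := by
        apply mul_left_cancel₀ hlz
        linear_combination hx
      have e2 : n1 + b * c 0 = m * y := by
        apply mul_left_cancel₀ hlz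
        linear_combination hy
      have e3 : (m : ℤ) ∣ b - b0 := ⟨s - v * x + u * y, by
        linear_combination hs - v * e1 + u * e2 - (b : ℤ) * huv⟩
      have e4 : (b : ℤ) % m = b0 % m := 
        Int.emod_eq_emod_iff_emod_sub_eq_zero.2 (Int.emod_eq_zero_of_dvd e3)
      rw [Int.emod_eq_of_lt (by positivity) (by exact_mod_cast hb),
        Int.emod_eq_of_lt hb0n hb0lt] at e4
      omega
    · rintro rfl
      have hbz : ((b0.toNat : ℕ) : ℤ) = b0 := Int.toNat_of_nonneg hb0n
      refine ⟨by omega, ⟨u * t + s * c 1, ?_⟩, ⟨v * t - s * c 0, ?_⟩⟩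
      · rw [hbz, h0]
        push_cast
        linear_combination (l : ℤ) * u * ht - (l : ℤ) * n0 * huv + (l : ℤ) * c 1 * hs
      · rw [hbz, h1]
        push_cast
        linear_combination (l : ℤ) * v * ht - (l : ℤ) * n1 * huv - (l : ℤ) * c 0 * hs
  · rw [Finset.card_eq_zero, Finset.filter_eq_empty_iff]
    rintro b - ⟨⟨x, hx⟩, ⟨y, hy⟩⟩
    push_cast at hx hy
    have h0 : n 0 = l * (m * x + b * c 1) := by linear_combination hx
    have h1 : n 1 = l * (m * y - b * c 0) := by linear_combination hy
    refine h ⟨⟨_, h0⟩, ⟨_, h1⟩, ?_⟩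
    rw [h0, h1, Int.mul_ediv_cancel_left _ hlz, Int.mul_ediv_cancel_left _ hlz]
    exact ⟨c 0 * x + c 1 * y, by ring⟩

/-- A sum over the multiples of `L` up to `Q`. -/
theorem sum_range_floor_div {E : Type*} [AddCommMonoid E] {Q : ℝ} {L : ℕ} (hL : 0 < L)
    (f : ℕ → E) :
    ∑ j ∈ Finset.range ⌊Q / L⌋₊, f (L * (j + 1)) =
      ∑ D ∈ (Finset.Icc 1 ⌊Q⌋₊).filter (fun D => L ∣ D), f D := by
  rw [Nat.floor_div_natCast]
  refine Finset.sum_bij (fun j _ => L * (j + 1)) ?_ ?_ ?_ ?_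
  · intro j hj
    rw [Finset.mem_range, Nat.lt_iff_add_one_le, Nat.le_div_iff_mul_le hL, mul_comm] at hj
    simp only [Finset.mem_filter, Finset.mem_Icc]
    exact ⟨⟨Nat.mul_pos hL (Nat.succ_pos _), hj⟩, Dvd.intro _ rfl⟩
  · intro i _ j _ hij
    have := Nat.eq_of_mul_eq_mul_left hL hij
    omega
  · intro D hD
    simp only [Finset.mem_filter, Finset.mem_Icc] at hD
    obtain ⟨⟨h1, h2⟩, ⟨j, rfl⟩⟩ := hD
    have hj : 0 < j := Nat.pos_of_ne_zero (by rintro rfl; omega)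
    refine ⟨j - 1, ?_, by rw [Nat.sub_add_cancel hj]⟩
    rw [Finset.mem_range, Nat.lt_iff_add_one_le, Nat.le_div_iff_mul_le hL, mul_comm,
      Nat.sub_add_cancel hj]
    exact h2
  · intro j _
    rfl

open Classical in
/-- The value at `n` of the weight attached to `r`, after all sums over residue classes have been
carried out: it vanishes unless `n` is a multiple of `r^⊥`. -/
theorem Weights.sum_reduced_h {ω₀ ω : ℝ → ℝ} (hω : Weights ω₀ ω) {Q : ℝ} (hQ : 0 < Q) {l : ℕ}
    (hl : 0 < l) {c r n : Fin 2 → ℤ} (hc : IsCoprime (c 0) (c 1)) (hr : ∀ i, r i = l * c i)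
    {z : ℝ} (hz : z = ((r 0 * n 0 + r 1 * n 1 : ℤ) : ℝ) / Q ^ 2) (hz' : |z| ≤ 1 / 2) :
    ∑ q ∈ Finset.Icc 1 ⌊Q⌋₊, ∑ a ∈ (reduced q).filter (fun a => (q : ℤ) ∣ wedge r a),
        e ((dot a n : ℝ) / q) * (h ω ((Nat.lcm q l : ℕ) / Q) z : ℂ) =
      if ∃ b : ℤ, n 0 = b * r 1 ∧ n 1 = -(b * r 0) then
        ((Q * l * ∑ j ∈ Finset.range ⌊Q / l⌋₊, ω (l * (j + 1 : ℕ) / Q) : ℝ) : ℂ) else 0 := by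
  have hlr : (0 : ℝ) < l := by exact_mod_cast hl
  have hlz : (l : ℤ) ≠ 0 := by exact_mod_cast hl.ne'
  set g : ℕ → ℝ := fun D => Q / D * (ω (D / Q) - ω (|z| * Q / D)) with hg
  have hh : ∀ q, 0 < q → h ω ((Nat.lcm q l : ℕ) / Q) z =
      ∑ D ∈ (Finset.Icc 1 ⌊Q⌋₊).filter (fun D => l ∣ D ∧ q ∣ D), g D := by
    intro q hq
    have hL : 0 < Nat.lcm q l := Nat.lcm_pos hq hl
    have hLr : (0 : ℝ) < (Nat.lcm q l : ℕ) := by exact_mod_cast hL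
    rw [hω.h_eq_sum (by positivity) hz', one_div_div]
    have : ∀ D : ℕ, (l ∣ D ∧ q ∣ D) ↔ Nat.lcm q l ∣ D := by
      intro D
      rw [Nat.lcm_dvd_iff, and_comm]
    simp only [this]
    rw [← sum_range_floor_div hL]
    refine Finset.sum_congr rfl fun j _ => ?_
    have hj : (0 : ℝ) < (j + 1 : ℕ) := by positivity
    simp only [hg]
    push_cast
    push_cast at hj
    rw [show (Nat.lcm q l : ℝ) / Q * (j + 1) = Nat.lcm q l * (j + 1) / Q by ring]
    congr 1
    · field_simp
    · congr 2
      field_simp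
  -- The modulus `D = lcm(q, l) j` becomes the outer variable, and `q` runs through its divisors.
  have hswap : ∑ q ∈ Finset.Icc 1 ⌊Q⌋₊, ∑ a ∈ (reduced q).filter (fun a => (q : ℤ) ∣ wedge r a),
        e ((dot a n : ℝ) / q) * (h ω ((Nat.lcm q l : ℕ) / Q) z : ℂ) =
      ∑ D ∈ (Finset.Icc 1 ⌊Q⌋₊).filter (fun D => l ∣ D), (g D : ℂ) *
        ∑ q ∈ D.divisors, ∑ a ∈ (reduced q).filter (fun a => (q : ℤ) ∣ wedge r a),
          e ((dot a n : ℝ) / q) := by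
    have h1 : ∀ q ∈ Finset.Icc 1 ⌊Q⌋₊,
        ∑ a ∈ (reduced q).filter (fun a => (q : ℤ) ∣ wedge r a),
          e ((dot a n : ℝ) / q) * (h ω ((Nat.lcm q l : ℕ) / Q) z : ℂ) =
        ∑ D ∈ (Finset.Icc 1 ⌊Q⌋₊).filter (fun D => l ∣ D ∧ q ∣ D), (g D : ℂ) *
          ∑ a ∈ (reduced q).filter (fun a => (q : ℤ) ∣ wedge r a), e ((dot a n : ℝ) / q) := by
      intro q hq
      rw [← Finset.sum_mul, hh q (Finset.mem_Icc.1 hq).1, mul_comm, ← Finset.sum_mul]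
      push_cast
      rfl
    rw [Finset.sum_congr rfl h1]
    simp only [Finset.mul_sum (f := fun q => ∑ a ∈ (reduced q).filter
      (fun a => (q : ℤ) ∣ wedge r a), e ((dot a n : ℝ) / q))]
    refine Finset.sum_comm' fun q D => ?_
    simp only [Finset.mem_Icc, Finset.mem_filter, Nat.mem_divisors]
    constructor
    · rintro ⟨h1, h2, h3, h4⟩
      exact ⟨⟨h4, by omega⟩, h2, h3⟩
    · rintro ⟨⟨h1, h2⟩, h3, h4⟩
      have := Nat.le_of_dvd (by omega) h1
      have := Nat.pos_of_dvd_of_pos h1 (by omega)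
      exact ⟨⟨by omega, by omega⟩, h3, h4, h1⟩
  -- All vectors modulo `D = l m` on a line: orthogonality leaves divisibility conditions on `n`.
  have hbox : ∀ m : ℕ, 0 < m → ∑ q ∈ (l * m).divisors,
      ∑ a ∈ (reduced q).filter (fun a => (q : ℤ) ∣ wedge r a), e ((dot a n : ℝ) / q) =
      (l : ℂ) ^ 2 * m * if (l : ℤ) ∣ n 0 ∧ (l : ℤ) ∣ n 1 ∧
        (m : ℤ) ∣ c 0 * (n 0 / l) + c 1 * (n 1 / l) then 1 else 0 := by
    intro m hm
    rw [sum_divisors_reduced (Nat.mul_pos hl hm)]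
    have hdvd : ∀ A : Fin 2 → ℕ, ((l * m : ℕ) : ℤ) ∣ wedge r A ↔ (m : ℤ) ∣ wedge c A := by
      intro A
      rw [show wedge r A = l * wedge c A by rw [wedge, wedge, hr, hr]; ring, Nat.cast_mul]
      exact mul_dvd_mul_iff_left hlz
    simp only [hdvd]
    rw [sum_box_wedge hl hm, card_line hl hm hc]
    push_cast
    rfl
  rw [hswap, ← sum_range_floor_div hl]
  have hterm : ∀ j ∈ Finset.range ⌊Q / l⌋₊, (g (l * (j + 1)) : ℂ) *
      ∑ q ∈ (l * (j + 1)).divisors, ∑ a ∈ (reduced q).filter (fun a => (q : ℤ) ∣ wedge r a),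
          e ((dot a n : ℝ) / q) =
      if (l : ℤ) ∣ n 0 ∧ (l : ℤ) ∣ n 1 ∧
        ((j + 1 : ℕ) : ℤ) ∣ c 0 * (n 0 / l) + c 1 * (n 1 / l) then
        ((Q * l * (ω (l * (j + 1 : ℕ) / Q) - ω (|z| * Q / (l * (j + 1 : ℕ)))) : ℝ) : ℂ) else 0 := by
    intro j _
    rw [hbox _ (Nat.succ_pos j)]
    have hj : (0 : ℝ) < (j + 1 : ℕ) := by positivity
    split_ifs
    · rw [mul_one, show (l : ℂ) ^ 2 * ((j + 1 : ℕ) : ℂ) = ((l ^ 2 * (j + 1 : ℕ) : ℝ) : ℂ) by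
        push_cast; rfl, ← Complex.ofReal_mul]
      congr 1
      simp only [hg]
      push_cast
      push_cast at hj
      field_simp
    · simp
  rw [Finset.sum_congr rfl hterm]
  by_cases hdiv : (l : ℤ) ∣ n 0 ∧ (l : ℤ) ∣ n 1
  swap
  · have h1 : ¬ ∃ b : ℤ, n 0 = b * r 1 ∧ n 1 = -(b * r 0) := by
      rintro ⟨b, h0, h1⟩
      exact hdiv ⟨⟨b * c 1, by rw [h0, hr]; ring⟩, ⟨-(b * c 0), by rw [h1, hr]; ring⟩⟩
    rw [if_neg h1]
    refine Finset.sum_eq_zero fun j _ => if_neg fun h => hdiv ⟨h.1, h.2.1⟩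
  obtain ⟨⟨n0, h0⟩, ⟨n1, h1⟩⟩ := hdiv
  have hN : c 0 * (n 0 / l) + c 1 * (n 1 / l) = c 0 * n0 + c 1 * n1 := by
    rw [h0, h1, Int.mul_ediv_cancel_left _ hlz, Int.mul_ediv_cancel_left _ hlz]
  have hzN : z = l ^ 2 * ((c 0 * n0 + c 1 * n1 : ℤ) : ℝ) / Q ^ 2 := by
    rw [hz, hr, hr, h0, h1]
    push_cast
    ring
  simp only [hN]
  have hcond : ∀ j : ℕ, ((l : ℤ) ∣ n 0 ∧ (l : ℤ) ∣ n 1 ∧ ((j + 1 : ℕ) : ℤ) ∣ c 0 * n0 + c 1 * n1) ↔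
      ((j + 1 : ℕ) : ℤ) ∣ c 0 * n0 + c 1 * n1 := fun j =>
    ⟨fun h => h.2.2, fun h => ⟨⟨_, h0⟩, ⟨_, h1⟩, h⟩⟩
  simp only [hcond]
  set K : ℤ := c 0 * n0 + c 1 * n1 with hK
  by_cases hK0 : K = 0
  · have hb : ∃ b : ℤ, n 0 = b * r 1 ∧ n 1 = -(b * r 0) := by
      obtain ⟨u, v, huv⟩ := hc
      refine ⟨v * n0 - u * n1, ?_, ?_⟩
      · rw [h0, hr]
        linear_combination l * u * (hK.symm.trans hK0) - (l : ℤ) * n0 * huv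
      · rw [h1, hr]
        linear_combination l * v * (hK.symm.trans hK0) - (l : ℤ) * n1 * huv
    rw [if_pos hb, hK0, Finset.mul_sum]
    push_cast
    refine Finset.sum_congr rfl fun j _ => ?_
    rw [if_pos (dvd_zero _), hzN, hK0]
    have : ω 0 = 0 := hω.om_eq_zero (Or.inl (by norm_num))
    simp [this]
  · have hb : ¬ ∃ b : ℤ, n 0 = b * r 1 ∧ n 1 = -(b * r 0) := by
      rintro ⟨b, h2, h3⟩
      apply hK0
      have : (l : ℤ) * K = 0 := by
        rw [hK]
        rw [h0, hr] at h2
        rw [h1, hr] at h3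
        linear_combination c 0 * h2 + c 1 * h3
      exact (mul_eq_zero.1 this).resolve_left hlz
    rw [if_neg hb]
    -- The divisors `m` and `|K| / m` of `K` contribute opposite amounts.
    set f : ℕ → ℂ := fun m =>
      (Q * l * (ω (l * m / Q) - ω (|z| * Q / (l * m))) : ℝ) with hf
    have habs : |z| = l ^ 2 * (K.natAbs : ℝ) / Q ^ 2 := by
      rw [hzN, abs_div, abs_mul, abs_of_pos (by positivity : (0:ℝ) < Q ^ 2),
        abs_of_pos (by positivity : (0:ℝ) < (l:ℝ) ^ 2), Nat.cast_natAbs, Int.cast_abs]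
    have hK1 : K.natAbs ≠ 0 := Int.natAbs_ne_zero.2 hK0
    -- Divisors beyond `Q / l` contribute zero, so the truncated sum runs over all divisors.
    have hsub : ∑ j ∈ Finset.range ⌊Q / l⌋₊, (if ((j + 1 : ℕ) : ℤ) ∣ K then f (j + 1) else 0) =
        ∑ m ∈ K.natAbs.divisors, f m := by
      have h2 := sum_range_floor_div (Q := Q / l) (L := 1) one_pos
        (fun m : ℕ => if (m : ℤ) ∣ K then f m else 0)
      simp only [one_mul, Nat.cast_one, div_one, isUnit_one, IsUnit.dvd, Finset.filter_true] at h2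
      rw [h2, ← Finset.sum_filter]
      refine Finset.sum_subset ?_ ?_
      · intro m hm
        simp only [Finset.mem_filter, Finset.mem_Icc] at hm
        exact Nat.mem_divisors.2 ⟨Int.natCast_dvd.1 hm.2, hK1⟩
      · intro m hm hm'
        have hmd := Nat.mem_divisors.1 hm
        have hmpos : 0 < m := Nat.pos_of_dvd_of_pos hmd.1 (Nat.pos_of_ne_zero hK1)
        have hmr : (0 : ℝ) < m := by exact_mod_cast hmpos
        have hbig : Q / l < m := by
          by_contra hle
          push Not at hle
          refine hm' ?_
          simp only [Finset.mem_filter, Finset.mem_Icc]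
          exact ⟨⟨hmpos, Nat.le_floor hle⟩, Int.natCast_dvd.2 hmd.1⟩
        rw [div_lt_iff₀ hlr] at hbig
        have e1 : ω (l * m / Q) = 0 := hω.om_eq_zero (Or.inr (by
          rw [le_div_iff₀ hQ]; linarith))
        have e2 : ω (|z| * Q / (l * m)) = 0 := hω.om_eq_zero (Or.inl (by
          rw [div_le_iff₀ (by positivity)]
          nlinarith [abs_nonneg z]))
        simp only [hf, e1, e2]
        simp
    have hgoal : ∑ m ∈ K.natAbs.divisors, f m = 0 := by
      have h3 : ∀ m ∈ K.natAbs.divisors, f m =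
          (Q * l * ω (l * m / Q) : ℝ) - (Q * l * ω (l * (K.natAbs / m : ℕ) / Q) : ℝ) := by
        intro m hm
        have hmd := Nat.mem_divisors.1 hm
        have hmpos : 0 < m := Nat.pos_of_dvd_of_pos hmd.1 (Nat.pos_of_ne_zero hK1)
        have hmr : (0 : ℝ) < m := by exact_mod_cast hmpos
        have : |z| * Q / (l * m) = l * (K.natAbs / m : ℕ) / Q := by
          rw [habs, Nat.cast_div hmd.1 hmr.ne']
          field_simp
        simp only [hf, this]
        push_cast
        ring
      rw [Finset.sum_congr rfl h3, Finset.sum_sub_distrib,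
        Nat.sum_div_divisors K.natAbs (fun m => ((Q * l * ω (l * m / Q) : ℝ) : ℂ)), sub_self]
    exact hsub.trans hgoal

/-- The reduced fractions `a/q` with `q ∣ D` detect the divisibility of `n` by `D`. -/
theorem sum_reduced_e {Q : ℝ}
    (n : Fin 2 → ℤ) (F : ℕ → ℝ) :
    ∑ q ∈ Finset.Icc 1 ⌊Q⌋₊, ∑ a ∈ reduced q, e ((dot a n : ℝ) / q) *
        ((∑ j ∈ Finset.range ⌊Q / q⌋₊, 1 / ((q * (j + 1) : ℕ) : ℝ) ^ 2 * F (q * (j + 1)) : ℝ) : ℂ) =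
      ((∑ D ∈ (Finset.Icc 1 ⌊Q⌋₊).filter (fun D : ℕ => (D : ℤ) ∣ n 0 ∧ (D : ℤ) ∣ n 1), F D : ℝ) : ℂ) := by
  classical
  have h1 : ∀ q ∈ Finset.Icc 1 ⌊Q⌋₊, ∑ a ∈ reduced q, e ((dot a n : ℝ) / q) *
        ((∑ j ∈ Finset.range ⌊Q / q⌋₊, 1 / ((q * (j + 1) : ℕ) : ℝ) ^ 2 * F (q * (j + 1)) : ℝ) : ℂ) =
      ∑ D ∈ (Finset.Icc 1 ⌊Q⌋₊).filter (fun D => q ∣ D), ((1 / (D : ℝ) ^ 2 * F D : ℝ) : ℂ) *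
        ∑ a ∈ reduced q, e ((dot a n : ℝ) / q) := by
    intro q hq
    rw [← Finset.sum_mul, sum_range_floor_div (Finset.mem_Icc.1 hq).1
      (fun D : ℕ => 1 / (D : ℝ) ^ 2 * F D), mul_comm, ← Finset.sum_mul]
    push_cast
    rfl
  rw [Finset.sum_congr rfl h1]
  have h2 : ∑ q ∈ Finset.Icc 1 ⌊Q⌋₊, ∑ D ∈ (Finset.Icc 1 ⌊Q⌋₊).filter (fun D => q ∣ D),
        ((1 / (D : ℝ) ^ 2 * F D : ℝ) : ℂ) * ∑ a ∈ reduced q, e ((dot a n : ℝ) / q) =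
      ∑ D ∈ Finset.Icc 1 ⌊Q⌋₊, ∑ q ∈ D.divisors,
        ((1 / (D : ℝ) ^ 2 * F D : ℝ) : ℂ) * ∑ a ∈ reduced q, e ((dot a n : ℝ) / q) := by
    refine Finset.sum_comm' fun q D => ?_
    simp only [Finset.mem_Icc, Finset.mem_filter, Nat.mem_divisors]
    constructor
    · rintro ⟨h1, h2, h3⟩
      exact ⟨⟨h3, by omega⟩, h2⟩
    · rintro ⟨⟨h1, h2⟩, h3⟩
      have := Nat.le_of_dvd (by omega) h1
      have := Nat.pos_of_dvd_of_pos h1 (by omega)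
      exact ⟨⟨by omega, by omega⟩, h3, h1⟩
  rw [h2, Finset.sum_filter]
  push_cast
  refine Finset.sum_congr rfl fun D hD => ?_
  have hD0 : 0 < D := (Finset.mem_Icc.1 hD).1
  have hDc : (D : ℂ) ≠ 0 := by exact_mod_cast hD0.ne'
  have h3 := sum_divisors_reduced hD0 0 n
  have h4 : ∀ (q : ℕ) (a : Fin 2 → ℕ), (q : ℤ) ∣ wedge 0 a := fun q a => by simp [wedge]
  simp only [h4, Finset.filter_true] at h3
  rw [← Finset.mul_sum, h3]
  have h5 := sum_box_e hD0 n
  rw [show (∑ A ∈ box D, e ((dot A n : ℝ) / D)) =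
    ∑ A ∈ box D, e (((A 0 * n 0 + A 1 * n 1 : ℤ) : ℝ) / D) from rfl, h5]
  split_ifs
  · field_simp
  · simp

open Classical in
/-- The vectors `r` with `n ∈ ℤ r^⊥` are `±D⁻¹ n` turned by a right angle, with `D` a common
divisor of the coordinates of `n`. -/
theorem sum_multiple_perp {n : Fin 2 → ℤ} (hn : n ≠ 0) (F : ℝ → ℝ) {B : ℕ}
    (hF : ∀ D : ℕ, B < D → F (‖vec n‖ / D) = 0) {R : Finset (Fin 2 → ℤ)}
    (hR : ∀ r, F ‖vec r‖ ≠ 0 → r ∈ R) :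
    ∑ r ∈ R.filter (fun r => ∃ b : ℤ, n 0 = b * r 1 ∧ n 1 = -(b * r 0)), F ‖vec r‖ =
      2 * ∑ D ∈ (Finset.Icc 1 B).filter (fun D : ℕ => (D : ℤ) ∣ n 0 ∧ (D : ℤ) ∣ n 1),
        F (‖vec n‖ / D) := by
  have hnorm : ∀ (r : Fin 2 → ℤ) (b : ℤ), b ≠ 0 → n 0 = b * r 1 → n 1 = -(b * r 0) →
      ‖vec r‖ = ‖vec n‖ / b.natAbs := by
    intro r b hb h0 h1
    have hb' : (0 : ℝ) < b.natAbs := by exact_mod_cast Int.natAbs_pos.2 hb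
    rw [eq_div_iff hb'.ne', ← sq_eq_sq₀ (by positivity) (norm_nonneg _), mul_pow, norm_sq_plane,
      norm_sq_plane]
    simp only [vec_apply, h0, h1]
    rw [Nat.cast_natAbs, Int.cast_abs, sq_abs]
    push_cast
    ring
  have hb0 : ∀ (r : Fin 2 → ℤ) (b : ℤ), n 0 = b * r 1 → n 1 = -(b * r 0) → b ≠ 0 := by
    rintro r b h0 h1 rfl
    apply hn
    ext i
    fin_cases i <;> simp_all
  have hrhs : 2 * ∑ D ∈ (Finset.Icc 1 B).filter (fun D : ℕ => (D : ℤ) ∣ n 0 ∧ (D : ℤ) ∣ n 1),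
        F (‖vec n‖ / D) =
      ∑ x ∈ ((Finset.Icc 1 B).filter (fun D : ℕ => (D : ℤ) ∣ n 0 ∧ (D : ℤ) ∣ n 1)) ×ˢ
        ({1, -1} : Finset ℤ), F (‖vec n‖ / x.1) := by
    rw [Finset.sum_product, Finset.mul_sum]
    refine Finset.sum_congr rfl fun D _ => ?_
    rw [Finset.sum_pair (by norm_num), two_mul]
  rw [hrhs]
  symm
  have hspec : ∀ x ∈ ((Finset.Icc 1 B).filter (fun D : ℕ => (D : ℤ) ∣ n 0 ∧ (D : ℤ) ∣ n 1)) ×ˢ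
        ({1, -1} : Finset ℤ), n 0 = x.2 * x.1 * (x.2 * (n 0 / x.1)) ∧
          n 1 = -(x.2 * x.1 * (-(x.2 * (n 1 / x.1)))) ∧ (x.2 * (x.1 : ℤ)).natAbs = x.1 ∧
          x.2 * x.2 = 1 ∧ 0 < x.1 := by
    rintro ⟨D, ε⟩ hx
    simp only [Finset.mem_product, Finset.mem_filter, Finset.mem_Icc, Finset.mem_insert,
      Finset.mem_singleton] at hx
    obtain ⟨⟨⟨hD, _⟩, h0, h1⟩, hε⟩ := hx
    have hε2 : ε * ε = 1 := by rcases hε with rfl | rfl <;> norm_num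
    have e0 := Int.mul_ediv_cancel' h0
    have e1 := Int.mul_ediv_cancel' h1
    refine ⟨?_, ?_, ?_, hε2, hD⟩
    · simp only
      linear_combination -e0 - (D : ℤ) * (n 0 / D) * hε2
    · simp only
      linear_combination -e1 - (D : ℤ) * (n 1 / D) * hε2
    · rcases hε with rfl | rfl <;> simp
  refine Finset.sum_bij_ne_zero (fun x _ _ => ![-(x.2 * (n 1 / x.1)), x.2 * (n 0 / x.1)])
    ?_ ?_ ?_ ?_
  · intro x hx hne
    obtain ⟨h0, h1, h2, h3, h4⟩ := hspec x hx
    rw [Finset.mem_filter]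
    refine ⟨hR _ ?_, x.2 * x.1, h0, h1⟩
    rwa [hnorm _ (x.2 * x.1) (hb0 ![-(x.2 * (n 1 / x.1)), x.2 * (n 0 / x.1)] _ h0 h1) h0 h1, h2]
  · intro x hx _ y hy _ hxy
    obtain ⟨h0, h1, h2, h3, h4⟩ := hspec x hx
    obtain ⟨k0, k1, k2, k3, k4⟩ := hspec y hy
    have g0 := congrFun hxy 0
    have g1 := congrFun hxy 1
    simp only [Matrix.cons_val_zero, Matrix.cons_val_one] at g0 g1
    have hbb : x.2 * (x.1 : ℤ) = y.2 * y.1 := by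
      by_contra hne
      have hne' : x.2 * (x.1 : ℤ) - y.2 * y.1 ≠ 0 := sub_ne_zero.2 hne
      have a0 : (x.2 * (x.1 : ℤ) - y.2 * y.1) * (x.2 * (n 0 / x.1)) = 0 := by
        linear_combination k0 - h0 - y.2 * y.1 * g1
      have a1 : (x.2 * (x.1 : ℤ) - y.2 * y.1) * (-(x.2 * (n 1 / x.1))) = 0 := by
        linear_combination h1 - k1 - y.2 * y.1 * g0
      have b0 := (mul_eq_zero.1 a0).resolve_left hne'
      have b1 := (mul_eq_zero.1 a1).resolve_left hne'
      apply hn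
      ext i
      fin_cases i
      · exact h0.trans (by rw [b0, mul_zero]; rfl)
      · exact h1.trans (by rw [b1, mul_zero, neg_zero]; rfl)
    have hD : x.1 = y.1 := by rw [← h2, ← k2, hbb]
    refine Prod.ext hD ?_
    rw [hD] at hbb
    exact mul_right_cancel₀ (by exact_mod_cast k4.ne') hbb
  · intro r hr hne
    obtain ⟨hrR, b, h0, h1⟩ := Finset.mem_filter.1 hr
    have hb := hb0 r b h0 h1
    rw [hnorm r b hb h0 h1] at hne
    have habs : b.sign * b.natAbs = b := Int.sign_mul_natAbs b
    have hsq : b.sign * b.sign = 1 := by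
      rcases Int.sign_trichotomy b with h | h | h
      · rw [h]; norm_num
      · exact absurd (Int.sign_eq_zero_iff_zero.1 h) hb
      · rw [h]; norm_num
    have hz : (b.natAbs : ℤ) ≠ 0 := by exact_mod_cast Int.natAbs_ne_zero.2 hb
    have d0 : n 0 = b.natAbs * (b.sign * r 1) := by
      rw [h0]; nth_rewrite 1 [← habs]; ring
    have d1 : n 1 = b.natAbs * (-(b.sign * r 0)) := by
      rw [h1]; nth_rewrite 1 [← habs]; ring
    refine ⟨(b.natAbs, b.sign), ?_, hne, ?_⟩
    · simp only [Finset.mem_product, Finset.mem_filter, Finset.mem_Icc, Finset.mem_insert,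
        Finset.mem_singleton]
      refine ⟨⟨⟨Int.natAbs_pos.2 hb, ?_⟩, ⟨_, d0⟩, ⟨_, d1⟩⟩, ?_⟩
      · by_contra hlt
        exact hne (hF _ (not_le.1 hlt))
      · rcases Int.sign_trichotomy b with h | h | h
        · exact Or.inl h
        · exact absurd (Int.sign_eq_zero_iff_zero.1 h) hb
        · exact Or.inr h
    · ext i
      fin_cases i
      · change -(b.sign * (n 1 / (b.natAbs : ℤ))) = r 0
        rw [d1, Int.mul_ediv_cancel_left _ hz]
        linear_combination r 0 * hsq
      · change b.sign * (n 0 / (b.natAbs : ℤ)) = r 1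
        rw [d0, Int.mul_ediv_cancel_left _ hz]
        linear_combination r 1 * hsq
  · intro x hx _
    obtain ⟨h0, h1, h2, h3, h4⟩ := hspec x hx
    rw [hnorm ![-(x.2 * (n 1 / x.1)), x.2 * (n 0 / x.1)] (x.2 * x.1)
      (hb0 ![-(x.2 * (n 1 / x.1)), x.2 * (n 0 / x.1)] _ h0 h1) h0 h1, h2]

/-! ### Fourier inversion for the two kernels -/

theorem phase_eq (n : Fin 2 → ℤ) (q : ℕ) (a : Fin 2 → ℕ) (w : Plane) :
    phase n q a w = e ((dot a n : ℝ) / q) * e (inner ℝ w (vec n)) := by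
  rw [phase, ← e_add, inner_plane, Fin.sum_univ_two, dot]
  congr 1
  simp only [vec_apply]
  push_cast
  ring

@[simp] theorem norm_phase (n : Fin 2 → ℤ) (q : ℕ) (a : Fin 2 → ℕ) (w : Plane) :
    ‖phase n q a w‖ = 1 := by
  rw [phase, norm_e]

theorem continuous_phase (n : Fin 2 → ℤ) (q : ℕ) (a : Fin 2 → ℕ) :
    Continuous (phase n q a) := by
  simp only [funext (phase_eq n q a)]
  fun_prop

/-- The function whose Fourier transform is the kernel `p_{1,q}`. -/
noncomputable def physical₁ (ω₀ ω : ℝ → ℝ) (Q : ℝ) (q : ℕ) (x : Plane) : ℂ :=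
  -((2 * cst ω / Q : ℝ) : ℂ) * ((ω₀ (‖x‖ / Q ^ (3 / 2 : ℝ)) *
    ∑ j ∈ Finset.range ⌊Q / q⌋₊, 1 / ((q * (j + 1) : ℕ) : ℝ) ^ 2 *
      ω (‖x‖ / ((q * (j + 1) : ℕ) * Q ^ (1 / 2 : ℝ))) : ℝ) : ℂ)

/-- The function whose Fourier transform is the kernel `p_{2,r,k,q}`. -/
noncomputable def physical₂ (ω₀ ω : ℝ → ℝ) (Q : ℝ) (r : Fin 2 → ℤ) (k q : ℕ) (x : Plane) : ℂ :=
  ((cst ω / Q ^ 3 : ℝ) : ℂ) * ((ω₀ (‖x‖ / Q ^ (3 / 2 : ℝ)) *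
    h ω ((k : ℝ) * q / Q) (inner ℝ (vec r) x / Q ^ 2) : ℝ) : ℂ)

/-- On the support of the cut-off, the argument of `h` stays in the range where `h` is given by
a sum of fixed length. -/
theorem Weights.abs_inner_div_le {ω₀ ω : ℝ → ℝ} (hω : Weights ω₀ ω) {Q : ℝ} (hQ : 0 < Q)
    {r : Fin 2 → ℤ} (hr : ‖vec r‖ ≤ Q ^ (1 / 2 : ℝ)) {x : Plane}
    (hx : ω₀ (‖x‖ / Q ^ (3 / 2 : ℝ)) ≠ 0) : |inner ℝ (vec r) x / Q ^ 2| ≤ 1 / 2 := by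
  have hY0 : 0 < Q ^ (1 / 2 : ℝ) := by positivity
  have h1 := hω.lt_half_of_om₀_ne_zero hx
  rw [abs_of_nonneg (by positivity), div_lt_iff₀ (by positivity), rpow_three_halves hQ] at h1
  rw [abs_div, abs_of_pos (by positivity : 0 < Q ^ 2), div_le_iff₀ (by positivity)]
  have h2 := abs_real_inner_le_norm (vec r) x
  have h3 : ‖vec r‖ * ‖x‖ ≤ Q ^ (1 / 2 : ℝ) * (1 / 2 * (Q * Q ^ (1 / 2 : ℝ))) :=
    mul_le_mul hr h1.le (norm_nonneg _) hY0.le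
  have h4 := rpow_half_sq hQ
  nlinarith

namespace Weights

variable {ω₀ ω : ℝ → ℝ} (hω : Weights ω₀ ω)
include hω

theorem physical₁_eq_zero {Q : ℝ} (hQ : 0 < Q) (q : ℕ) {x : Plane}
    (hx : Q ^ (3 / 2 : ℝ) ≤ ‖x‖) : physical₁ ω₀ ω Q q x = 0 := by
  have hX0 : 0 < Q ^ (3 / 2 : ℝ) := by positivity
  rw [physical₁, hω.om₀_eq_zero, zero_mul, Complex.ofReal_zero, mul_zero]
  rw [abs_of_nonneg (by positivity), le_div_iff₀ hX0]
  linarith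

theorem physical₂_eq_zero {Q : ℝ} (hQ : 0 < Q) (r : Fin 2 → ℤ) (k q : ℕ) {x : Plane}
    (hx : Q ^ (3 / 2 : ℝ) ≤ ‖x‖) : physical₂ ω₀ ω Q r k q x = 0 := by
  have hX0 : 0 < Q ^ (3 / 2 : ℝ) := by positivity
  rw [physical₂, hω.om₀_eq_zero, zero_mul, Complex.ofReal_zero, mul_zero]
  rw [abs_of_nonneg (by positivity), le_div_iff₀ hX0]
  linarith

theorem continuous_physical₁ (Q : ℝ) (q : ℕ) : Continuous (physical₁ ω₀ ω Q q) := by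
  have c1 := hω.smooth₀.continuous
  have c2 := hω.smooth.continuous
  unfold physical₁
  fun_prop

theorem continuous_physical₂ {Q : ℝ} (hQ : 0 < Q) {r : Fin 2 → ℤ}
    (hr : ‖vec r‖ ≤ Q ^ (1 / 2 : ℝ)) {k q : ℕ} (hk : 1 ≤ k) (hq : 1 ≤ q) :
    Continuous (physical₂ ω₀ ω Q r k q) := by
  have c1 := hω.smooth₀.continuous
  have c2 := hω.smooth.continuous
  have hk' : (0 : ℝ) < k := by exact_mod_cast hk
  have hq' : (0 : ℝ) < q := by exact_mod_cast hq
  have h1 : physical₂ ω₀ ω Q r k q = fun x => ((cst ω / Q ^ 3 : ℝ) : ℂ) *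
      ((ω₀ (‖x‖ / Q ^ (3 / 2 : ℝ)) * ∑ j ∈ Finset.range ⌊1 / ((k : ℝ) * q / Q)⌋₊,
        1 / ((k : ℝ) * q / Q * ((j + 1 : ℕ) : ℝ)) * (ω ((k : ℝ) * q / Q * ((j + 1 : ℕ) : ℝ)) -
          ω (|inner ℝ (vec r) x / Q ^ 2| / ((k : ℝ) * q / Q * ((j + 1 : ℕ) : ℝ)))) : ℝ) : ℂ) := by
    ext x
    rw [physical₂]
    by_cases hx : ω₀ (‖x‖ / Q ^ (3 / 2 : ℝ)) = 0
    · simp [hx]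
    rw [hω.h_eq_sum (by positivity) (hω.abs_inner_div_le hQ hr hx)]
  rw [h1]
  fun_prop

theorem fourier_physical₁ {Q : ℝ} (hQ : 0 < Q) {q : ℕ} (hq : 1 ≤ q) :
    𝓕 (physical₁ ω₀ ω Q q) = p1 ω₀ ω Q q := by
  ext w
  have hq' : (0 : ℝ) < q := by exact_mod_cast hq
  have hX0 : 0 < Q ^ (3 / 2 : ℝ) := by positivity
  rw [fourier_eq_integral, p1, ← integral_const_mul]
  congr 1
  ext x
  rw [physical₁, mul_assoc, real_inner_comm]
  congr 3
  by_cases hx : ω₀ (‖x‖ / Q ^ (3 / 2 : ℝ)) = 0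
  · simp [hx]
  have hx1 := hω.lt_half_of_om₀_ne_zero hx
  rw [abs_of_nonneg (by positivity), div_lt_iff₀ hX0, rpow_three_halves hQ] at hx1
  rw [tsum_pnat_eq_sum_range (f := fun j : ℕ => 1 / ((q : ℝ) ^ 2 * (j : ℝ) ^ 2) *
    ω (‖x‖ / ((j : ℝ) * q * Q ^ (1 / 2 : ℝ)))) (n := ⌊Q / q⌋₊) fun j hj => ?_]
  · congr 1
    refine Finset.sum_congr rfl fun j _ => ?_
    push_cast
    rw [mul_pow, mul_comm (q : ℝ) ((j : ℝ) + 1)]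
  · have hj' := lt_mul_of_floor_div_lt hq' hj
    have hY0 : 0 < Q ^ (1 / 2 : ℝ) := by positivity
    have hj0 : 0 < (j : ℝ) * q * Q ^ (1 / 2 : ℝ) := by
      have : 0 < q * (j : ℝ) := hQ.trans hj'
      rw [mul_comm (j : ℝ)]
      positivity
    rw [hω.om_eq_zero (Or.inl ?_), mul_zero]
    rw [div_le_iff₀ hj0]
    nlinarith

omit hω in
theorem fourier_physical₂ (Q : ℝ) (r : Fin 2 → ℤ) (k q : ℕ) :
    𝓕 (physical₂ ω₀ ω Q r k q) = p2 ω₀ ω Q r k q := by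
  ext w
  rw [fourier_eq_integral, p2, ← integral_const_mul]
  congr 1
  ext x
  rw [physical₂, mul_assoc, real_inner_comm x w]

theorem exists_p1_decay {Q : ℝ} (hQ : 1 ≤ Q) {q : ℕ} (hq : 1 ≤ q) :
    ∃ C, ∀ w, ‖p1 ω₀ ω Q q w‖ ≤ C / (1 + ‖w‖) ^ 3 := by
  obtain ⟨C, hC0, hC⟩ := hω.exists_norm_p1_le 3
  refine ⟨C * Q, fun w => (hC Q hQ q hq w).trans ?_⟩
  have hq' : (1 : ℝ) ≤ q := by exact_mod_cast hq
  have hY : 1 ≤ Q ^ (1 / 2 : ℝ) := Real.one_le_rpow hQ (by norm_num)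
  have h1 : Q / (q * (1 + ‖w‖ * Q ^ (3 / 2 : ℝ))) ≤ Q := by
    apply div_le_self (by linarith)
    have : 0 ≤ ‖w‖ * Q ^ (3 / 2 : ℝ) := by positivity
    nlinarith
  have h2 : ‖w‖ ≤ ‖w‖ * q * Q ^ (1 / 2 : ℝ) := by
    have := mul_le_mul hq' hY zero_le_one (by linarith)
    rw [mul_assoc]
    nlinarith [norm_nonneg w]
  have h3 : 1 / (1 + ‖w‖ * q * Q ^ (1 / 2 : ℝ)) ^ 3 ≤ 1 / (1 + ‖w‖) ^ 3 := by gcongr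
  calc _ ≤ C * (Q * (1 / (1 + ‖w‖) ^ 3)) :=
        mul_le_mul_of_nonneg_left (mul_le_mul h1 h3 (by positivity) (by linarith)) hC0
    _ = _ := by ring

theorem exists_p2_decay {Q : ℝ} (hQ : 1 ≤ Q) {r : Fin 2 → ℤ} (hr1 : Q ^ (1 / 2 : ℝ) / 2 ≤ ‖vec r‖)
    (hr2 : ‖vec r‖ ≤ Q ^ (1 / 2 : ℝ)) {k q : ℕ} (hk : 1 ≤ k) (hq : 1 ≤ q) :
    ∃ C, ∀ w, ‖p2 ω₀ ω Q r k q w‖ ≤ C / (1 + ‖w‖) ^ 3 := by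
  obtain ⟨C, hC0, hC⟩ := hω.exists_norm_p2_le 3
  refine ⟨C, fun w => (hC Q (by linarith) r hr1 hr2 k q hk hq w).trans ?_⟩
  have hq' : (1 : ℝ) ≤ q := by exact_mod_cast hq
  have hk' : (1 : ℝ) ≤ k := by exact_mod_cast hk
  have hY : 1 ≤ Q ^ (1 / 2 : ℝ) := Real.one_le_rpow hQ (by norm_num)
  have h2 : ‖w‖ ≤ ‖w‖ * k * q * Q ^ (1 / 2 : ℝ) := by
    have h3 := mul_le_mul hq' hY zero_le_one (by linarith)
    have h4 := mul_le_mul hk' h3 (by norm_num) (by linarith)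
    rw [mul_assoc, mul_assoc]
    nlinarith [norm_nonneg w]
  have h3 : 0 ≤ |inner ℝ w (perp (vec r))| * Q := by positivity
  rw [mul_one_div]
  have h4 : 1 + ‖w‖ ≤ 1 + ‖w‖ * k * q * Q ^ (1 / 2 : ℝ) + |inner ℝ w (perp (vec r))| * Q := by
    linarith
  gcongr

theorem integrable_physical₁ {Q : ℝ} (hQ : 0 < Q) (q : ℕ) : Integrable (physical₁ ω₀ ω Q q) :=
  integrable_of_continuous_of_eq_zero (hω.continuous_physical₁ Q q)
    fun _ hx => hω.physical₁_eq_zero hQ q hx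

theorem integrable_physical₂ {Q : ℝ} (hQ : 0 < Q) {r : Fin 2 → ℤ}
    (hr : ‖vec r‖ ≤ Q ^ (1 / 2 : ℝ)) {k q : ℕ} (hk : 1 ≤ k) (hq : 1 ≤ q) :
    Integrable (physical₂ ω₀ ω Q r k q) :=
  integrable_of_continuous_of_eq_zero (hω.continuous_physical₂ hQ hr hk hq)
    fun _ hx => hω.physical₂_eq_zero hQ r k q hx

theorem continuous_p1 {Q : ℝ} (hQ : 0 < Q) {q : ℕ} (hq : 1 ≤ q) :
    Continuous (p1 ω₀ ω Q q) :=
  hω.fourier_physical₁ hQ hq ▸ continuous_fourier (hω.integrable_physical₁ hQ q)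

theorem continuous_p2 {Q : ℝ} (hQ : 0 < Q) {r : Fin 2 → ℤ}
    (hr : ‖vec r‖ ≤ Q ^ (1 / 2 : ℝ)) {k q : ℕ} (hk : 1 ≤ k) (hq : 1 ≤ q) :
    Continuous (p2 ω₀ ω Q r k q) :=
  fourier_physical₂ (ω₀ := ω₀) (ω := ω) Q r k q ▸
    continuous_fourier (hω.integrable_physical₂ hQ hr hk hq)

theorem integral_p1_mul_phase {Q : ℝ} (hQ : 1 ≤ Q) {q : ℕ} (hq : 1 ≤ q) (n : Fin 2 → ℤ)
    (a : Fin 2 → ℕ) : ∫ w, p1 ω₀ ω Q q w * phase n q a w =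
      e ((dot a n : ℝ) / q) * physical₁ ω₀ ω Q q (vec n) := by
  have hQ0 : 0 < Q := by linarith
  obtain ⟨C, hC⟩ := hω.exists_p1_decay hQ hq
  have h1 := eq_integral_fourier (hω.continuous_physical₁ Q q) (hω.integrable_physical₁ hQ0 q)
    (C := C) (N := 3) (by rw [finrank_euclideanSpace, Fintype.card_fin]; norm_num)
    (by rwa [hω.fourier_physical₁ hQ0 hq]) (vec n)
  rw [h1, hω.fourier_physical₁ hQ0 hq, ← integral_const_mul]
  congr 1
  ext w
  rw [phase_eq]
  ring

theorem integral_p2_mul_phase {Q : ℝ} (hQ : 1 ≤ Q) {r : Fin 2 → ℤ}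
    (hr1 : Q ^ (1 / 2 : ℝ) / 2 ≤ ‖vec r‖) (hr2 : ‖vec r‖ ≤ Q ^ (1 / 2 : ℝ)) {k q : ℕ}
    (hk : 1 ≤ k) (hq : 1 ≤ q) (n : Fin 2 → ℤ) (a : Fin 2 → ℕ) :
    ∫ w, p2 ω₀ ω Q r k q w * phase n q a w =
      e ((dot a n : ℝ) / q) * physical₂ ω₀ ω Q r k q (vec n) := by
  have hQ0 : 0 < Q := by linarith
  obtain ⟨C, hC⟩ := hω.exists_p2_decay hQ hr1 hr2 hk hq
  have h1 := eq_integral_fourier (hω.continuous_physical₂ hQ0 hr2 hk hq)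
    (hω.integrable_physical₂ hQ0 hr2 hk hq)
    (C := C) (N := 3) (by rw [finrank_euclideanSpace, Fintype.card_fin]; norm_num)
    (by rwa [fourier_physical₂]) (vec n)
  rw [h1, fourier_physical₂, ← integral_const_mul]
  congr 1
  ext w
  rw [phase_eq]
  ring

theorem integrable_p1 {Q : ℝ} (hQ : 1 ≤ Q) {q : ℕ} (hq : 1 ≤ q) : Integrable (p1 ω₀ ω Q q) := by
  obtain ⟨C, hC⟩ := hω.exists_p1_decay hQ hq
  exact integrable_of_decay (hω.continuous_p1 (by linarith) hq).aestronglyMeasurable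
    (by rw [finrank_euclideanSpace, Fintype.card_fin]; norm_num) hC

theorem integrable_p2 {Q : ℝ} (hQ : 1 ≤ Q) {r : Fin 2 → ℤ}
    (hr1 : Q ^ (1 / 2 : ℝ) / 2 ≤ ‖vec r‖) (hr2 : ‖vec r‖ ≤ Q ^ (1 / 2 : ℝ)) {k q : ℕ}
    (hk : 1 ≤ k) (hq : 1 ≤ q) : Integrable (p2 ω₀ ω Q r k q) := by
  obtain ⟨C, hC⟩ := hω.exists_p2_decay hQ hr1 hr2 hk hq
  exact integrable_of_decay (hω.continuous_p2 (by linarith) hr2 hk hq).aestronglyMeasurable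
    (by rw [finrank_euclideanSpace, Fintype.card_fin]; norm_num) hC

end Weights

theorem integrable_mul_phase {f : Plane → ℂ} (hf : Integrable f) (n : Fin 2 → ℤ) (q : ℕ)
    (a : Fin 2 → ℕ) : Integrable fun w => f w * phase n q a w :=
  hf.mul_bdd (c := 1) (continuous_phase n q a).aestronglyMeasurable
    (Eventually.of_forall fun w => (norm_phase n q a w).le)

/-! ### The shell of vectors `r` -/

/-- The greatest common divisor of the coordinates. -/
def content (r : Fin 2 → ℤ) : ℕ := Int.gcd (r 0) (r 1)

open Classical in
/-- The integer vectors `r` with `ω(|r| / Q^{1/2}) ≠ 0`. -/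
noncomputable def shell (ω : ℝ → ℝ) (Q : ℝ) : Finset (Fin 2 → ℤ) :=
  (finite_norm_vec_le (Q ^ (1 / 2 : ℝ))).toFinset.filter
    (fun r => ω (‖vec r‖ / Q ^ (1 / 2 : ℝ)) ≠ 0)

theorem exists_primitive {r : Fin 2 → ℤ} (hr : r ≠ 0) :
    0 < content r ∧ ∃ c : Fin 2 → ℤ, IsCoprime (c 0) (c 1) ∧ ∀ i, r i = content r * c i := by
  have h0 : 0 < content r := by
    rw [content, Int.gcd_pos_iff]
    by_contra! h
    exact hr (by ext i; fin_cases i; exacts [h.1, h.2])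
  refine ⟨h0, ![r 0 / content r, r 1 / content r], ?_, ?_⟩
  · rw [Int.isCoprime_iff_gcd_eq_one]
    exact Int.gcd_div_gcd_div_gcd h0
  · intro i
    fin_cases i
    · exact (Int.mul_ediv_cancel' (Int.gcd_dvd_left _ _)).symm
    · exact (Int.mul_ediv_cancel' (Int.gcd_dvd_right _ _)).symm

theorem content_mul {l : ℕ} {c : Fin 2 → ℤ} (hc : IsCoprime (c 0) (c 1)) :
    content (fun i => (l : ℤ) * c i) = l := by
  rw [content, Int.gcd_mul_left, Int.isCoprime_iff_gcd_eq_one.1 hc, mul_one, Int.natAbs_natCast]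

theorem content_le_norm {r : Fin 2 → ℤ} (hr : r ≠ 0) : (content r : ℝ) ≤ ‖vec r‖ := by
  obtain ⟨h0, c, hc, hrc⟩ := exists_primitive hr
  obtain ⟨i, hi⟩ := Function.ne_iff.1 hr
  have h1 : (content r : ℤ) ∣ r i := ⟨c i, hrc i⟩
  have h2 : (content r : ℤ) ≤ |r i| := Int.le_of_dvd (abs_pos.2 hi) ((dvd_abs _ _).2 h1)
  have h3 : (content r : ℝ) ≤ |(r i : ℝ)| := by exact_mod_cast h2
  exact h3.trans (abs_coord_le (vec r) i)

theorem div_gcd_mul_eq_lcm (q l : ℕ) : l / Nat.gcd q l * q = Nat.lcm q l := by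
  rw [mul_comm, Nat.lcm, Nat.mul_div_assoc _ (Nat.gcd_dvd_right q l)]

namespace Weights

variable {ω₀ ω : ℝ → ℝ} (hω : Weights ω₀ ω)
include hω

theorem mem_shell {Q : ℝ} (hQ : 0 < Q) {r : Fin 2 → ℤ} :
    r ∈ shell ω Q ↔ ω (‖vec r‖ / Q ^ (1 / 2 : ℝ)) ≠ 0 := by
  have hY0 : 0 < Q ^ (1 / 2 : ℝ) := by positivity
  rw [shell, Finset.mem_filter, Set.Finite.mem_toFinset, Set.mem_ofPred_eq, and_iff_right_iff_imp]
  intro h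
  by_contra hlt
  refine h (hω.om_eq_zero (Or.inr ?_))
  rw [le_div_iff₀ hY0, one_mul]
  exact (not_le.1 hlt).le

theorem half_le_of_mem_shell {Q : ℝ} (hQ : 0 < Q) {r : Fin 2 → ℤ} (hr : r ∈ shell ω Q) :
    Q ^ (1 / 2 : ℝ) / 2 ≤ ‖vec r‖ := by
  have hY0 : 0 < Q ^ (1 / 2 : ℝ) := by positivity
  by_contra hlt
  refine (hω.mem_shell hQ).1 hr (hω.om_eq_zero (Or.inl ?_))
  rw [div_le_iff₀ hY0]
  linarith [not_le.1 hlt]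

omit hω in
theorem le_of_mem_shell {Q : ℝ} {r : Fin 2 → ℤ} (hr : r ∈ shell ω Q) :
    ‖vec r‖ ≤ Q ^ (1 / 2 : ℝ) := by
  rw [shell, Finset.mem_filter, Set.Finite.mem_toFinset] at hr
  exact hr.1

theorem ne_zero_of_mem_shell {Q : ℝ} (hQ : 0 < Q) {r : Fin 2 → ℤ} (hr : r ∈ shell ω Q) :
    r ≠ 0 := by
  rintro rfl
  have := hω.half_le_of_mem_shell hQ hr
  rw [vec_zero, norm_zero] at this
  have hY0 : 0 < Q ^ (1 / 2 : ℝ) := by positivity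
  linarith

omit hω in
theorem card_shell_le {Q : ℝ} (hQ : 1 ≤ Q) : ((shell ω Q).card : ℝ) ≤ 9 * Q := by
  have hY1 : 1 ≤ Q ^ (1 / 2 : ℝ) := Real.one_le_rpow hQ (by norm_num)
  set m : ℤ := ⌊Q ^ (1 / 2 : ℝ)⌋ with hm
  have hm0 : 0 ≤ m := Int.floor_nonneg.2 (by linarith)
  have h1 : shell ω Q ⊆ Fintype.piFinset fun _ => Finset.Icc (-m) m := by
    intro r hr
    rw [Fintype.mem_piFinset]
    intro i
    have h2 := (abs_coord_le (vec r) i).trans (le_of_mem_shell hr)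
    rw [vec_apply] at h2
    have h3 : |r i| ≤ m := Int.le_floor.2 (by rwa [Int.cast_abs])
    exact Finset.mem_Icc.2 (abs_le.1 h3)
  have h2 := Finset.card_le_card h1
  rw [Fintype.card_piFinset, Finset.prod_const, Finset.card_univ, Fintype.card_fin,
    Int.card_Icc] at h2
  have h3 : ((m + 1 - -m).toNat : ℝ) ≤ 3 * Q ^ (1 / 2 : ℝ) := by
    have h4 : (((m + 1 - -m).toNat : ℤ) : ℝ) = ((m + 1 - -m : ℤ) : ℝ) := by
      rw [Int.toNat_of_nonneg (by omega)]
    rw [Int.cast_natCast] at h4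
    rw [h4]
    push_cast
    linarith [Int.floor_le (Q ^ (1 / 2 : ℝ))]
  calc ((shell ω Q).card : ℝ) ≤ ((m + 1 - -m).toNat : ℝ) ^ 2 := by exact_mod_cast h2
    _ ≤ (3 * Q ^ (1 / 2 : ℝ)) ^ 2 := by gcongr
    _ = 9 * Q := by rw [mul_pow, rpow_half_sq (by linarith)]; norm_num

/-- A Riemann sum of `ω` approximates `∫ ω = 1` to any order in the step. -/
theorem exists_abs_sum_om_sub_le (N : ℕ) : ∃ C, 0 ≤ C ∧ ∀ Q : ℝ, 0 < Q → ∀ l : ℕ, 0 < l →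
    |l / Q * ∑ j ∈ Finset.range ⌊Q / l⌋₊, ω (l * (j + 1 : ℕ) / Q) - 1| ≤
      C * (l / Q) ^ (N + 2) := by
  set f : ℝ → ℂ := fun x => (ω |x| : ℂ) with hf
  have hf1 : ContDiff ℝ (⊤ : ℕ∞) f := Complex.ofRealCLM.contDiff.comp hω.contDiff_om_abs
  have hfR : ∀ x, 1 ≤ |x| → f x = 0 := fun x hx => by
    rw [hf]
    simp only
    rw [hω.om_abs_eq_zero hx, Complex.ofReal_zero]
  have hfs : HasCompactSupport f := HasCompactSupport.intro (isCompact_Icc (a := (-1 : ℝ)) (b := 1))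
    fun x hx => hfR x (by
      by_contra! h
      exact hx ⟨(abs_lt.1 h).1.le, (abs_lt.1 h).2.le⟩)
  obtain ⟨K, hK0, hK⟩ := exists_fourier_decay hf1 hfs (N + 2)
  have hwi : Integrable ω := by
    by_contra h
    have := hω.integral
    rw [integral_undef h] at this
    exact zero_ne_one this
  have hF0 : 𝓕 f 0 = 2 := by
    rw [fourier_eq_integral]
    simp only [inner_zero_right, neg_zero, e_zero, mul_one]
    rw [hf, integral_complex_ofReal]
    have h1 : (fun x => ω |x|) = fun x => ω x + ω (-x) := by
      ext x
      rcases le_total 0 x with hx | hx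
      · rw [abs_of_nonneg hx, hω.om_eq_zero (x := -x) (Or.inl (by linarith)), add_zero]
      · rw [abs_of_nonpos hx, hω.om_eq_zero (x := x) (Or.inl (by linarith)), zero_add]
    rw [h1, integral_add hwi hwi.comp_neg, integral_neg_eq_self, hω.integral]
    norm_num
  have hf0 : f 0 = 0 := by
    rw [hf]
    simp only [abs_zero]
    rw [hω.om_eq_zero (Or.inl (by norm_num)), Complex.ofReal_zero]
  refine ⟨zetaTwo * K, mul_nonneg zetaTwo_nonneg hK0, fun Q hQ l hl => ?_⟩
  have hl' : (0 : ℝ) < l := by exact_mod_cast hl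
  set y : ℝ := l / Q with hy
  have hy0 : 0 < y := by positivity
  have h1 := norm_tsum_pnat_sub_le hf1.continuous (fun x => by rw [hf]; simp only [abs_neg]) hfR hy0
    (N := N) (K := K) (fun ξ hξ => (hK ξ).trans (by
      have : 0 < |ξ| := lt_of_lt_of_le (by positivity) hξ
      rw [Real.norm_eq_abs]
      gcongr
      linarith))
  rw [hF0, hf0] at h1
  have h2 : ∑' j : ℕ+, f (y * (j : ℝ)) =
      ((∑ j ∈ Finset.range ⌊Q / l⌋₊, ω (l * (j + 1 : ℕ) / Q) : ℝ) : ℂ) := by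
    rw [tsum_pnat_eq_sum_range (f := fun j : ℕ => f (y * (j : ℝ))) (n := ⌊Q / l⌋₊) fun j hj => ?_]
    · push_cast
      refine Finset.sum_congr rfl fun j _ => ?_
      rw [hf]
      simp only
      rw [abs_of_nonneg (by positivity), hy, div_mul_eq_mul_div]
    · apply hfR
      rw [abs_of_nonneg (by positivity), hy, div_mul_eq_mul_div, le_div_iff₀ hQ, one_mul]
      exact (lt_mul_of_floor_div_lt hl' hj).le
  rw [h2] at h1
  set S : ℝ := ∑ j ∈ Finset.range ⌊Q / l⌋₊, ω (l * (j + 1 : ℕ) / Q) with hS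
  have h3 : |S - 1 / y| ≤ zetaTwo * K * y ^ (N + 1) := by
    rw [← Real.norm_eq_abs, ← Complex.norm_real]
    convert h1 using 2
    push_cast
    field_simp
    ring
  have hmul : y * S - 1 = y * (S - 1 / y) := by field_simp
  rw [hmul, abs_mul, abs_of_pos hy0]
  calc y * |S - 1 / y| ≤ y * (zetaTwo * K * y ^ (N + 1)) := by gcongr
    _ = _ := by ring

/-- The number of lattice points in a smooth annulus agrees with its area to any order. -/
theorem exists_abs_sum_shell_sub_le (N : ℕ) : ∃ C, 0 ≤ C ∧ ∀ Q : ℝ, 1 ≤ Q →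
    |cst ω / Q * ∑ r ∈ shell ω Q, ω (‖vec r‖ / Q ^ (1 / 2 : ℝ)) - 1| ≤ C / Q ^ N := by
  obtain ⟨K₀, hK₀, hK₀'⟩ := exists_fourier_decay hω.contDiff_radial hω.hasCompactSupport_radial 4
  obtain ⟨K, hK, hK'⟩ := exists_fourier_decay hω.contDiff_radial hω.hasCompactSupport_radial
    (2 * N + 4)
  have hcst := hω.cst_pos
  refine ⟨cst ω * (latticeConst * (K * 4 ^ (2 * N + 4))), by
    have := latticeConst_nonneg
    positivity, fun Q hQ => ?_⟩
  have hQ0 : 0 < Q := by linarith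
  set X := Q ^ (1 / 2 : ℝ) with hX
  have hX1 : 1 ≤ X := Real.one_le_rpow hQ (by norm_num)
  have hX0 : 0 < X := by linarith
  have hX2 : X ^ 2 = Q := rpow_half_sq hQ0
  have h1 := norm_lattice_sum_sub_le hω.contDiff_radial.continuous (R := 1)
    (fun x hx => hω.radial_eq_zero (Or.inr hx)) hK₀' hX0 one_pos (N := 2 * N) (K := K)
    (fun ξ hξ => (hK' ξ).trans (by
      have : 0 < ‖ξ‖ := lt_of_lt_of_le (by positivity) hξ
      gcongr
      linarith)) (a := 0) (by simp [reduced]; rfl)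
  have h2 : ∑' r : Fin 2 → ℤ, (if ((1 : ℕ) : ℤ) ∣ wedge r 0 then radial ω (X⁻¹ • vec r) else 0) =
      ((∑ r ∈ shell ω Q, ω (‖vec r‖ / X) : ℝ) : ℂ) := by
    have h3 : ∀ r : Fin 2 → ℤ, (if ((1 : ℕ) : ℤ) ∣ wedge r 0 then radial ω (X⁻¹ • vec r) else 0) =
        ((ω (‖vec r‖ / X) : ℝ) : ℂ) := by
      intro r
      rw [if_pos (by simp), radial, norm_smul, Real.norm_of_nonneg (by positivity), inv_mul_eq_div]
    simp only [h3]
    rw [tsum_eq_sum (s := shell ω Q) fun r hr => ?_]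
    · push_cast
      rfl
    · rw [hω.mem_shell hQ0, not_not] at hr
      rw [hr, Complex.ofReal_zero]
  have h3 : 𝓕 (radial ω) 0 = (((cst ω)⁻¹ : ℝ) : ℂ) := by
    rw [fourier_eq_integral, cst, inv_inv, ← integral_complex_ofReal]
    simp only [inner_zero_right, neg_zero, e_zero, mul_one, radial]
  rw [h2, h3, hX2] at h1
  set S : ℝ := ∑ r ∈ shell ω Q, ω (‖vec r‖ / X) with hS
  have h4 : |S - Q * (cst ω)⁻¹| ≤ Q * (latticeConst * (K * (4 / X) ^ (2 * N + 4))) := by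
    rw [← Real.norm_eq_abs, ← Complex.norm_real]
    convert h1 using 2
    · push_cast
      simp
    · simp
  have h5 : cst ω / Q * S - 1 = cst ω / Q * (S - Q * (cst ω)⁻¹) := by field_simp
  rw [h5, abs_mul, abs_of_pos (by positivity)]
  have h6 : (4 / X) ^ (2 * N + 4) ≤ 4 ^ (2 * N + 4) / Q ^ N := by
    rw [div_pow]
    have : Q ^ N ≤ X ^ (2 * N + 4) := by
      rw [← hX2, ← pow_mul]
      exact pow_le_pow_right₀ hX1 (by omega)
    gcongr
  calc cst ω / Q * |S - Q * (cst ω)⁻¹| ≤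
      cst ω / Q * (Q * (latticeConst * (K * (4 ^ (2 * N + 4) / Q ^ N)))) := by
        have := latticeConst_nonneg
        refine mul_le_mul_of_nonneg_left (h4.trans ?_) (by positivity)
        gcongr
    _ = _ := by field_simp

end Weights

/-! ### The delta symbol before localisation to arcs -/

/-- The expansion of the delta symbol in physical space: the sum over all fractions `a/q` of the
integrals of the kernels over the whole plane. -/
noncomputable def synthesis (ω₀ ω : ℝ → ℝ) (Q : ℝ) (n : Fin 2 → ℤ) : ℂ :=
  ∑ q ∈ Finset.Icc 1 ⌊Q⌋₊, ∑ a ∈ reduced q, e ((dot a n : ℝ) / q) *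
    (physical₁ ω₀ ω Q q (vec n) +
      ∑ r ∈ (shell ω Q).filter (fun r => (q : ℤ) ∣ wedge r a),
        (ω (‖vec r‖ / Q ^ (1 / 2 : ℝ)) : ℂ) *
          physical₂ ω₀ ω Q r (content r / Nat.gcd q (content r)) q (vec n))

namespace Weights

variable {ω₀ ω : ℝ → ℝ} (hω : Weights ω₀ ω)
include hω

open Classical in
/-- Evaluation of the expansion. The kernels `p_{1,q}` collect the common divisors of `n`, the
kernels `p_{2,r,k,q}` the vectors `r` orthogonal to `n`. -/
theorem synthesis_eq {Q : ℝ} (hQ : 0 < Q) {n : Fin 2 → ℤ}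
    (hn : ω₀ (‖vec n‖ / Q ^ (3 / 2 : ℝ)) ≠ 0) : synthesis ω₀ ω Q n =
      ((ω₀ (‖vec n‖ / Q ^ (3 / 2 : ℝ)) * (cst ω / Q) *
        (∑ r ∈ (shell ω Q).filter (fun r => ∃ b : ℤ, n 0 = b * r 1 ∧ n 1 = -(b * r 0)),
          ω (‖vec r‖ / Q ^ (1 / 2 : ℝ)) * (content r / Q *
            ∑ j ∈ Finset.range ⌊Q / content r⌋₊, ω (content r * (j + 1 : ℕ) / Q)) -
        2 * ∑ D ∈ (Finset.Icc 1 ⌊Q⌋₊).filter (fun D : ℕ => (D : ℤ) ∣ n 0 ∧ (D : ℤ) ∣ n 1),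
          ω (‖vec n‖ / D / Q ^ (1 / 2 : ℝ))) : ℝ) : ℂ) := by
  set W := ω₀ (‖vec n‖ / Q ^ (3 / 2 : ℝ)) with hW
  set wt : (Fin 2 → ℤ) → ℝ := fun r => ω (‖vec r‖ / Q ^ (1 / 2 : ℝ)) with hwt
  have h1 : synthesis ω₀ ω Q n =
      (∑ q ∈ Finset.Icc 1 ⌊Q⌋₊, ∑ a ∈ reduced q, e ((dot a n : ℝ) / q) *
        physical₁ ω₀ ω Q q (vec n)) +
      ∑ r ∈ shell ω Q, (wt r : ℂ) * ∑ q ∈ Finset.Icc 1 ⌊Q⌋₊,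
        ∑ a ∈ (reduced q).filter (fun a => (q : ℤ) ∣ wedge r a), e ((dot a n : ℝ) / q) *
          physical₂ ω₀ ω Q r (content r / Nat.gcd q (content r)) q (vec n) := by
    rw [synthesis]
    simp only [mul_add, Finset.sum_add_distrib]
    congr 1
    simp only [Finset.mul_sum]
    rw [Finset.sum_comm]
    refine Finset.sum_congr rfl fun q _ => ?_
    simp only [Finset.sum_filter]
    rw [Finset.sum_comm]
    refine Finset.sum_congr rfl fun r _ => Finset.sum_congr rfl fun a _ => ?_
    split_ifs
    · ring
    · rfl
  have h2 : (∑ q ∈ Finset.Icc 1 ⌊Q⌋₊, ∑ a ∈ reduced q, e ((dot a n : ℝ) / q) *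
        physical₁ ω₀ ω Q q (vec n)) = ((-(2 * cst ω / Q) * W *
        ∑ D ∈ (Finset.Icc 1 ⌊Q⌋₊).filter (fun D : ℕ => (D : ℤ) ∣ n 0 ∧ (D : ℤ) ∣ n 1),
          ω (‖vec n‖ / D / Q ^ (1 / 2 : ℝ)) : ℝ) : ℂ) := by
    have h3 := sum_reduced_e (Q := Q) n fun D : ℕ => ω (‖vec n‖ / D / Q ^ (1 / 2 : ℝ))
    rw [Complex.ofReal_mul, ← h3, Finset.mul_sum]
    refine Finset.sum_congr rfl fun q _ => ?_
    rw [Finset.mul_sum]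
    refine Finset.sum_congr rfl fun a _ => ?_
    rw [physical₁]
    simp only [div_div]
    push_cast
    ring
  have h4 : ∀ r ∈ shell ω Q, ∑ q ∈ Finset.Icc 1 ⌊Q⌋₊,
        ∑ a ∈ (reduced q).filter (fun a => (q : ℤ) ∣ wedge r a), e ((dot a n : ℝ) / q) *
          physical₂ ω₀ ω Q r (content r / Nat.gcd q (content r)) q (vec n) =
      if ∃ b : ℤ, n 0 = b * r 1 ∧ n 1 = -(b * r 0) then
        ((cst ω / Q * W * (content r / Q *
            ∑ j ∈ Finset.range ⌊Q / content r⌋₊, ω (content r * (j + 1 : ℕ) / Q)) : ℝ) : ℂ)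
        else 0 := by
    intro r hr
    obtain ⟨hl, c, hc, hrc⟩ := exists_primitive (hω.ne_zero_of_mem_shell hQ hr)
    have hz : inner ℝ (vec r) (vec n) / Q ^ 2 =
        ((r 0 * n 0 + r 1 * n 1 : ℤ) : ℝ) / Q ^ 2 := by
      rw [inner_plane]
      simp only [vec_apply]
      push_cast
      rfl
    have h5 := hω.sum_reduced_h hQ hl (n := n) hc hrc hz
      (hω.abs_inner_div_le hQ (le_of_mem_shell hr) hn)
    have h6 : ∀ q ∈ Finset.Icc 1 ⌊Q⌋₊,
        ∑ a ∈ (reduced q).filter (fun a => (q : ℤ) ∣ wedge r a), e ((dot a n : ℝ) / q) *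
          physical₂ ω₀ ω Q r (content r / Nat.gcd q (content r)) q (vec n) =
        ((cst ω / Q ^ 3 * W : ℝ) : ℂ) *
        ∑ a ∈ (reduced q).filter (fun a => (q : ℤ) ∣ wedge r a), e ((dot a n : ℝ) / q) *
          (h ω ((Nat.lcm q (content r) : ℕ) / Q) (inner ℝ (vec r) (vec n) / Q ^ 2) : ℂ) := by
      intro q _
      rw [Finset.mul_sum]
      refine Finset.sum_congr rfl fun a _ => ?_
      rw [physical₂, ← Nat.cast_mul, div_gcd_mul_eq_lcm, Complex.ofReal_mul, Complex.ofReal_mul]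
      ring
    rw [Finset.sum_congr rfl h6, ← Finset.mul_sum, h5]
    split_ifs
    · rw [← Complex.ofReal_mul]
      congr 1
      field_simp
    · rw [mul_zero]
  have h7 : ∑ r ∈ shell ω Q, (wt r : ℂ) * ∑ q ∈ Finset.Icc 1 ⌊Q⌋₊,
        ∑ a ∈ (reduced q).filter (fun a => (q : ℤ) ∣ wedge r a), e ((dot a n : ℝ) / q) *
          physical₂ ω₀ ω Q r (content r / Nat.gcd q (content r)) q (vec n) =
      ((cst ω / Q * W *
        ∑ r ∈ (shell ω Q).filter (fun r => ∃ b : ℤ, n 0 = b * r 1 ∧ n 1 = -(b * r 0)),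
          wt r * (content r / Q *
            ∑ j ∈ Finset.range ⌊Q / content r⌋₊, ω (content r * (j + 1 : ℕ) / Q)) : ℝ) : ℂ) := by
    rw [Finset.sum_congr rfl fun r hr => by rw [h4 r hr], Complex.ofReal_mul, Complex.ofReal_sum,
      Finset.sum_filter, Finset.mul_sum]
    refine Finset.sum_congr rfl fun r _ => ?_
    split_ifs
    · push_cast
      ring
    · simp
  rw [h1, h2, h7]
  push_cast
  ring

/-- The expansion reproduces the delta symbol up to an arbitrary power of `Q`. -/
theorem exists_norm_synthesis_sub_delta_le (N : ℕ) : ∃ C, 0 ≤ C ∧ ∀ Q : ℝ, 1 ≤ Q →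
    ∀ n : Fin 2 → ℤ, ‖synthesis ω₀ ω Q n - delta n‖ ≤ C / Q ^ N := by
  classical
  obtain ⟨A, hA0, hA⟩ := hω.exists_abs_sum_om_sub_le (2 * N)
  obtain ⟨E, hE0, hE⟩ := hω.exists_abs_sum_shell_sub_le N
  obtain ⟨B, hB0, hB⟩ := hω.exists_bound
  obtain ⟨B', hB'⟩ : ∃ B', ∀ x, ω₀ x ≤ B' := by
    have hc : HasCompactSupport ω₀ :=
      HasCompactSupport.intro (isCompact_Icc (a := (-1 : ℝ)) (b := 1)) fun x hx =>
        hω.om₀_eq_zero (by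
          by_contra! h
          exact hx ⟨by linarith [(abs_lt.1 h).1], by linarith [(abs_lt.1 h).2]⟩)
    obtain ⟨B, hB⟩ := hω.smooth₀.continuous.bounded_above_of_compact_support hc
    exact ⟨B, fun x => (le_abs_self _).trans (hB x)⟩
  have hB'0 : 0 ≤ B' := (hω.nonneg₀ 0).trans (hB' 0)
  have hcst := hω.cst_pos
  refine ⟨B' * (cst ω * (9 * (B * A))) + E, by positivity, fun Q hQ n => ?_⟩
  have hQ0 : 0 < Q := by linarith
  set X := Q ^ (1 / 2 : ℝ) with hX
  have hX1 : 1 ≤ X := Real.one_le_rpow hQ (by norm_num)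
  have hX0 : 0 < X := by linarith
  have hX2 : X ^ 2 = Q := rpow_half_sq hQ0
  by_cases hn : ω₀ (‖vec n‖ / Q ^ (3 / 2 : ℝ)) = 0
  · have hn0 : n ≠ 0 := by
      rintro rfl
      rw [vec_zero, norm_zero, zero_div, hω.zero₀] at hn
      exact one_ne_zero hn
    have : synthesis ω₀ ω Q n = 0 := by
      rw [synthesis]
      refine Finset.sum_eq_zero fun q _ => Finset.sum_eq_zero fun a _ => ?_
      simp [physical₁, physical₂, hn]
    rw [this, delta, if_neg hn0, sub_zero, norm_zero]
    positivity
  rw [hω.synthesis_eq hQ0 hn]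
  set W := ω₀ (‖vec n‖ / Q ^ (3 / 2 : ℝ)) with hW
  have hW0 : 0 ≤ W := hω.nonneg₀ _
  set T : (Fin 2 → ℤ) → ℝ := fun r => content r / Q *
    ∑ j ∈ Finset.range ⌊Q / content r⌋₊, ω (content r * (j + 1 : ℕ) / Q) with hT
  set S := (shell ω Q).filter (fun r => ∃ b : ℤ, n 0 = b * r 1 ∧ n 1 = -(b * r 0)) with hS
  -- Replacing each Riemann sum by its limit costs a negligible amount.
  have hTr : ∀ r ∈ shell ω Q, |T r - 1| ≤ A / Q ^ N := by
    intro r hr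
    have hr0 := hω.ne_zero_of_mem_shell hQ0 hr
    have hl := (exists_primitive hr0).1
    have hle : (content r : ℝ) ≤ X := (content_le_norm hr0).trans (le_of_mem_shell hr)
    refine (hA Q hQ0 (content r) hl).trans ?_
    have h1 : (content r : ℝ) / Q ≤ 1 / X := by
      rw [div_le_div_iff₀ hQ0 hX0]
      nlinarith
    calc A * (content r / Q) ^ (2 * N + 2) ≤ A * (1 / X) ^ (2 * N + 2) := by gcongr
      _ ≤ A * (1 / X) ^ (2 * N) := by
        refine mul_le_mul_of_nonneg_left (pow_le_pow_of_le_one (by positivity) ?_ (by omega)) hA0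
        rw [div_le_one hX0]
        exact hX1
      _ = A / Q ^ N := by rw [one_div, inv_pow, pow_mul, hX2, div_eq_mul_inv]
  have hsum : |cst ω / Q * (∑ r ∈ S, ω (‖vec r‖ / X) * T r - ∑ r ∈ S, ω (‖vec r‖ / X))| ≤
      cst ω * (9 * (B * A)) / Q ^ N := by
    rw [abs_mul, abs_of_pos (by positivity), ← Finset.sum_sub_distrib]
    have h1 : |∑ r ∈ S, (ω (‖vec r‖ / X) * T r - ω (‖vec r‖ / X))| ≤
        (9 * Q) * (B * (A / Q ^ N)) := by
      refine (Finset.abs_sum_le_sum_abs _ _).trans ?_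
      refine (Finset.sum_le_card_nsmul S _ (B * (A / Q ^ N)) fun r hr => ?_).trans ?_
      · rw [← mul_sub_one, abs_mul, abs_of_nonneg (hω.nonneg _)]
        exact mul_le_mul (hB _) (hTr r (Finset.mem_filter.1 hr).1) (abs_nonneg _) hB0
      · rw [nsmul_eq_mul]
        refine mul_le_mul_of_nonneg_right ?_ (by positivity)
        exact le_trans (by exact_mod_cast Finset.card_filter_le _ _) (card_shell_le hQ)
    calc _ ≤ cst ω / Q * ((9 * Q) * (B * (A / Q ^ N))) := by gcongr
      _ = _ := by field_simp
  have hmain : |W * (cst ω / Q) * (∑ r ∈ S, ω (‖vec r‖ / X) - 2 *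
      ∑ D ∈ (Finset.Icc 1 ⌊Q⌋₊).filter (fun D : ℕ => (D : ℤ) ∣ n 0 ∧ (D : ℤ) ∣ n 1),
          ω (‖vec n‖ / D / X)) - (if n = 0 then 1 else 0)| ≤ E / Q ^ N := by
    by_cases hn0 : n = 0
    · subst hn0
      have h1 : W = 1 := by rw [hW, vec_zero, norm_zero, zero_div, hω.zero₀]
      have h2 : S = shell ω Q := by
        rw [hS, Finset.filter_true_of_mem]
        intro r _
        exact ⟨0, by simp⟩
      have h3 : ∀ D : ℕ, ω (‖vec (0 : Fin 2 → ℤ)‖ / D / X) = 0 := by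
        intro D
        rw [vec_zero, norm_zero, zero_div, zero_div, hω.om_eq_zero (Or.inl (by norm_num))]
      simp only [h3, Finset.sum_const_zero, mul_zero, sub_zero]
      rw [h1, h2, one_mul, if_pos trivial]
      exact hE Q hQ
    · have h1 := sum_multiple_perp hn0 (fun t => ω (t / X)) (B := ⌊Q⌋₊) (R := shell ω Q) ?_
        fun r hr => (hω.mem_shell hQ0).2 hr
      · rw [if_neg hn0, hS, h1, sub_self, mul_zero, sub_zero, abs_zero]
        positivity
      · intro D hD
        have hD' := Nat.lt_of_floor_lt hD
        have hD0 : (0 : ℝ) < D := hQ0.trans hD'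
        have h2 := hω.lt_half_of_om₀_ne_zero hn
        rw [abs_of_nonneg (by positivity), div_lt_iff₀ (by positivity), rpow_three_halves hQ0]
          at h2
        refine hω.om_eq_zero (Or.inl ?_)
        rw [div_div, div_le_iff₀ (by positivity)]
        nlinarith
  have hdelta : delta n = ((if n = 0 then 1 else 0 : ℝ) : ℂ) := by
    rw [delta]
    split_ifs <;> simp
  rw [hdelta, ← Complex.ofReal_sub, Complex.norm_real, Real.norm_eq_abs]
  set P := ∑ D ∈ (Finset.Icc 1 ⌊Q⌋₊).filter (fun D : ℕ => (D : ℤ) ∣ n 0 ∧ (D : ℤ) ∣ n 1),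
          ω (‖vec n‖ / D / X) with hP
  set U := ∑ r ∈ S, ω (‖vec r‖ / X) with hU
  set V := ∑ r ∈ S, ω (‖vec r‖ / X) * T r with hV
  set z : ℝ := if n = 0 then 1 else 0 with hz
  calc |W * (cst ω / Q) * (V - 2 * P) - z| =
      |W * (cst ω / Q * (V - U)) + (W * (cst ω / Q) * (U - 2 * P) - z)| := by ring_nf
    _ ≤ |W * (cst ω / Q * (V - U))| + |W * (cst ω / Q) * (U - 2 * P) - z| := abs_add_le _ _
    _ ≤ B' * (cst ω * (9 * (B * A)) / Q ^ N) + E / Q ^ N := by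
      rw [abs_mul W, abs_of_nonneg hW0]
      exact add_le_add (mul_le_mul (hB' _) hsum (abs_nonneg _) hB'0) hmain
    _ = _ := by ring

end Weights

/-! ### The combined kernel -/

/-- The total weight attached to the point `a/q + w`: the kernel `p_{1,q}` together with all
kernels `p_{2,r,k,q}` that occur at the fraction `a/q`. A vector `r` and a modulus `q` determine
`d = gcd(q, l)` and `k = l/d`, where `l` is the greatest common divisor of the coordinates
of `r`. -/
noncomputable def kernel (ω₀ ω : ℝ → ℝ) (Q : ℝ) (q : ℕ) (a : Fin 2 → ℕ) (w : Plane) : ℂ :=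
  p1 ω₀ ω Q q w + ∑ r ∈ (shell ω Q).filter (fun r => (q : ℤ) ∣ wedge r a),
    (ω (‖vec r‖ / Q ^ (1 / 2 : ℝ)) : ℂ) *
      p2 ω₀ ω Q r (content r / Nat.gcd q (content r)) q w

theorem one_le_div_gcd {q l : ℕ} (hl : 0 < l) : 1 ≤ l / Nat.gcd q l :=
  Nat.div_pos (Nat.le_of_dvd hl (Nat.gcd_dvd_right _ _)) (Nat.gcd_pos_of_pos_right _ hl)

namespace Weights

variable {ω₀ ω : ℝ → ℝ} (hω : Weights ω₀ ω)
include hω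

theorem integrable_p2_of_mem_shell {Q : ℝ} (hQ : 1 ≤ Q) {r : Fin 2 → ℤ} (hr : r ∈ shell ω Q)
    {q : ℕ} (hq : 1 ≤ q) :
    Integrable (p2 ω₀ ω Q r (content r / Nat.gcd q (content r)) q) :=
  hω.integrable_p2 hQ (hω.half_le_of_mem_shell (by linarith) hr) (le_of_mem_shell hr)
    (one_le_div_gcd (exists_primitive (hω.ne_zero_of_mem_shell (by linarith) hr)).1) hq

theorem integrable_kernel {Q : ℝ} (hQ : 1 ≤ Q) {q : ℕ} (hq : 1 ≤ q) (a : Fin 2 → ℕ) :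
    Integrable (kernel ω₀ ω Q q a) :=
  (hω.integrable_p1 hQ hq).add (integrable_finsetSum _ fun _ hr =>
    (hω.integrable_p2_of_mem_shell hQ (Finset.mem_filter.1 hr).1 hq).const_mul _)

/-- The integral of the combined kernel over a set, split into its constituents. -/
theorem setIntegral_kernel {Q : ℝ} (hQ : 1 ≤ Q) {q : ℕ} (hq : 1 ≤ q) (n : Fin 2 → ℤ)
    (a : Fin 2 → ℕ) (s : Set Plane) : ∫ w in s, kernel ω₀ ω Q q a w * phase n q a w =
      (∫ w in s, p1 ω₀ ω Q q w * phase n q a w) +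
      ∑ r ∈ (shell ω Q).filter (fun r => (q : ℤ) ∣ wedge r a),
        (ω (‖vec r‖ / Q ^ (1 / 2 : ℝ)) : ℂ) *
          ∫ w in s, p2 ω₀ ω Q r (content r / Nat.gcd q (content r)) q w * phase n q a w := by
  have h2 : ∀ r ∈ (shell ω Q).filter (fun r => (q : ℤ) ∣ wedge r a), Integrable (fun w =>
      (ω (‖vec r‖ / Q ^ (1 / 2 : ℝ)) : ℂ) *
        (p2 ω₀ ω Q r (content r / Nat.gcd q (content r)) q w * phase n q a w)) := fun r hr =>
    (integrable_mul_phase (hω.integrable_p2_of_mem_shell hQ (Finset.mem_filter.1 hr).1 hq)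
      n q a).const_mul _
  simp only [kernel, add_mul, Finset.sum_mul, mul_assoc]
  rw [integral_add (integrable_mul_phase (hω.integrable_p1 hQ hq) n q a).integrableOn
    (integrable_finsetSum _ fun r hr => (h2 r hr).integrableOn),
    integral_finsetSum _ fun r hr => (h2 r hr).integrableOn]
  simp only [integral_const_mul]

theorem sum_integral_kernel {Q : ℝ} (hQ : 1 ≤ Q) (n : Fin 2 → ℤ) :
    ∑ q ∈ Finset.Icc 1 ⌊Q⌋₊, ∑ a ∈ reduced q, ∫ w, kernel ω₀ ω Q q a w * phase n q a w =
      synthesis ω₀ ω Q n := by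
  rw [synthesis]
  refine Finset.sum_congr rfl fun q hq => Finset.sum_congr rfl fun a _ => ?_
  have hq1 : 1 ≤ q := (Finset.mem_Icc.1 hq).1
  have h1 := hω.setIntegral_kernel hQ hq1 n a Set.univ
  simp only [Measure.restrict_univ] at h1
  rw [h1, hω.integral_p1_mul_phase hQ hq1, mul_add, Finset.mul_sum]
  congr 1
  refine Finset.sum_congr rfl fun r hr => ?_
  have hr' := (Finset.mem_filter.1 hr).1
  rw [hω.integral_p2_mul_phase hQ (hω.half_le_of_mem_shell (by linarith) hr') (le_of_mem_shell hr')
    (one_le_div_gcd (exists_primitive (hω.ne_zero_of_mem_shell (by linarith) hr')).1) hq1]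
  ring

/-- For `kq > Q` the function `h(kq/Q, ·)` vanishes on the range of integration. -/
theorem p2_eq_zero {Q : ℝ} (hQ : 0 < Q) {r : Fin 2 → ℤ} (hr : ‖vec r‖ ≤ Q ^ (1 / 2 : ℝ))
    {k q : ℕ} (hkq : Q < k * q) (w : Plane) : p2 ω₀ ω Q r k q w = 0 := by
  have h1 : ∀ x, physical₂ ω₀ ω Q r k q x = 0 := by
    intro x
    rw [physical₂]
    by_cases hx : ω₀ (‖x‖ / Q ^ (3 / 2 : ℝ)) = 0
    · simp [hx]
    · have h2 : (0 : ℝ) < k * q := by linarith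
      rw [hω.h_eq_sum (by positivity) (hω.abs_inner_div_le hQ hr hx), Nat.floor_eq_zero.2 ?_]
      · simp
      · rw [one_div_div, div_lt_one h2]
        exact hkq
  rw [← fourier_physical₂, fourier_eq_integral]
  simp [h1]

/-- The parametrisation `r = dkc` of the second minor arc term in terms of `r` and `q`. -/
theorem E2_eq {Q : ℝ} (hQ : 1 ≤ Q) (δ : ℝ) (n : Fin 2 → ℤ) : E2 ω₀ ω Q δ n =
    ∑ q ∈ Finset.Icc 1 ⌊Q⌋₊, ∑ a ∈ reduced q,
      ∑ r ∈ (shell ω Q).filter (fun r => (q : ℤ) ∣ wedge r a),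
        (ω (‖vec r‖ / Q ^ (1 / 2 : ℝ)) : ℂ) * ∫ w in minorArc Q δ q,
          p2 ω₀ ω Q r (content r / Nat.gcd q (content r)) q w * phase n q a w := by
  classical
  have hQ0 : 0 < Q := by linarith
  set I : (Fin 2 → ℤ) → ℕ → ℕ → (Fin 2 → ℕ) → ℂ := fun r k q a =>
    ∫ w in minorArc Q δ q, p2 ω₀ ω Q r k q w * phase n q a w with hI
  set G : (Fin 2 → ℤ) → ℕ → ℂ := fun r q => ∑ a ∈ (reduced q).filter
    (fun a => (q : ℤ) ∣ wedge r a), I r (content r / Nat.gcd q (content r)) q a with hG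
  set H : (Fin 2 → ℤ) × ℕ → ℂ := fun x => (ω (‖vec x.1‖ / Q ^ (1 / 2 : ℝ)) : ℂ) *
    ∑ q ∈ Finset.Icc 1 ⌊Q⌋₊, if Nat.gcd q (content x.1) = x.2 then G x.1 q else 0 with hH
  set g : ℕ+ × ℕ+ × Primitive → (Fin 2 → ℤ) × ℕ := fun t =>
    (fun i => (t.1 : ℤ) * t.2.1 * (t.2.2 : Fin 2 → ℤ) i, (t.1 : ℕ)) with hg
  have hcontent : ∀ t, content (g t).1 = t.1 * t.2.1 := by
    intro t
    have h1 := content_mul (l := (t.1 : ℕ) * t.2.1) t.2.2.2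
    push_cast at h1
    exact h1
  have hginj : Function.Injective g := by
    intro t t' htt
    have h1 : (t.1 : ℕ) = t'.1 := congrArg Prod.snd htt
    have h2 : (t.1 : ℕ) * t.2.1 = t'.1 * t'.2.1 := by
      rw [← hcontent, ← hcontent, htt]
    have h3 : (t.2.1 : ℕ) = t'.2.1 := by
      rw [← h1] at h2
      exact Nat.eq_of_mul_eq_mul_left t.1.pos h2
    have h4 : ∀ i, (t.2.2 : Fin 2 → ℤ) i = (t'.2.2 : Fin 2 → ℤ) i := by
      intro i
      have h5 : (t.1 : ℤ) * t.2.1 * (t.2.2 : Fin 2 → ℤ) i =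
        (t'.1 : ℤ) * t'.2.1 * (t'.2.2 : Fin 2 → ℤ) i := congrFun (congrArg Prod.fst htt) i
      have h6 : ((t.1 : ℕ) : ℤ) * (t.2.1 : ℕ) ≠ 0 := by
        have := t.1.pos
        have := t.2.1.pos
        positivity
      rw [← h1, ← h3] at h5
      exact mul_left_cancel₀ h6 h5
    exact Prod.ext (PNat.eq h1) (Prod.ext (PNat.eq h3) (Subtype.ext (funext h4)))
  have hsupp : Function.support H ⊆ Set.range g := by
    rintro ⟨r, d⟩ hrd
    have h1 := Function.mem_support.1 hrd
    rw [hH] at h1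
    simp only at h1
    have h2 : r ∈ shell ω Q := (hω.mem_shell hQ0).2 fun h =>
      h1 (by rw [h, Complex.ofReal_zero, zero_mul])
    obtain ⟨q, hq, hq'⟩ := Finset.exists_ne_zero_of_sum_ne_zero (right_ne_zero_of_mul h1)
    have h3 : Nat.gcd q (content r) = d := by
      by_contra h
      exact hq' (if_neg h)
    obtain ⟨hl, c, hc, hrc⟩ := exists_primitive (hω.ne_zero_of_mem_shell hQ0 h2)
    have hd : d ∣ content r := h3 ▸ Nat.gcd_dvd_right _ _
    have hd0 : 0 < d := Nat.pos_of_dvd_of_pos hd hl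
    refine ⟨(⟨d, hd0⟩, ⟨content r / d, Nat.div_pos (Nat.le_of_dvd hl hd) hd0⟩, ⟨c, hc⟩), ?_⟩
    refine Prod.ext (funext fun i => ?_) rfl
    rw [hg]
    simp only [PNat.mk_coe]
    rw [hrc i, ← Nat.cast_mul, Nat.mul_div_cancel' hd]
  have hterm : ∀ t : ℕ+ × ℕ+ × Primitive, (ω (‖vec (g t).1‖ / Q ^ (1 / 2 : ℝ)) : ℂ) *
      ∑ q ∈ (Finset.Icc 1 ⌊Q / (t.2.1 : ℕ)⌋₊).filter
          (fun q => (t.1 : ℕ) ∣ q ∧ Nat.gcd (q / t.1) t.2.1 = 1),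
        ∑ a ∈ (reduced q).filter
            (fun a => (q : ℤ) ∣ (t.1 : ℤ) * ((t.2.2 : Fin 2 → ℤ) 0 * (a 1 : ℤ) -
              (t.2.2 : Fin 2 → ℤ) 1 * (a 0 : ℤ))), I (g t).1 t.2.1 q a = H (g t) := by
    intro t
    rw [hH]
    simp only
    by_cases hr : (g t).1 ∈ shell ω Q
    swap
    · rw [hω.mem_shell hQ0, not_not] at hr
      rw [hr, Complex.ofReal_zero, zero_mul, zero_mul]
    congr 1
    obtain ⟨d, k, c⟩ := t
    have hk0 : 0 < (k : ℕ) := k.pos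
    have hd0 : 0 < (d : ℕ) := d.pos
    have hkr : (0 : ℝ) < (k : ℕ) := by exact_mod_cast hk0
    rw [hcontent]
    simp only
    have hgcd : ∀ q : ℕ, ((d : ℕ) ∣ q ∧ Nat.gcd (q / d) k = 1) ↔ Nat.gcd q (d * k) = d := by
      intro q
      constructor
      · rintro ⟨⟨m, rfl⟩, h1⟩
        rw [Nat.mul_div_cancel_left _ hd0] at h1
        rw [Nat.gcd_mul_left, h1, mul_one]
      · intro h1
        have h2 : (d : ℕ) ∣ q := h1 ▸ Nat.gcd_dvd_left q (d * k)
        obtain ⟨m, rfl⟩ := h2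
        rw [Nat.gcd_mul_left] at h1
        refine ⟨dvd_mul_right _ _, ?_⟩
        rw [Nat.mul_div_cancel_left _ hd0]
        exact Nat.eq_of_mul_eq_mul_left hd0 (h1.trans (mul_one _).symm)
    simp only [hgcd]
    rw [← Finset.sum_filter]
    -- The moduli with `kq > Q` may be added, their kernels vanish.
    have hsub : (Finset.Icc 1 ⌊Q / (k : ℕ)⌋₊).filter (fun q => Nat.gcd q (d * k) = d) ⊆
        (Finset.Icc 1 ⌊Q⌋₊).filter (fun q => Nat.gcd q (d * k) = d) := by
      refine Finset.filter_subset_filter _ (Finset.Icc_subset_Icc_right (Nat.floor_le_floor ?_))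
      exact div_le_self hQ0.le (by exact_mod_cast hk0)
    have hGeq : ∀ q, Nat.gcd q (d * k) = d → G (g (d, k, c)).1 q =
        ∑ a ∈ (reduced q).filter
            (fun a => (q : ℤ) ∣ (d : ℤ) * ((c : Fin 2 → ℤ) 0 * (a 1 : ℤ) -
              (c : Fin 2 → ℤ) 1 * (a 0 : ℤ))), I (g (d, k, c)).1 k q a := by
      intro q hq
      rw [hG]
      simp only
      rw [hcontent]
      simp only
      rw [hq, Nat.mul_div_cancel_left _ hd0]
      refine Finset.sum_congr (Finset.filter_congr fun a _ => ?_) fun _ _ => rfl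
      obtain ⟨⟨m, rfl⟩, h1⟩ := (hgcd q).2 hq
      rw [Nat.mul_div_cancel_left _ hd0] at h1
      have hdz : ((d : ℕ) : ℤ) ≠ 0 := by exact_mod_cast hd0.ne'
      have h2 : wedge (g (d, k, c)).1 a = (d : ℕ) * ((k : ℕ) * ((c : Fin 2 → ℤ) 0 * (a 1 : ℤ) -
              (c : Fin 2 → ℤ) 1 * (a 0 : ℤ))) := by
        rw [wedge, hg]
        ring
      rw [h2, Nat.cast_mul, mul_dvd_mul_iff_left hdz, mul_dvd_mul_iff_left hdz]
      have h3 : IsCoprime (m : ℤ) (k : ℕ) := Nat.isCoprime_iff_coprime.2 h1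
      exact ⟨fun h => h3.dvd_of_dvd_mul_left h, fun h => h.mul_left _⟩
    rw [← Finset.sum_subset hsub fun q hq hq' => ?_]
    · refine Finset.sum_congr rfl fun q hq => ?_
      rw [hGeq q (Finset.mem_filter.1 hq).2]
    · obtain ⟨hq1, hq2⟩ := Finset.mem_filter.1 hq
      rw [hGeq q hq2]
      have hbig : Q < (k : ℕ) * q := by
        by_contra hle
        push Not at hle
        refine hq' (Finset.mem_filter.2 ⟨Finset.mem_Icc.2 ⟨(Finset.mem_Icc.1 hq1).1,
          Nat.le_floor ?_⟩, hq2⟩)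
        rwa [le_div_iff₀' hkr]
      refine Finset.sum_eq_zero fun a _ => ?_
      rw [hI]
      simp [hω.p2_eq_zero hQ0 (le_of_mem_shell hr) hbig]
  have hE2 : E2 ω₀ ω Q δ n = ∑' t, H (g t) := by
    rw [E2]
    exact tsum_congr hterm
  rw [hE2, hginj.tsum_eq hsupp]
  rw [tsum_eq_sum (s := shell ω Q ×ˢ Finset.Icc 1 ⌊Q⌋₊) ?_, Finset.sum_product]
  · have h1 : ∀ r ∈ shell ω Q, ∑ d ∈ Finset.Icc 1 ⌊Q⌋₊, H (r, d) =
        (ω (‖vec r‖ / Q ^ (1 / 2 : ℝ)) : ℂ) * ∑ q ∈ Finset.Icc 1 ⌊Q⌋₊, G r q := by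
      intro r _
      rw [hH]
      simp only
      rw [← Finset.mul_sum, Finset.sum_comm]
      congr 1
      refine Finset.sum_congr rfl fun q hq => ?_
      rw [Finset.sum_ite_eq, if_pos]
      obtain ⟨hq1, hq2⟩ := Finset.mem_Icc.1 hq
      exact Finset.mem_Icc.2 ⟨Nat.gcd_pos_of_pos_left _ hq1,
        (Nat.le_of_dvd hq1 (Nat.gcd_dvd_left _ _)).trans hq2⟩
    rw [Finset.sum_congr rfl h1]
    simp only [hG, Finset.mul_sum]
    rw [Finset.sum_comm]
    refine Finset.sum_congr rfl fun q _ => ?_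
    simp only [Finset.sum_filter]
    rw [Finset.sum_comm]
  · rintro ⟨r, d⟩ hrd
    by_contra hne
    rw [hH] at hne
    simp only at hne
    have h2 : r ∈ shell ω Q := (hω.mem_shell hQ0).2 fun h =>
      hne (by rw [h, Complex.ofReal_zero, zero_mul])
    obtain ⟨q, hq, hq'⟩ := Finset.exists_ne_zero_of_sum_ne_zero (right_ne_zero_of_mul hne)
    have h3 : Nat.gcd q (content r) = d := by
      by_contra h
      exact hq' (if_neg h)
    obtain ⟨hq1, hq2⟩ := Finset.mem_Icc.1 hq
    refine hrd (Finset.mem_product.2 ⟨h2, Finset.mem_Icc.2 ⟨?_, ?_⟩⟩)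
    · exact h3 ▸ Nat.gcd_pos_of_pos_left _ hq1
    · exact h3 ▸ (Nat.le_of_dvd hq1 (Nat.gcd_dvd_left _ _)).trans hq2

/-- The two minor arc terms are the integral of the combined kernel over the minor arcs. -/
theorem E1_add_E2 {Q : ℝ} (hQ : 1 ≤ Q) (δ : ℝ) (n : Fin 2 → ℤ) :
    E1 ω₀ ω Q δ n + E2 ω₀ ω Q δ n = ∑ q ∈ Finset.Icc 1 ⌊Q⌋₊, ∑ a ∈ reduced q,
      ∫ w in minorArc Q δ q, kernel ω₀ ω Q q a w * phase n q a w := by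
  rw [hω.E2_eq hQ, E1, ← Finset.sum_add_distrib]
  refine Finset.sum_congr rfl fun q hq => ?_
  rw [← Finset.sum_add_distrib]
  refine Finset.sum_congr rfl fun a _ => ?_
  rw [hω.setIntegral_kernel hQ (Finset.mem_Icc.1 hq).1]

end Weights

/-! ### The combined kernel near and away from the fractions -/

namespace Weights

variable {ω₀ ω : ℝ → ℝ} (hω : Weights ω₀ ω)
include hω

theorem exists_norm_kernel_le (N : ℕ) : ∃ C, 0 ≤ C ∧ ∀ Q : ℝ, 1 ≤ Q → ∀ q : ℕ, 1 ≤ q →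
    ∀ (a : Fin 2 → ℕ) (w : Plane), ‖kernel ω₀ ω Q q a w‖ ≤
      C * Q * (1 / (1 + ‖w‖ * q * Q ^ (1 / 2 : ℝ)) ^ N) := by
  obtain ⟨C₁, hC₁, h1⟩ := hω.exists_norm_p1_le N
  obtain ⟨C₂, hC₂, h2⟩ := hω.exists_norm_p2_le N
  obtain ⟨B, hB0, hB⟩ := hω.exists_bound
  refine ⟨C₁ + 9 * (B * C₂), by positivity, fun Q hQ q hq a w => ?_⟩
  have hQ0 : 0 < Q := by linarith
  have hq' : (1 : ℝ) ≤ q := by exact_mod_cast hq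
  set D : ℝ := 1 / (1 + ‖w‖ * q * Q ^ (1 / 2 : ℝ)) ^ N with hD
  have hD0 : 0 ≤ D := by positivity
  have e1 : ‖p1 ω₀ ω Q q w‖ ≤ C₁ * (Q * D) := by
    refine (h1 Q hQ q hq w).trans ?_
    have : Q / (q * (1 + ‖w‖ * Q ^ (3 / 2 : ℝ))) ≤ Q := by
      apply div_le_self hQ0.le
      have : 0 ≤ ‖w‖ * Q ^ (3 / 2 : ℝ) := by positivity
      nlinarith
    gcongr
  have e2 : ∀ r ∈ (shell ω Q).filter (fun r => (q : ℤ) ∣ wedge r a),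
      ‖(ω (‖vec r‖ / Q ^ (1 / 2 : ℝ)) : ℂ) *
        p2 ω₀ ω Q r (content r / Nat.gcd q (content r)) q w‖ ≤ B * (C₂ * D) := by
    intro r hr
    have hr' := (Finset.mem_filter.1 hr).1
    have hk := one_le_div_gcd (q := q)
      (exists_primitive (hω.ne_zero_of_mem_shell hQ0 hr')).1
    set k := content r / Nat.gcd q (content r)
    have hk' : (1 : ℝ) ≤ k := by exact_mod_cast hk
    rw [norm_mul, Complex.norm_real, Real.norm_of_nonneg (hω.nonneg _)]
    refine mul_le_mul (hB _) ?_ (norm_nonneg _) hB0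
    refine (h2 Q hQ0 r (hω.half_le_of_mem_shell hQ0 hr') (le_of_mem_shell hr') k q hk hq w).trans ?_
    have h3 : ‖w‖ * q * Q ^ (1 / 2 : ℝ) ≤ ‖w‖ * k * q * Q ^ (1 / 2 : ℝ) := by
      have : ‖w‖ * 1 ≤ ‖w‖ * k := by gcongr
      rw [mul_one] at this
      gcongr
    have h4 : 0 ≤ |inner ℝ w (perp (vec r))| * Q := by positivity
    have h5 : 1 + ‖w‖ * q * Q ^ (1 / 2 : ℝ) ≤
        1 + ‖w‖ * k * q * Q ^ (1 / 2 : ℝ) + |inner ℝ w (perp (vec r))| * Q := by linarith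
    rw [hD]
    gcongr
  have e3 := norm_sum_le_of_le _ e2
  rw [Finset.sum_const, nsmul_eq_mul] at e3
  have hcard : ((((shell ω Q).filter (fun r => (q : ℤ) ∣ wedge r a)).card : ℕ) : ℝ) ≤ 9 * Q :=
    le_trans (by exact_mod_cast Finset.card_filter_le _ _) (card_shell_le hQ)
  calc ‖kernel ω₀ ω Q q a w‖ ≤ C₁ * (Q * D) + (9 * Q) * (B * (C₂ * D)) :=
        (norm_add_le _ _).trans (add_le_add e1 (e3.trans (by gcongr)))
    _ = _ := by ring

/-- Close to a fraction with small denominator the combined kernel is nearly `1`: the deviation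
of `p_{1,q}` from `1` cancels against the main term of the sum over `r`. -/
theorem exists_norm_kernel_sub_one_le (N : ℕ) : ∃ C, 0 ≤ C ∧ ∀ Q : ℝ, 1 ≤ Q → ∀ z : ℝ, 1 ≤ z →
    ∀ q : ℕ, 1 ≤ q → q * z ≤ Q ^ (1 / 2 : ℝ) → ∀ a ∈ reduced q, ∀ w : Plane,
      ‖w‖ * (q * (Q * z)) ≤ 1 → ‖kernel ω₀ ω Q q a w - 1‖ ≤ C * Q / z ^ N := by
  obtain ⟨C₀, hC₀, h0⟩ := hω.exists_norm_kernel_le 0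
  obtain ⟨C₁, hC₁, h1⟩ := hω.exists_norm_p1_sub_le N
  obtain ⟨C₂, hC₂, h2⟩ := hω.exists_norm_p2_sub_le N
  obtain ⟨C₃, hC₃, h3⟩ := hω.exists_norm_fourier_star_le 4
  obtain ⟨C₄, hC₄, h4⟩ := hω.exists_norm_fourier_star_le (N + 4)
  have hcst := hω.cst_pos
  have hlat := latticeConst_nonneg
  refine ⟨(C₀ + 1) * 4 ^ N + (C₁ + 9 * C₂ + cst ω * (latticeConst * (C₄ * 4 ^ (N + 4)))),
    by positivity, fun Q hQ z hz q hq hqz a ha w hw => ?_⟩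
  have hQ0 : 0 < Q := by linarith
  have hz0 : 0 < z := by linarith
  have hq' : (1 : ℝ) ≤ q := by exact_mod_cast hq
  have hq0 : (0 : ℝ) < q := by linarith
  rcases lt_or_ge z 4 with hz4 | hz4
  · -- For bounded `z` the trivial estimate suffices.
    have e1 := h0 Q hQ q hq a w
    rw [pow_zero, div_one, mul_one] at e1
    have e2 : ‖kernel ω₀ ω Q q a w - 1‖ ≤ (C₀ + 1) * Q := by
      refine (norm_sub_le _ _).trans ?_
      rw [norm_one]
      linarith
    have e3 : z ^ N ≤ 4 ^ N := by gcongr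
    rw [le_div_iff₀ (by positivity)]
    calc ‖kernel ω₀ ω Q q a w - 1‖ * z ^ N ≤ (C₀ + 1) * Q * 4 ^ N := by gcongr
      _ = (C₀ + 1) * 4 ^ N * Q := by ring
      _ ≤ _ := by
        apply mul_le_mul_of_nonneg_right _ hQ0.le
        linarith [show 0 ≤ C₁ + 9 * C₂ + cst ω * (latticeConst * (C₄ * 4 ^ (N + 4))) by positivity]
  set X := Q ^ (1 / 2 : ℝ) with hX
  have hX1 : 1 ≤ X := Real.one_le_rpow hQ (by norm_num)
  have hX0 : 0 < X := by linarith
  have hX2 : X ^ 2 = Q := rpow_half_sq hQ0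
  have hXQ : X ≤ Q := by nlinarith
  set W : Plane := Q ^ (3 / 2 : ℝ) • w with hW
  have hWn : ‖W‖ * (q * z) ≤ X := by
    rw [hW, norm_smul, Real.norm_of_nonneg (by positivity), rpow_three_halves hQ0, ← hX]
    calc Q * X * ‖w‖ * (q * z) = X * (‖w‖ * (q * (Q * z))) := by ring
      _ ≤ X * 1 := by gcongr
      _ = X := mul_one X
  have hWq : 4 * (‖W‖ * q) ≤ X := by
    have : ‖W‖ * q * 4 ≤ ‖W‖ * q * z := by gcongr
    linarith [mul_assoc ‖W‖ (q : ℝ) z]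
  have hW0 := norm_nonneg W
  have e1 := h1 Q hQ0 q hq w (by
    rw [← hW, le_div_iff₀ hq0]
    nlinarith)
  rw [← hW] at e1
  set G : ℂ := 𝓕 (ray ω₀ ω W) 0 with hG
  have hz1 : (q : ℝ) / Q ≤ 1 / z := by
    rw [div_le_div_iff₀ hQ0 hz0]
    linarith
  have hpow : ∀ t : ℝ, 0 ≤ t → t ≤ 1 / z → t ^ (N + 1) ≤ 1 / z ^ N := by
    intro t ht0 ht
    have ht1 : t ≤ 1 := ht.trans (by rw [div_le_one hz0]; exact hz)
    calc t ^ (N + 1) ≤ t ^ N := pow_le_pow_of_le_one ht0 ht1 (by omega)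
      _ ≤ (1 / z) ^ N := by gcongr
      _ = 1 / z ^ N := by rw [div_pow, one_pow]
  have e1' : ‖p1 ω₀ ω Q q w - (1 - (cst ω * (Q / q) : ℝ) * G)‖ ≤ C₁ * Q * (1 / z ^ N) := by
    refine e1.trans ?_
    have := hpow (q / Q) (by positivity) hz1
    have h5 : C₁ * 1 ≤ C₁ * Q := by gcongr
    calc C₁ * (q / Q) ^ (N + 1) ≤ C₁ * (1 / z ^ N) := by gcongr
      _ ≤ _ := by
        refine mul_le_mul_of_nonneg_right ?_ (by positivity)
        linarith
  set S := (shell ω Q).filter (fun r => (q : ℤ) ∣ wedge r a) with hS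
  have hcard : ((S.card : ℕ) : ℝ) ≤ 9 * Q :=
    le_trans (by exact_mod_cast Finset.card_filter_le _ _) (card_shell_le hQ)
  have e2 : ∀ r ∈ S, ‖(ω (‖vec r‖ / X) : ℂ) *
      p2 ω₀ ω Q r (content r / Nat.gcd q (content r)) q w - cst ω * star ω₀ ω W (X⁻¹ • vec r)‖ ≤
      C₂ * (1 / z ^ N) := by
    intro r hr
    have hr' := (Finset.mem_filter.1 hr).1
    have hr0 := hω.ne_zero_of_mem_shell hQ0 hr'
    have hk := one_le_div_gcd (q := q) (exists_primitive hr0).1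
    have hkX : ((content r / Nat.gcd q (content r) : ℕ) : ℝ) ≤ X :=
      le_trans (by exact_mod_cast Nat.div_le_self _ _)
        ((content_le_norm hr0).trans (le_of_mem_shell hr'))
    set k := content r / Nat.gcd q (content r)
    have hk0 : (0 : ℝ) < k := by exact_mod_cast hk
    refine (h2 Q hQ0 r (hω.half_le_of_mem_shell hQ0 hr') (le_of_mem_shell hr') k q hk hq w
      ?_).trans ?_
    · rw [← hW, ← mul_div_assoc, div_le_one hQ0]
      calc 4 * ‖W‖ * (k * q) = 4 * (‖W‖ * q) * k := by ring
        _ ≤ X * X := mul_le_mul hWq hkX hk0.le hX0.le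
        _ = Q := by rw [← sq, hX2]
    · refine mul_le_mul_of_nonneg_left (hpow _ (by positivity) ?_) hC₂
      rw [div_le_div_iff₀ hQ0 hz0]
      calc (k : ℝ) * q * z = k * (q * z) := by ring
        _ ≤ X * X := mul_le_mul hkX hqz (by positivity) hX0.le
        _ = 1 * Q := by rw [← sq, hX2, one_mul]
  have e2' := norm_sum_le_of_le _ e2
  rw [Finset.sum_const, nsmul_eq_mul, Finset.sum_sub_distrib, ← Finset.mul_sum] at e2'
  have e3 := norm_lattice_sum_sub_le (hω.continuous_star W) (R := 1)
    (fun x hx => hω.star_eq_zero W hx) (K₀ := C₃ * (1 + ‖W‖) ^ 4) (fun ξ => (h3 W ξ).1) hX0 hq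
    (N := N) (K := C₄) (fun ξ hξ => by
      rw [div_le_iff₀ hq0] at hξ
      have hξ0 : 0 < ‖ξ‖ := by
        by_contra h
        have : ‖ξ‖ * q ≤ 0 := mul_nonpos_of_nonpos_of_nonneg (not_lt.1 h) hq0.le
        linarith
      refine ((h4 W ξ).2 ?_).trans ?_
      · have : 4 * ‖W‖ * q ≤ ‖ξ‖ * q := by linarith
        have := le_of_mul_le_mul_right this hq0
        linarith
      · gcongr
        linarith) ha
  -- The function `T` vanishes at `r/Q^{1/2}` unless `r` belongs to the finite set of summation.
  have htsum : ∑' r : Fin 2 → ℤ, (if (q : ℤ) ∣ wedge r a then star ω₀ ω W (X⁻¹ • vec r) else 0) =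
      ∑ r ∈ S, star ω₀ ω W (X⁻¹ • vec r) := by
    rw [tsum_eq_sum (s := shell ω Q) fun r hr => ?_, hS, Finset.sum_filter]
    rw [hω.mem_shell hQ0, not_not] at hr
    have : radial ω (X⁻¹ • vec r) = 0 := by
      rw [radial, norm_smul, Real.norm_of_nonneg (by positivity), inv_mul_eq_div, hr,
        Complex.ofReal_zero]
    simp [star, this]
  rw [htsum, hω.fourier_star_zero, hX2, ← hG] at e3
  set T : ℂ := ∑ r ∈ S, star ω₀ ω W (X⁻¹ • vec r) with hT
  have e3' : ‖(cst ω : ℂ) * (T - (Q / q : ℝ) * G)‖ ≤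
      cst ω * (latticeConst * (C₄ * 4 ^ (N + 4))) * Q * (1 / z ^ N) := by
    rw [norm_mul, Complex.norm_real, Real.norm_of_nonneg hcst.le]
    have h5 : (4 * q / X) ^ (N + 4) ≤ 4 ^ (N + 4) * (1 / z ^ N) := by
      have h6 : (q : ℝ) / X ≤ 1 / z := by
        rw [div_le_div_iff₀ hX0 hz0]
        linarith
      have h7 := hpow _ (by positivity) h6
      have h8 : (q / X) ^ (N + 4) ≤ (q / X) ^ (N + 1) :=
        pow_le_pow_of_le_one (by positivity) (h6.trans (by rw [div_le_one hz0]; exact hz))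
          (by omega)
      rw [mul_div_assoc, mul_pow]
      gcongr
      exact h8.trans h7
    calc cst ω * ‖T - (Q / q : ℝ) * G‖ ≤
        cst ω * (Q * (latticeConst * (C₄ * (4 ^ (N + 4) * (1 / z ^ N))))) := by
          refine mul_le_mul_of_nonneg_left (e3.trans ?_) hcst.le
          gcongr
      _ = _ := by ring
  set P : ℂ := ∑ r ∈ S, (ω (‖vec r‖ / X) : ℂ) *
    p2 ω₀ ω Q r (content r / Nat.gcd q (content r)) q w with hP
  have hsplit : kernel ω₀ ω Q q a w - 1 =
      (p1 ω₀ ω Q q w - (1 - (cst ω * (Q / q) : ℝ) * G)) + (P - cst ω * T) +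
        (cst ω : ℂ) * (T - (Q / q : ℝ) * G) := by
    rw [kernel]
    push_cast
    ring
  rw [hsplit]
  refine norm_add₃_le.trans ?_
  calc _ ≤ C₁ * Q * (1 / z ^ N) + 9 * Q * (C₂ * (1 / z ^ N)) +
        cst ω * (latticeConst * (C₄ * 4 ^ (N + 4))) * Q * (1 / z ^ N) :=
        add_le_add (add_le_add e1' (e2'.trans (by gcongr))) e3'
    _ = (C₁ + 9 * C₂ + cst ω * (latticeConst * (C₄ * 4 ^ (N + 4)))) * (Q / z ^ N) := by ring
    _ ≤ ((C₀ + 1) * 4 ^ N + (C₁ + 9 * C₂ + cst ω * (latticeConst * (C₄ * 4 ^ (N + 4))))) *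
        (Q / z ^ N) := by
      refine mul_le_mul_of_nonneg_right ?_ (by positivity)
      linarith [show 0 ≤ (C₀ + 1) * 4 ^ N by positivity]
    _ = _ := by ring

/-- The contribution of the points far from the fraction `a/q` is negligible. -/
theorem exists_norm_integral_tail_le (N : ℕ) : ∃ C, 0 ≤ C ∧ ∀ Q : ℝ, 1 ≤ Q → ∀ z : ℝ, 1 ≤ z →
    ∀ q : ℕ, 1 ≤ q → ∀ (a : Fin 2 → ℕ) (n : Fin 2 → ℤ) (s : Set Plane), MeasurableSet s →
      (∀ w ∈ s, z ≤ ‖w‖ * q * Q ^ (1 / 2 : ℝ)) →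
      ‖∫ w in s, kernel ω₀ ω Q q a w * phase n q a w‖ ≤ C * Q / z ^ N := by
  -- Three of the `N + 3` powers of decay make the integral converge, the others give `z⁻ᴺ`.
  obtain ⟨C, hC0, hC⟩ := hω.exists_norm_kernel_le (N + 3)
  have hint : Integrable fun w : Plane => (1 + ‖w‖) ^ (-(3 : ℝ)) :=
    integrable_one_add_norm (by rw [finrank_euclideanSpace, Fintype.card_fin]; norm_num)
  refine ⟨C * ∫ w : Plane, (1 + ‖w‖) ^ (-(3 : ℝ)), by positivity,
    fun Q hQ z hz q hq a n s hs hsz => ?_⟩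
  have hQ0 : 0 < Q := by linarith
  have hz0 : 0 < z := by linarith
  have hq' : (1 : ℝ) ≤ q := by exact_mod_cast hq
  have hY : 1 ≤ Q ^ (1 / 2 : ℝ) := Real.one_le_rpow hQ (by norm_num)
  have hbound : ∀ w ∈ s, ‖kernel ω₀ ω Q q a w * phase n q a w‖ ≤
      C * Q / z ^ N * (1 + ‖w‖) ^ (-(3 : ℝ)) := by
    intro w hw
    rw [norm_mul, norm_phase, mul_one]
    refine (hC Q hQ q hq a w).trans ?_
    have h1 := hsz w hw
    have h2 : ‖w‖ ≤ ‖w‖ * q * Q ^ (1 / 2 : ℝ) := by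
      have := mul_le_mul hq' hY zero_le_one (by linarith)
      rw [mul_assoc]
      nlinarith [norm_nonneg w]
    set t := ‖w‖ * q * Q ^ (1 / 2 : ℝ) with ht
    have h3 : z ^ N * (1 + ‖w‖) ^ 3 ≤ (1 + t) ^ (N + 3) := by
      rw [pow_add]
      gcongr
      linarith
    have h4 : (1 + ‖w‖) ^ (-(3 : ℝ)) = 1 / (1 + ‖w‖) ^ 3 := by
      rw [Real.rpow_neg (by positivity), one_div]
      norm_cast
    calc C * Q * (1 / (1 + t) ^ (N + 3)) ≤ C * Q * (1 / (z ^ N * (1 + ‖w‖) ^ 3)) := by gcongr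
      _ = _ := by rw [h4]; field_simp
  refine (norm_integral_le_of_norm_le ((hint.const_mul (C * Q / z ^ N)).integrableOn (s := s))
    ((ae_restrict_iff' hs).2 (Eventually.of_forall hbound))).trans ?_
  refine (setIntegral_le_integral (hint.const_mul _) (Eventually.of_forall fun w => ?_)).trans ?_
  · simp only [Pi.zero_apply]
    positivity
  · rw [integral_const_mul]
    exact le_of_eq (by ring)

end Weights

/-! ### The delta symbol -/

theorem card_reduced_le {Q : ℝ} {q : ℕ} (hq : (q : ℝ) ≤ Q) : ((reduced q).card : ℝ) ≤ Q ^ 2 := by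
  have h1 : (reduced q).card ≤ q ^ 2 := by
    refine (Finset.card_filter_le _ _).trans ?_
    rw [Fintype.card_piFinset, Finset.prod_const, Finset.card_range, Finset.card_univ,
      Fintype.card_fin]
  calc ((reduced q).card : ℝ) ≤ (q : ℝ) ^ 2 := by exact_mod_cast h1
    _ ≤ Q ^ 2 := by gcongr

/-- The trivial bound for a sum over fractions of denominator at most `Q`. -/
theorem norm_sum_sum_reduced_le {Q : ℝ} (hQ : 0 ≤ Q) {K : ℝ} (hK : 0 ≤ K) {S : Finset ℕ}
    (hS : S ⊆ Finset.Icc 1 ⌊Q⌋₊) {f : ℕ → (Fin 2 → ℕ) → ℂ}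
    (hf : ∀ q ∈ S, ∀ a ∈ reduced q, ‖f q a‖ ≤ K) :
    ‖∑ q ∈ S, ∑ a ∈ reduced q, f q a‖ ≤ Q ^ 3 * K := by
  have h1 : ∀ q ∈ S, ‖∑ a ∈ reduced q, f q a‖ ≤ Q ^ 2 * K := by
    intro q hq
    have h2 := norm_sum_le_of_le _ (hf q hq)
    rw [Finset.sum_const, nsmul_eq_mul] at h2
    refine h2.trans ?_
    have h3 : (q : ℝ) ≤ Q := (Nat.cast_le.2 (Finset.mem_Icc.1 (hS hq)).2).trans (Nat.floor_le hQ)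
    have := card_reduced_le h3
    gcongr
  have h2 := norm_sum_le_of_le _ h1
  rw [Finset.sum_const, nsmul_eq_mul] at h2
  refine h2.trans ?_
  have h3 : (S.card : ℝ) ≤ Q := by
    have h4 := Finset.card_le_card hS
    rw [Nat.card_Icc, Nat.add_sub_cancel] at h4
    exact (Nat.cast_le.2 h4).trans (Nat.floor_le hQ)
  calc (S.card : ℝ) * (Q ^ 2 * K) ≤ Q * (Q ^ 2 * K) := by gcongr
    _ = _ := by ring

/-- The two arcs around a fraction fill a disc. -/
theorem majorArc_union_minorArc {Q δ : ℝ} (hQ : 1 ≤ Q) (hδ : 0 < δ) (q : ℕ) :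
    majorArc Q δ q ∪ minorArc Q δ q = {w | ‖w‖ < (q : ℝ)⁻¹ * Q ^ (-(1 / 2) + δ)} := by
  have h1 : (q : ℝ)⁻¹ * Q ^ (-1 - δ) ≤ (q : ℝ)⁻¹ * Q ^ (-(1 / 2) + δ) :=
    mul_le_mul_of_nonneg_left (Real.rpow_le_rpow_of_exponent_le hQ (by linarith)) (by positivity)
  ext w
  simp only [majorArc, minorArc, Set.mem_union, Set.mem_ofPred_eq]
  constructor
  · rintro (h | h)
    · exact h.trans_le h1
    · exact h.1
  · intro h
    rcases lt_or_ge ‖w‖ ((q : ℝ)⁻¹ * Q ^ (-1 - δ)) with h2 | h2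
    · exact Or.inl h2
    · exact Or.inr ⟨h, fun _ => h2⟩

theorem disjoint_majorArc_minorArc {Q δ : ℝ} {q : ℕ} (hq : (q : ℝ) ≤ Q ^ (1 / 2 - δ)) :
    Disjoint (majorArc Q δ q) (minorArc Q δ q) := by
  rw [Set.disjoint_left]
  intro w h1 h2
  exact absurd (h2.2 hq) (not_le.2 h1)

theorem minorArc_eq_of_lt {Q δ : ℝ} {q : ℕ} (hq : Q ^ (1 / 2 - δ) < q) :
    minorArc Q δ q = {w | ‖w‖ < (q : ℝ)⁻¹ * Q ^ (-(1 / 2) + δ)} := by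
  ext w
  simp only [minorArc, Set.mem_ofPred_eq]
  exact ⟨fun h => h.1, fun h => ⟨h, fun h' => absurd h' (not_le.2 hq)⟩⟩

theorem measurableSet_minorArc (Q δ : ℝ) (q : ℕ) : MeasurableSet (minorArc Q δ q) := by
  by_cases hq : (q : ℝ) ≤ Q ^ (1 / 2 - δ)
  · have : minorArc Q δ q = {w | ‖w‖ < (q : ℝ)⁻¹ * Q ^ (-(1 / 2) + δ)} ∩
        {w | (q : ℝ)⁻¹ * Q ^ (-1 - δ) ≤ ‖w‖} := by
      ext w
      simp only [minorArc, Set.mem_inter_iff, Set.mem_ofPred_eq]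
      exact ⟨fun h => ⟨h.1, h.2 hq⟩, fun h => ⟨h.1, fun _ => h.2⟩⟩
    rw [this]
    exact (measurableSet_lt measurable_norm measurable_const).inter
      (measurableSet_le measurable_const measurable_norm)
  · rw [minorArc_eq_of_lt (not_le.1 hq)]
    exact measurableSet_lt measurable_norm measurable_const

namespace Weights

variable {ω₀ ω : ℝ → ℝ} (hω : Weights ω₀ ω)
include hω

/-- The identity behind the decomposition: the difference is made up of the deviation of the
combined kernel from `1` on the major arcs and of the part of the expansion outside all arcs. -/
theorem M_add_E1_add_E2_eq {Q δ : ℝ} (hQ : 1 ≤ Q) (hδ : 0 < δ) (n : Fin 2 → ℤ) :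
    M Q δ n + E1 ω₀ ω Q δ n + E2 ω₀ ω Q δ n = synthesis ω₀ ω Q n -
      ∑ q ∈ Finset.Icc 1 ⌊Q⌋₊, ∑ a ∈ reduced q,
        (∫ w in {w : Plane | (q : ℝ)⁻¹ * Q ^ (-(1 / 2) + δ) ≤ ‖w‖},
          kernel ω₀ ω Q q a w * phase n q a w) -
      ∑ q ∈ Finset.Icc 1 ⌊Q ^ (1 / 2 - δ)⌋₊, ∑ a ∈ reduced q,
        ∫ w in majorArc Q δ q, (kernel ω₀ ω Q q a w - 1) * phase n q a w := by
  have hQ0 : 0 < Q := by linarith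
  have hsub : Finset.Icc 1 ⌊Q ^ (1 / 2 - δ)⌋₊ ⊆ Finset.Icc 1 ⌊Q⌋₊ := by
    refine Finset.Icc_subset_Icc_right (Nat.floor_le_floor ?_)
    calc Q ^ (1 / 2 - δ) ≤ Q ^ (1 : ℝ) :=
          Real.rpow_le_rpow_of_exponent_le hQ (by linarith)
      _ = Q := Real.rpow_one Q
  have hmem : ∀ q ∈ Finset.Icc 1 ⌊Q⌋₊, q ∈ Finset.Icc 1 ⌊Q ^ (1 / 2 - δ)⌋₊ ↔
      (q : ℝ) ≤ Q ^ (1 / 2 - δ) := by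
    intro q hq
    rw [Finset.mem_Icc, Nat.le_floor_iff (by positivity)]
    exact ⟨fun h => h.2, fun h => ⟨(Finset.mem_Icc.1 hq).1, h⟩⟩
  have hmajor : ∀ q ∈ Finset.Icc 1 ⌊Q ^ (1 / 2 - δ)⌋₊, ∀ a ∈ reduced q,
      ∫ w in majorArc Q δ q, phase n q a w =
      (∫ w in majorArc Q δ q, kernel ω₀ ω Q q a w * phase n q a w) -
        ∫ w in majorArc Q δ q, (kernel ω₀ ω Q q a w - 1) * phase n q a w := by
    intro q hq a _
    have hq1 := (Finset.mem_Icc.1 hq).1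
    have hfin : IntegrableOn (phase n q a) (majorArc Q δ q) := by
      have hsubset : majorArc Q δ q ⊆ Metric.closedBall 0 ((q : ℝ)⁻¹ * Q ^ (-1 - δ)) := by
        intro w hw
        rw [mem_closedBall_zero_iff]
        exact le_of_lt hw
      exact ((continuous_phase n q a).continuousOn.integrableOn_compact
        (isCompact_closedBall _ _)).mono_set hsubset
    have hk : IntegrableOn (fun w => kernel ω₀ ω Q q a w * phase n q a w) (majorArc Q δ q) :=
      (integrable_mul_phase (hω.integrable_kernel hQ hq1 a) n q a).integrableOn
    simp only [sub_mul, one_mul]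
    rw [integral_sub hk hfin]
    ring
  have hM : M Q δ n = (∑ q ∈ Finset.Icc 1 ⌊Q⌋₊, ∑ a ∈ reduced q,
      if (q : ℝ) ≤ Q ^ (1 / 2 - δ) then
        ∫ w in majorArc Q δ q, kernel ω₀ ω Q q a w * phase n q a w else 0) -
      ∑ q ∈ Finset.Icc 1 ⌊Q ^ (1 / 2 - δ)⌋₊, ∑ a ∈ reduced q,
        ∫ w in majorArc Q δ q, (kernel ω₀ ω Q q a w - 1) * phase n q a w := by
    rw [← Finset.sum_subset hsub fun q hq hq' => ?_, M, ← Finset.sum_sub_distrib]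
    · refine Finset.sum_congr rfl fun q hq => ?_
      rw [← Finset.sum_sub_distrib]
      refine Finset.sum_congr rfl fun a ha => ?_
      rw [hmajor q hq a ha, if_pos ((hmem q (hsub hq)).1 hq)]
    · refine Finset.sum_eq_zero fun a _ => if_neg fun h => hq' ((hmem q hq).2 h)
  have hball : ∀ q ∈ Finset.Icc 1 ⌊Q⌋₊, ∀ a ∈ reduced q,
      (if (q : ℝ) ≤ Q ^ (1 / 2 - δ) then
        ∫ w in majorArc Q δ q, kernel ω₀ ω Q q a w * phase n q a w else 0) +
      (∫ w in minorArc Q δ q, kernel ω₀ ω Q q a w * phase n q a w) =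
      (∫ w, kernel ω₀ ω Q q a w * phase n q a w) -
        ∫ w in {w : Plane | (q : ℝ)⁻¹ * Q ^ (-(1 / 2) + δ) ≤ ‖w‖},
          kernel ω₀ ω Q q a w * phase n q a w := by
    intro q hq a _
    have hint := integrable_mul_phase (hω.integrable_kernel hQ (Finset.mem_Icc.1 hq).1 a) n q a
    have hcompl : {w : Plane | (q : ℝ)⁻¹ * Q ^ (-(1 / 2) + δ) ≤ ‖w‖} =
        {w | ‖w‖ < (q : ℝ)⁻¹ * Q ^ (-(1 / 2) + δ)}ᶜ := by
      ext w
      simp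
    rw [hcompl, ← integral_add_compl (s := {w : Plane | ‖w‖ < (q : ℝ)⁻¹ * Q ^ (-(1 / 2) + δ)})
      (measurableSet_lt measurable_norm measurable_const) hint, add_sub_cancel_right]
    split_ifs with h
    · rw [← setIntegral_union (disjoint_majorArc_minorArc h) (measurableSet_minorArc Q δ q)
        hint.integrableOn hint.integrableOn, majorArc_union_minorArc hQ hδ q]
    · rw [minorArc_eq_of_lt (not_le.1 h), zero_add]
  rw [add_assoc, hω.E1_add_E2 hQ, hM, ← hω.sum_integral_kernel hQ, ← Finset.sum_sub_distrib,
    sub_add_eq_add_sub, ← Finset.sum_add_distrib]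
  congr 1
  refine Finset.sum_congr rfl fun q hq => ?_
  rw [← Finset.sum_add_distrib, ← Finset.sum_sub_distrib]
  exact Finset.sum_congr rfl fun a ha => hball q hq a ha

theorem exists_norm_delta_sub_le {δ : ℝ} (hδ : 0 < δ) (N : ℝ) :
    ∃ C, ∀ Q : ℝ, 1 ≤ Q → ∀ n : Fin 2 → ℤ,
      ‖delta n - (M Q δ n + E1 ω₀ ω Q δ n + E2 ω₀ ω Q δ n)‖ ≤ C * Q ^ (-(δ * N)) := by
  -- The exponent `m` absorbs the factor `Q⁴` lost by estimating trivially over fractions.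
  obtain ⟨m, hm⟩ := exists_nat_ge (N + 4 / δ)
  obtain ⟨m', hm'⟩ := exists_nat_ge (δ * N)
  obtain ⟨A, hA0, hA⟩ := hω.exists_norm_synthesis_sub_delta_le m'
  obtain ⟨B, hB0, hB⟩ := hω.exists_norm_integral_tail_le m
  obtain ⟨D, hD0, hD⟩ := hω.exists_norm_kernel_sub_one_le m
  set V : ℝ := volume.real (Metric.closedBall (0 : Plane) 1) with hV
  refine ⟨A + B + D * V, fun Q hQ n => ?_⟩
  have hQ0 : 0 < Q := by linarith
  set z := Q ^ δ with hz
  have hz1 : 1 ≤ z := Real.one_le_rpow hQ hδ.le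
  have hz0 : 0 < z := by linarith
  have hX0 : 0 < Q ^ (1 / 2 : ℝ) := by positivity
  have hzm : Q ^ 4 / z ^ m ≤ Q ^ (-(δ * N)) := by
    rw [hz, ← Real.rpow_natCast, ← Real.rpow_natCast, ← Real.rpow_mul hQ0.le, ← Real.rpow_sub hQ0]
    refine Real.rpow_le_rpow_of_exponent_le hQ ?_
    have h1 : δ * (N + 4 / δ) ≤ δ * m := by gcongr
    have h2 : δ * (N + 4 / δ) = δ * N + 4 := by field_simp
    push_cast
    linarith
  have hzm' : 1 / Q ^ m' ≤ Q ^ (-(δ * N)) := by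
    rw [one_div, ← Real.rpow_natCast, ← Real.rpow_neg hQ0.le]
    exact Real.rpow_le_rpow_of_exponent_le hQ (by linarith)
  have htail : ‖∑ q ∈ Finset.Icc 1 ⌊Q⌋₊, ∑ a ∈ reduced q,
      (∫ w in {w : Plane | (q : ℝ)⁻¹ * Q ^ (-(1 / 2) + δ) ≤ ‖w‖},
        kernel ω₀ ω Q q a w * phase n q a w)‖ ≤ Q ^ 3 * (B * Q / z ^ m) := by
    refine norm_sum_sum_reduced_le hQ0.le (by positivity) subset_rfl fun q hq a _ => ?_
    have hq1 := (Finset.mem_Icc.1 hq).1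
    have hq0 : (0 : ℝ) < q := by exact_mod_cast hq1
    refine hB Q hQ z hz1 q hq1 a n _ (measurableSet_le measurable_const measurable_norm)
      fun w hw => ?_
    have h1 : (q : ℝ)⁻¹ * Q ^ (-(1 / 2) + δ) ≤ ‖w‖ := hw
    rw [Real.rpow_add hQ0, Real.rpow_neg hQ0.le, ← hz] at h1
    calc z = (q : ℝ)⁻¹ * ((Q ^ (1 / 2 : ℝ))⁻¹ * z) * q * Q ^ (1 / 2 : ℝ) := by field_simp
      _ ≤ ‖w‖ * q * Q ^ (1 / 2 : ℝ) := by gcongr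
  have hmaj : ‖∑ q ∈ Finset.Icc 1 ⌊Q ^ (1 / 2 - δ)⌋₊, ∑ a ∈ reduced q,
      ∫ w in majorArc Q δ q, (kernel ω₀ ω Q q a w - 1) * phase n q a w‖ ≤
      Q ^ 3 * (D * Q / z ^ m * V) := by
    refine norm_sum_sum_reduced_le hQ0.le (by positivity) (Finset.Icc_subset_Icc_right
      (Nat.floor_le_floor ?_)) fun q hq a ha => ?_
    · calc Q ^ (1 / 2 - δ) ≤ Q ^ (1 : ℝ) :=
            Real.rpow_le_rpow_of_exponent_le hQ (by linarith)
        _ = Q := Real.rpow_one Q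
    obtain ⟨hq1, hq2⟩ := Finset.mem_Icc.1 hq
    have hq0 : (1 : ℝ) ≤ q := by exact_mod_cast hq1
    have hq0' : (0 : ℝ) < q := by linarith
    rw [Nat.le_floor_iff (by positivity), Real.rpow_sub hQ0, ← hz, le_div_iff₀ hz0] at hq2
    have hrad : ∀ w ∈ majorArc Q δ q, ‖w‖ * (q * (Q * z)) ≤ 1 := by
      intro w hw
      have h1 : ‖w‖ < (q : ℝ)⁻¹ * Q ^ (-1 - δ) := hw
      rw [sub_eq_add_neg, Real.rpow_add hQ0, Real.rpow_neg hQ0.le, Real.rpow_neg hQ0.le, ← hz,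
        Real.rpow_one] at h1
      calc ‖w‖ * (q * (Q * z)) ≤ (q : ℝ)⁻¹ * (Q⁻¹ * z⁻¹) * (q * (Q * z)) := by gcongr
        _ = 1 := by field_simp
    have hsubset : majorArc Q δ q ⊆ Metric.closedBall 0 1 := by
      intro w hw
      rw [mem_closedBall_zero_iff]
      have h1 : 1 ≤ (q : ℝ) * (Q * z) := one_le_mul_of_one_le_of_one_le hq0
        (one_le_mul_of_one_le_of_one_le hQ hz1)
      have h2 := hrad w hw
      nlinarith [norm_nonneg w]
    have hfin : volume (Metric.closedBall (0 : Plane) 1) < ⊤ :=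
      (isCompact_closedBall (0 : Plane) 1).measure_lt_top
    refine (norm_setIntegral_le_of_norm_le_const ((measure_mono hsubset).trans_lt hfin)
      (C := D * Q / z ^ m) fun w hw => ?_).trans ?_
    · rw [norm_mul, norm_phase, mul_one]
      exact hD Q hQ z hz1 q hq1 hq2 a ha w (hrad w hw)
    · exact mul_le_mul_of_nonneg_left (measureReal_mono hsubset hfin.ne) (by positivity)
  rw [hω.M_add_E1_add_E2_eq hQ hδ]
  set T := ∑ q ∈ Finset.Icc 1 ⌊Q⌋₊, ∑ a ∈ reduced q,
      (∫ w in {w : Plane | (q : ℝ)⁻¹ * Q ^ (-(1 / 2) + δ) ≤ ‖w‖},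
        kernel ω₀ ω Q q a w * phase n q a w)
  set U := ∑ q ∈ Finset.Icc 1 ⌊Q ^ (1 / 2 - δ)⌋₊, ∑ a ∈ reduced q,
      ∫ w in majorArc Q δ q, (kernel ω₀ ω Q q a w - 1) * phase n q a w
  have hS := hA Q hQ n
  rw [norm_sub_rev] at hS
  have hsplit : delta n - (synthesis ω₀ ω Q n - T - U) =
      (delta n - synthesis ω₀ ω Q n) + T + U := by
    ring
  rw [hsplit]
  refine norm_add₃_le.trans ?_
  calc _ ≤ A / Q ^ m' + Q ^ 3 * (B * Q / z ^ m) + Q ^ 3 * (D * Q / z ^ m * V) :=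
        add_le_add (add_le_add hS htail) hmaj
    _ = A * (1 / Q ^ m') + (B + D * V) * (Q ^ 4 / z ^ m) := by ring
    _ ≤ A * Q ^ (-(δ * N)) + (B + D * V) * Q ^ (-(δ * N)) := by
        have : 0 ≤ V := measureReal_nonneg
        gcongr
    _ = _ := by ring

end Weights

end DeltaSymbol

theorem proposition5p1 (ω₀ ω : ℝ → ℝ) (hω : DeltaSymbol.Weights ω₀ ω) :
    -- decay of the kernels `p_{1,q}`
    (∀ N : ℝ, 0 < N → ∃ C : ℝ, ∀ Q : ℝ, 1 ≤ Q → ∀ q : ℕ, 1 ≤ q → (q : ℝ) ≤ Q →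
      ∀ w : DeltaSymbol.Plane,
        ‖DeltaSymbol.p1 ω₀ ω Q q w‖ ≤
          C * (Q / (q * (1 + ‖w‖ * Q ^ (3 / 2 : ℝ))) *
            (1 + ‖w‖ * q * Q ^ (1 / 2 : ℝ)) ^ (-N))) ∧
    -- decay of the kernels `p_{2,r,k,q}`
    (∀ N : ℝ, 0 < N → ∃ C : ℝ, ∀ Q : ℝ, 1 ≤ Q → ∀ r : Fin 2 → ℤ,
      Q ^ (1 / 2 : ℝ) / 2 ≤ ‖DeltaSymbol.vec r‖ → ‖DeltaSymbol.vec r‖ ≤ Q ^ (1 / 2 : ℝ) →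
      ∀ k q : ℕ, 1 ≤ k → 1 ≤ q → ∀ w : DeltaSymbol.Plane,
        ‖DeltaSymbol.p2 ω₀ ω Q r k q w‖ ≤
          C * (1 + ‖w‖ * k * q * Q ^ (1 / 2 : ℝ) +
            |inner ℝ w (DeltaSymbol.perp (DeltaSymbol.vec r))| * Q) ^ (-N)) ∧
    -- the delta symbol
    ∃ δ₀ : ℝ, 0 < δ₀ ∧ ∀ δ : ℝ, 0 < δ → δ < δ₀ → ∀ N : ℝ, 0 < N →
      ∃ C : ℝ, ∀ Q : ℝ, 1 ≤ Q → ∀ n : Fin 2 → ℤ,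
        ‖DeltaSymbol.delta n -
            (DeltaSymbol.M Q δ n + DeltaSymbol.E1 ω₀ ω Q δ n + DeltaSymbol.E2 ω₀ ω Q δ n)‖ ≤
          C * Q ^ (-(δ * N)) := by
  refine ⟨fun N _ => ?_, fun N _ => ?_, 1 / 2, by norm_num,
    fun δ hδ _ N _ => hω.exists_norm_delta_sub_le hδ N⟩
  · obtain ⟨C, hC0, hC⟩ := hω.exists_norm_p1_le ⌈N⌉₊
    refine ⟨C, fun Q hQ q hq _ w => (hC Q hQ q hq w).trans ?_⟩
    gcongr
    exact DeltaSymbol.one_div_pow_ceil_le (by positivity) N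
  · obtain ⟨C, hC0, hC⟩ := hω.exists_norm_p2_le ⌈N⌉₊
    refine ⟨C, fun Q hQ r hr1 hr2 k q hk hq w =>
      (hC Q (by linarith) r hr1 hr2 k q hk hq w).trans ?_⟩
    refine mul_le_mul_of_nonneg_left ?_ hC0
    have h := DeltaSymbol.one_div_pow_ceil_le (t := ‖w‖ * k * q * Q ^ (1 / 2 : ℝ) +
      |inner ℝ w (DeltaSymbol.perp (DeltaSymbol.vec r))| * Q) (by positivity) N
    rwa [← add_assoc] at h
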